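/- Let $G$ be a noncompact connected Lie group with identity $e$ and Lie algebra $\mathfrak g$ (identified with the left-invariant vector fields), and let $\mu$ be a left Haar measure on $G$. Fix a scalar product on $\mathfrak g$ and a linear subspace $\mathcal H\subseteq\mathfrak g$ which generates $\mathfrak g$ as a Lie algebra, and let $X_1,\dots,X_\nu$ be an orthonormal basis of $\mathcal H$. Let $d$ be the associated left-invariant Carnot--Carathéodory distance, i.e. $d(x,y)$ is the infimum of $\int_0^1|\gamma'(t)|\,\mathrm dt$ over the absolutely continuous curves $\gamma\colon[0,1]\to G$ from $x$ to $y$ with $\gamma'(t)\in\mathcal H_{\gamma(t)}$ for almost every $t$, and let $B(x,r)=\{y\in G: d(x,y)<r\}$. Let $V\colon G\to\mathbb R$ be in $L^1_{\mathrm{loc}}(\mu)$ and essentially bounded from below, and let $\mathcal H_V$ be the self-adjoint operator on $L^2(\mu)$ (complex-valued functions) induced by the form \[ Q(f,g)=\int_G\Big(\sum_{j=1}^\nu (X_jf)\,\overline{X_jg}+Vf\overline g\Big)\,\mathrm d\mu,\qquad \mathrm{Dom}(Q)=\big\{f\in L^2: X_1f,\dots,X_\nu f\in L^2,\ |V|^{1/2}f\in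 L^2\big\}, \] where $X_jf$ is meant in the sense of distributions; that is, $f\in\mathrm{Dom}(\mathcal H_V)$ and $\mathcal H_Vf=h$ if and only if $f\in\mathrm{Dom}(Q)$, $h\in L^2$ and $Q(f,g)=\int_G h\overline g\,\mathrm d\mu$ for all $g\in\mathrm{Dom}(Q)$. If $\mathcal H_V$ has purely discrete spectrum, i.e. its spectrum is a discrete set and consists of eigenvalues of finite multiplicity, then for every $r>0$ \[ \lim_{x\to\infty}\int_{B(x,r)}V\,\mathrm d\mu=\infty , \] where $x\to\infty$ means that $x$ eventually leaves every compact subset of $G$. -/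

import Mathlib

open MeasureTheory Set Filter Topology
open scoped Manifold ContDiff ENNReal ComplexConjugate

noncomputable section

/-! ### Spectrum of an unbounded operator -/

namespace LinearPMap

variable {H : Type*} [NormedAddCommGroup H] [InnerProductSpace ℂ H]

/-- The resolvent set of an unbounded operator `T`: the `z : ℂ` such that
`T - z : Dom T → H` is a bijection whose inverse `R` is bounded on `H`. -/
def resolventSet (T : H →ₗ.[ℂ] H) : Set ℂ :=
  {z | ∃ R : H →L[ℂ] H,
    (∀ u : H, ∃ hu : R u ∈ T.domain, T ⟨R u, hu⟩ - z • R u = u) ∧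
    ∀ f : T.domain, R (T f - z • (f : H)) = f}

/-- The spectrum of an unbounded operator. -/
def unboundedSpectrum (T : H →ₗ.[ℂ] H) : Set ℂ := T.resolventSetᶜ

/-- The eigenspace `{f ∈ Dom T | T f = z f}`, as a subspace of the domain. -/
def eigenspace (T : H →ₗ.[ℂ] H) (z : ℂ) : Submodule ℂ T.domain :=
  LinearMap.ker (T.toFun - z • T.domain.subtype)

/-- The spectrum of `T` is purely discrete: it is a discrete set and consists of eigenvalues of
finite multiplicity. -/
def HasPurelyDiscreteSpectrum (T : H →ₗ.[ℂ] H) : Prop :=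
  DiscreteTopology T.unboundedSpectrum ∧
    ∀ z ∈ T.unboundedSpectrum, T.eigenspace z ≠ ⊥ ∧ FiniteDimensional ℂ (T.eigenspace z)

end LinearPMap

namespace SubRiem

/-- A smooth Lie group is regular enough to carry Mathlib's Lie algebra structure on the tangent
space at the identity. -/
instance instLEInftyMinSmoothness : ENat.LEInfty (minSmoothness ℝ 3) :=
  ⟨by rw [minSmoothness_of_isRCLikeNormedField]; exact ENat.LEInfty.out⟩

variable {n : ℕ} {G : Type*} [TopologicalSpace G] [ChartedSpace (EuclideanSpace ℝ (Fin n)) G]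
  [Group G]

/-! ### The Carnot–Carathéodory distance -/

/-- `γ : [0,1] → G` is an absolutely continuous curve (i.e. continuous, and absolutely continuous
when read through smooth functions) which for almost every `t` is differentiable with
`γ'(t) = (X_{u(t)})_{γ(t)}`, where `u(t) ∈ 𝓗` and `X_v` is the left-invariant vector field
with value `v` at the identity. In particular `u` is a.e. determined by `γ`. -/
structure IsHorizontalCurve (𝓗 : Submodule ℝ (GroupLieAlgebra (𝓡 n) G))
    (γ : ℝ → G) (u : ℝ → GroupLieAlgebra (𝓡 n) G) : Prop where
  continuousOn : ContinuousOn γ (Icc 0 1)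
  absolutelyContinuous : ∀ φ : G → ℝ, ContMDiff (𝓡 n) 𝓘(ℝ, ℝ) ∞ φ →
    AbsolutelyContinuousOnInterval (φ ∘ γ) 0 1
  velocity : ∀ᵐ t ∂(volume.restrict (Icc (0 : ℝ) 1)), u t ∈ 𝓗 ∧
    HasMFDerivAt 𝓘(ℝ, ℝ) (𝓡 n) γ t
      ((1 : ℝ →L[ℝ] ℝ).smulRight (mulInvariantVectorField (I := 𝓡 n) (u t) (γ t)))

/-- The length `∫₀¹ |γ'(t)| dt` of a horizontal curve with velocity `u` (read in the Lie algebra by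
left translation), for the left-invariant metric induced by the scalar product `ip`. -/
def curveLength (ip : InnerProductSpace.Core ℝ (GroupLieAlgebra (𝓡 n) G))
    (u : ℝ → GroupLieAlgebra (𝓡 n) G) : ℝ≥0∞ :=
  ∫⁻ t in Icc (0 : ℝ) 1, ENNReal.ofReal (√(ip.inner (u t) (u t)))

/-- The Carnot–Carathéodory distance, with values in `[0,∞]` (`∞` if there is no horizontal curve
from `x` to `y`). -/
def ccDist (ip : InnerProductSpace.Core ℝ (GroupLieAlgebra (𝓡 n) G))
    (𝓗 : Submodule ℝ (GroupLieAlgebra (𝓡 n) G)) (x y : G) : ℝ≥0∞ :=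
  ⨅ (γ : ℝ → G) (u : ℝ → GroupLieAlgebra (𝓡 n) G)
    (_ : IsHorizontalCurve 𝓗 γ u ∧ γ 0 = x ∧ γ 1 = y), curveLength ip u

/-- The open ball `B(x,r)` of the Carnot–Carathéodory distance. -/
def ccBall (ip : InnerProductSpace.Core ℝ (GroupLieAlgebra (𝓡 n) G))
    (𝓗 : Submodule ℝ (GroupLieAlgebra (𝓡 n) G)) (x : G) (r : ℝ) : Set G :=
  {y | ccDist ip 𝓗 x y < ENNReal.ofReal r}

/-! ### Left-invariant derivatives, classical and weak -/

/-- `(X φ)(x)`, for `X` in the Lie algebra seen as a left-invariant vector field. -/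
def fieldDeriv (X : GroupLieAlgebra (𝓡 n) G) (φ : G → ℂ) (x : G) : ℂ :=
  mfderiv (𝓡 n) 𝓘(ℝ, ℂ) φ x (mulInvariantVectorField (I := 𝓡 n) X x)

/-- The space `C_c^∞(G)` of complex-valued test functions. -/
def IsTestFun (n : ℕ) {G : Type*} [TopologicalSpace G]
    [ChartedSpace (EuclideanSpace ℝ (Fin n)) G] (φ : G → ℂ) : Prop :=
  ContMDiff (𝓡 n) 𝓘(ℝ, ℂ) ∞ φ ∧ HasCompactSupport φ

theorem IsTestFun.continuous {n : ℕ} {G : Type*} [TopologicalSpace G]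
    [ChartedSpace (EuclideanSpace ℝ (Fin n)) G] {φ : G → ℂ} (h : IsTestFun n φ) :
    Continuous φ := h.1.continuous

theorem IsTestFun.hasCompactSupport_fieldDeriv {φ : G → ℂ} (h : IsTestFun n φ)
    (X : GroupLieAlgebra (𝓡 n) G) : HasCompactSupport (fieldDeriv X φ) := by
  refine h.2.mono' fun x hx => ?_
  by_contra hx'
  apply hx
  have : φ =ᶠ[𝓝 x] fun _ => 0 := notMem_tsupport_iff_eventuallyEq.1 hx'
  simp only [fieldDeriv]
  rw [this.mfderiv_eq, mfderiv_const]
  rfl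

variable [LieGroup (𝓡 n) ∞ G]

/-- The modular function `δ`, normalised by `μ(A x) = δ(x) μ(A)` for left Haar measures `μ`
(Mathlib's `modularCharacterFun g` is the ratio `μ(A g⁻¹) / μ(A)`). -/
def modularFun (n : ℕ) {G : Type*} [TopologicalSpace G]
    [ChartedSpace (EuclideanSpace ℝ (Fin n)) G] [Group G] [LieGroup (𝓡 n) ∞ G] (x : G) : ℝ :=
  haveI : IsTopologicalGroup G := topologicalGroup_of_lieGroup (𝓡 n) ∞
  haveI : LocallyCompactSpace G := Manifold.locallyCompact_of_finiteDimensional (𝓡 n)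
  (Measure.modularCharacterFun x⁻¹ : ℝ)

/-- The constant `c_X = (X δ)(e)`; the formal adjoint of `X` in `L²(μ)` is `-(X + c_X)`. -/
def modularDeriv (X : GroupLieAlgebra (𝓡 n) G) : ℝ :=
  mfderiv (𝓡 n) 𝓘(ℝ, ℝ) (modularFun n : G → ℝ) 1 X

theorem IsTestFun.continuous_fieldDeriv {φ : G → ℂ} (h : IsTestFun n φ)
    (X : GroupLieAlgebra (𝓡 n) G) : Continuous (fieldDeriv X φ) := by
  have h1 := h.1.continuous_tangentMap (by simp)
  have h2 := (contMDiff_mulInvariantVectorField (I := 𝓡 n) (G := G) X).continuous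
  have h3 := (tangentBundleModelSpaceHomeomorph 𝓘(ℝ, ℂ)).continuous
  exact (continuous_snd.comp (h3.comp (h1.comp h2)) :)

variable [MeasurableSpace G] [BorelSpace G] (μ : Measure G) [μ.IsHaarMeasure]

theorem integrable_Lp_mul {φ : G → ℂ} (h : Continuous φ) (h' : HasCompactSupport φ)
    (f : Lp ℂ 2 μ) : Integrable (fun x => f x * φ x) μ :=
  (Lp.memLp f).integrable_mul (q := 2) (h.memLp_of_hasCompactSupport h')

/-- The graph of the weak derivative along `X` on `L²(μ)`: the pairs `(f, g)` with `X f = g` in the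
sense of distributions, i.e. `∫ g φ dμ = -∫ f (X φ + c_X φ) dμ` for all `φ ∈ C_c^∞(G)`. -/
def weakDerivGraph (X : GroupLieAlgebra (𝓡 n) G) : Submodule ℂ (Lp ℂ 2 μ × Lp ℂ 2 μ) where
  carrier := {p | ∀ φ : G → ℂ, IsTestFun n φ →
    ∫ x, p.2 x * φ x ∂μ = -∫ x, p.1 x * (fieldDeriv X φ x + modularDeriv X * φ x) ∂μ}
  zero_mem' := by
    intro φ _
    have h0 : ∀ ψ : G → ℂ, ∫ x, (0 : Lp ℂ 2 μ) x * ψ x ∂μ = 0 := fun ψ => by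
      rw [← integral_zero G ℂ (μ := μ)]
      refine integral_congr_ae ?_
      filter_upwards [Lp.coeFn_zero ℂ 2 μ] with x hx
      rw [hx, Pi.zero_apply, zero_mul]
    simp only [Prod.fst_zero, Prod.snd_zero]
    rw [h0, h0, neg_zero]
  add_mem' := by
    intro p q hp hq φ hφ
    have hadd : ∀ (f g : Lp ℂ 2 μ) (ψ : G → ℂ), Continuous ψ → HasCompactSupport ψ →
        ∫ x, (f + g) x * ψ x ∂μ = ∫ x, f x * ψ x ∂μ + ∫ x, g x * ψ x ∂μ := by
      intro f g ψ h h'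
      rw [← integral_add (integrable_Lp_mul μ h h' f) (integrable_Lp_mul μ h h' g)]
      refine integral_congr_ae ?_
      filter_upwards [Lp.coeFn_add f g] with x hx
      rw [hx, Pi.add_apply, add_mul]
    simp only [Prod.fst_add, Prod.snd_add]
    rw [hadd _ _ _ hφ.continuous hφ.2, hadd _ _
      (fun x => fieldDeriv X φ x + modularDeriv X * φ x) ((hφ.continuous_fieldDeriv X).add (continuous_const.mul hφ.continuous))
      ((hφ.hasCompactSupport_fieldDeriv X).add hφ.2.mul_left), hp φ hφ, hq φ hφ, neg_add]
  smul_mem' := by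
    intro c p hp φ hφ
    have hsmul : ∀ (f : Lp ℂ 2 μ) (ψ : G → ℂ),
        ∫ x, (c • f) x * ψ x ∂μ = c * ∫ x, f x * ψ x ∂μ := by
      intro f ψ
      rw [← integral_const_mul]
      refine integral_congr_ae ?_
      filter_upwards [Lp.coeFn_smul c f] with x hx
      simp [hx, mul_assoc]
    simp only [Prod.smul_fst, Prod.smul_snd]
    rw [hsmul, hsmul, hp φ hφ, mul_neg]

/-- The weak derivative along the left-invariant field `X`, as an unbounded operator on `L²(μ)`
with its maximal domain `{f ∈ L² | X f ∈ L²}`. -/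
def weakDeriv (X : GroupLieAlgebra (𝓡 n) G) : Lp ℂ 2 μ →ₗ.[ℂ] Lp ℂ 2 μ :=
  (weakDerivGraph μ X).toLinearPMap

/-! ### The form `Q` and the Schrödinger operator -/

variable {ν : ℕ} (X : Fin ν → GroupLieAlgebra (𝓡 n) G) (V : G → ℝ)

/-- `Dom(Q) = {f ∈ L² | ∇f ∈ L², |V|^{1/2} f ∈ L²}`, the horizontal gradient being
`∇f = ∑ j, (X j f) X j`. -/
def formDomain : Submodule ℂ (Lp ℂ 2 μ) where
  carrier := {f | (∀ j, f ∈ (weakDeriv μ (X j)).domain) ∧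
    MemLp (fun x => (√|V x| : ℂ) * f x) 2 μ}
  zero_mem' := by
    refine ⟨fun j => Submodule.zero_mem _, (memLp_congr_ae ?_).2 (MemLp.zero (μ := μ))⟩
    filter_upwards [Lp.coeFn_zero ℂ 2 μ] with x hx
    rw [hx, Pi.zero_apply, mul_zero]
  add_mem' := by
    intro f g hf hg
    refine ⟨fun j => Submodule.add_mem _ (hf.1 j) (hg.1 j),
      (memLp_congr_ae ?_).2 (hf.2.add hg.2)⟩
    filter_upwards [Lp.coeFn_add f g] with x hx
    rw [hx]
    simp only [Pi.add_apply, mul_add]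
  smul_mem' := by
    intro c f hf
    refine ⟨fun j => Submodule.smul_mem _ c (hf.1 j), (memLp_congr_ae ?_).2 (hf.2.const_smul c)⟩
    filter_upwards [Lp.coeFn_smul c f] with x hx
    simp [hx]
    ring

/-- The component `X j f` of the weak horizontal gradient, on `Dom(Q)`. -/
def weakGrad (j : Fin ν) : formDomain μ X V →ₗ[ℂ] Lp ℂ 2 μ :=
  (weakDeriv μ (X j)).toFun ∘ₗ Submodule.inclusion (fun _ hf => hf.1 j)

/-- The form `Q(f,g) = ∫ (∇f · ∇ḡ + V f ḡ) dμ` on `Dom(Q)`. -/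
def form (f g : formDomain μ X V) : ℂ :=
  ∫ x, ((∑ j, weakGrad μ X V j f x * conj (weakGrad μ X V j g x)) +
    (V x : ℂ) * (f : Lp ℂ 2 μ) x * conj ((g : Lp ℂ 2 μ) x)) ∂μ

theorem form_integrable (hV : AEStronglyMeasurable V μ) (f g : formDomain μ X V) :
    Integrable (fun x => (∑ j, weakGrad μ X V j f x * conj (weakGrad μ X V j g x)) +
      (V x : ℂ) * (f : Lp ℂ 2 μ) x * conj ((g : Lp ℂ 2 μ) x)) μ := by
  refine Integrable.add (integrable_finsetSum _ fun j _ => ?_) ?_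
  · exact (Lp.memLp (weakGrad μ X V j f)).integrable_mul (Lp.memLp (weakGrad μ X V j g)).star
  · have h := f.2.2.integrable_mul g.2.2.star
    refine h.norm.mono' ?_ (Eventually.of_forall fun x => le_of_eq ?_)
    · exact ((Complex.continuous_ofReal.comp_aestronglyMeasurable hV).mul
        (Lp.aestronglyMeasurable _)).mul (Lp.memLp _).star.1
    · have hs : √|V x| * √|V x| = |V x| := Real.mul_self_sqrt (abs_nonneg _)
      simp only [Pi.mul_apply, Pi.star_apply, norm_mul, norm_star, RCLike.norm_conj,
        Complex.norm_real, Real.norm_eq_abs, abs_of_nonneg (Real.sqrt_nonneg _)]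
      linear_combination -(‖(f : Lp ℂ 2 μ) x‖ * ‖(g : Lp ℂ 2 μ) x‖) * hs

theorem form_add_left (hV : AEStronglyMeasurable V μ) (f f' g : formDomain μ X V) :
    form μ X V (f + f') g = form μ X V f g + form μ X V f' g := by
  rw [form, form, form, ← integral_add (form_integrable μ X V hV f g)
    (form_integrable μ X V hV f' g)]
  refine integral_congr_ae ?_
  have h := ae_all_iff.2 fun j => Lp.coeFn_add (weakGrad μ X V j f) (weakGrad μ X V j f')
  filter_upwards [h, Lp.coeFn_add (f : Lp ℂ 2 μ) f'] with x hx hx'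
  simp only [map_add, Submodule.coe_add, hx, hx', Pi.add_apply, add_mul, mul_add,
    Finset.sum_add_distrib]
  ring

theorem form_smul_left (c : ℂ) (f g : formDomain μ X V) :
    form μ X V (c • f) g = c * form μ X V f g := by
  rw [form, form, ← integral_const_mul]
  refine integral_congr_ae ?_
  have h := ae_all_iff.2 fun j => Lp.coeFn_smul c (weakGrad μ X V j f)
  filter_upwards [h, Lp.coeFn_smul c (f : Lp ℂ 2 μ)] with x hx hx'
  simp only [map_smul, Submodule.coe_smul, hx, hx', Pi.smul_apply, smul_eq_mul, mul_add,
    Finset.mul_sum, mul_assoc, mul_left_comm c]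

variable {V} [SecondCountableTopology G] (hV : LocallyIntegrable V μ)

/-- The graph of the operator induced by `Q`: the pairs `(f, h)` with `f ∈ Dom(Q)`, `h ∈ L²` and
`Q(f,g) = ⟨h,g⟩ = ∫ h ḡ dμ` for all `g ∈ Dom(Q)`. -/
def schrodingerGraph : Submodule ℂ (Lp ℂ 2 μ × Lp ℂ 2 μ) where
  carrier := {p | ∃ f : formDomain μ X V, (f : Lp ℂ 2 μ) = p.1 ∧
    ∀ g : formDomain μ X V, form μ X V f g = inner ℂ (g : Lp ℂ 2 μ) p.2}
  zero_mem' := by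
    refine ⟨0, rfl, fun g => ?_⟩
    rw [← zero_smul ℂ (0 : formDomain μ X V), form_smul_left]
    simp
  add_mem' := by
    rintro p q ⟨f, hf, hf'⟩ ⟨f₁, hf₁, hf₁'⟩
    refine ⟨f + f₁, by simp [hf, hf₁], fun g => ?_⟩
    rw [form_add_left μ X V hV.aestronglyMeasurable, hf', hf₁', Prod.snd_add, inner_add_right]
  smul_mem' := by
    rintro c p ⟨f, hf, hf'⟩
    refine ⟨c • f, by simp [hf], fun g => ?_⟩
    rw [form_smul_left, hf', Prod.smul_snd, inner_smul_right]

/-- The Schrödinger operator `H_V` induced by the form `Q` on `L²(μ)`. -/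
def schrodinger : Lp ℂ 2 μ →ₗ.[ℂ] Lp ℂ 2 μ := (schrodingerGraph μ X hV).toLinearPMap

end SubRiem

end

/-! ### Resolvents of symmetric operators with purely discrete spectrum -/

/-! Suppose that the conclusion fails for some `r`. Then there are a constant `M` and points `x`,
arbitrarily far out, at which the integral of `V` over `B(x,r)` is below `M`. Take a smooth bump `φ`
supported in `B(e,r)` and translate it to a sequence `x k` of such points, so sparse that the
supports are disjoint (`exists_seq_disjoint`). By left invariance all translates have the same `L²`
norm and the same kinetic energy. Since `V ≥ c` and `0 ≤ φ ≤ 1`, their potential energies are at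
most `M` plus a constant (`integral_mul_le_setIntegral`). After normalisation this is an orthonormal
sequence along which `Q` is bounded above.

Purely discrete spectrum forbids this (`not_bddAbove_form_orthonormal`). For real `z` below the
lower bound of the form the resolvent `R` exists, because every spectral point is an eigenvalue and
an eigenvalue below the bound is impossible. It is a norm limit of finite-rank operators
(`LinearPMap.IsResolvent.exists_finiteRank_approx`), hence `⟨f_k, R f_k⟩ → 0` along orthonormal
sequences. But `1 ≤ C ⟨f, R f⟩` for every unit vector with `Q(f,f) - z ≤ C`
(`one_le_mul_re_inner_resolvent`).

The geometric input is twofold. Balls are neighbourhoods of their centres (`ccBall_one_mem_nhds`,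
Chow's theorem), so that the bump exists; and `B(x,r)` lies in `xK` for one fixed compact `K`
(`exists_isCompact_ccBall_subset`), so that the constants do not depend on `x`. The analytic input
is that test functions belong to `Dom(Q)` with their classical derivatives. This rests on
integration by parts with the modular correction (`IsTestFun.integral_fieldDeriv_mul`), as `G` need
not be unimodular. -/

theorem LinearMap.finiteDimensional_ker_comp {K V₁ V₂ V₃ : Type*} [Field K] [AddCommGroup V₁]
    [Module K V₁] [AddCommGroup V₂] [Module K V₂] [AddCommGroup V₃] [Module K V₃]
    (g : V₂ →ₗ[K] V₃) (f : V₁ →ₗ[K] V₂) [FiniteDimensional K (LinearMap.ker f)]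
    [FiniteDimensional K (LinearMap.ker g)] : FiniteDimensional K (LinearMap.ker (g ∘ₗ f)) := by
  rw [← Submodule.fg_iff_finiteDimensional]
  refine Submodule.fg_of_fg_map_of_fg_inf_ker f ?_ ?_
  · rw [Submodule.fg_iff_finiteDimensional]
    refine Submodule.finiteDimensional_of_le (S₂ := LinearMap.ker g) ?_
    rintro _ ⟨x, hx, rfl⟩
    exact hx
  · rw [Submodule.fg_iff_finiteDimensional]
    exact Submodule.finiteDimensional_of_le (S₂ := LinearMap.ker f) inf_le_right

/-- Bessel's inequality: `⟨e k, b⟩ → 0` for each of the finitely many vectors `b` of an orthonormal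
basis of the range. -/
theorem Orthonormal.tendsto_inner_of_finiteDimensional {H : Type*} [NormedAddCommGroup H]
    [InnerProductSpace ℂ H] {e : ℕ → H} (he : Orthonormal ℂ e) (F : H →L[ℂ] H)
    (hF : FiniteDimensional ℂ (LinearMap.range (F : H →ₗ[ℂ] H))) :
    Tendsto (fun k => inner ℂ (e k) (F (e k))) atTop (𝓝 0) := by
  set E := LinearMap.range (F : H →ₗ[ℂ] H)
  let b := stdOrthonormalBasis ℂ E
  have hexp : ∀ u : H, F u = ∑ i, inner ℂ (b i : H) (F u) • (b i : H) := fun u => by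
    have := congrArg (Subtype.val) (b.sum_repr' (⟨F u, ⟨u, rfl⟩⟩ : E))
    simpa using this.symm
  have hb : ∀ i, Tendsto (fun k => ‖inner ℂ (e k) (b i : H)‖) atTop (𝓝 0) := fun i => by
    have h := (he.inner_products_summable (b i : H)).tendsto_atTop_zero
    have h2 := (Real.continuous_sqrt.tendsto 0).comp h
    simpa [Function.comp_def, Real.sqrt_sq (norm_nonneg _)] using h2
  have hsum : Tendsto (fun k => ∑ i, ‖F‖ * ‖inner ℂ (e k) (b i : H)‖) atTop (𝓝 0) := by
    simpa using tendsto_finsetSum Finset.univ fun i _ => (hb i).const_mul ‖F‖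
  refine squeeze_zero_norm (fun k => ?_) hsum
  rw [hexp (e k), inner_sum]
  refine (norm_sum_le _ _).trans (Finset.sum_le_sum fun i _ => ?_)
  rw [inner_smul_right, norm_mul]
  gcongr
  refine (norm_inner_le_norm _ _).trans ?_
  have h1 : ‖(b i : H)‖ = 1 := b.orthonormal.1 i
  rw [h1, one_mul]
  simpa [he.1 k] using F.le_opNorm (e k)

/-- This function vanishes on `[-ε, ε]` and stays within `ε` of the identity. Applied to the
resolvent it discards the spectrum near `0`. -/
theorem continuous_softThreshold (ε : ℝ) :
    Continuous fun x : ℝ => x - max (-ε) (min x ε) := by fun_prop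

namespace LinearPMap

variable {H : Type*} [NormedAddCommGroup H] [InnerProductSpace ℂ H] {T : H →ₗ.[ℂ] H}

/-- `R` is the (everywhere defined, bounded) inverse of `T - z`. -/
def IsResolvent (T : H →ₗ.[ℂ] H) (z : ℂ) (R : H →L[ℂ] H) : Prop :=
  (∀ u : H, ∃ hu : R u ∈ T.domain, T ⟨R u, hu⟩ - z • R u = u) ∧
    ∀ f : T.domain, R (T f - z • (f : H)) = f

/-- The first resolvent identity: apply `R (T - z) = 1` to `S u`. -/
theorem IsResolvent.mul_eq {z w : ℂ} {R S : H →L[ℂ] H} (hR : T.IsResolvent z R)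
    (hS : T.IsResolvent w S) : (w - z) • (R * S) = S - R := by
  ext u
  obtain ⟨hu, h⟩ := hS.1 u
  have h2 := hR.2 ⟨S u, hu⟩
  have h3 : T ⟨S u, hu⟩ - z • S u = u + (w - z) • S u := by
    rw [sub_eq_iff_eq_add.1 h]; module
  simp only at h2
  rw [h3, _root_.map_add, _root_.map_smul] at h2
  change (w - z) • R (S u) = S u - R u
  nth_rewrite 2 [← h2]
  abel

/-- With `S` the resolvent at `z + w⁻¹`, the inverse of `w - R` is `w⁻¹ + w⁻² S`. -/
theorem IsResolvent.isUnit_sub {z : ℂ} {R : H →L[ℂ] H} (hR : T.IsResolvent z R) {w : ℂ}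
    (hw : w ≠ 0) (hmem : z + w⁻¹ ∈ T.resolventSet) : w ∉ spectrum ℂ R := by
  obtain ⟨S, hS⟩ := hmem
  have hS : T.IsResolvent (z + w⁻¹) S := hS
  have h1 : R * S = w • (S - R) := by
    rw [← hR.mul_eq hS, smul_smul]; simp [hw]
  have h2 : S * R = w • (S - R) := by
    have := hS.mul_eq hR
    rw [← neg_sub R S, ← this, ← neg_smul, smul_smul]
    simp [hw]
  rw [spectrum.notMem_iff, Algebra.algebraMap_eq_smul_one]
  refine ⟨⟨w • 1 - R, w⁻¹ • 1 + (w⁻¹ * w⁻¹) • S, ?_, ?_⟩, rfl⟩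
  · simp only [sub_mul, mul_add, smul_mul_assoc, mul_smul_comm, one_mul, mul_one, h1, smul_smul,
      smul_sub]
    rw [show w⁻¹ * w⁻¹ * w = w⁻¹ by field_simp, inv_mul_cancel₀ hw]
    module
  · simp only [mul_sub, add_mul, smul_mul_assoc, mul_smul_comm, one_mul, mul_one, h2, smul_smul,
      smul_sub]
    rw [show w⁻¹ * w⁻¹ * w = w⁻¹ by field_simp, smul_add, smul_smul, smul_smul,
      show w * (w⁻¹ * w⁻¹) = w⁻¹ by field_simp, mul_inv_cancel₀ hw]
    module

theorem IsResolvent.isSymmetric {z : ℝ} {R : H →L[ℂ] H} (hR : T.IsResolvent (z : ℂ) R)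
    (hT : ∀ f g : T.domain, inner ℂ (T f) (g : H) = inner ℂ (f : H) (T g)) :
    (R : H →ₗ[ℂ] H).IsSymmetric := by
  intro u v
  obtain ⟨hu, h⟩ := hR.1 u
  obtain ⟨hv, h'⟩ := hR.1 v
  have := hT ⟨R u, hu⟩ ⟨R v, hv⟩
  simp only [ContinuousLinearMap.coe_coe]
  calc inner ℂ (R u) v = inner ℂ (R u) (T ⟨R v, hv⟩ - (z : ℂ) • R v) := by rw [h']
    _ = inner ℂ (T ⟨R u, hu⟩ - (z : ℂ) • R u) (R v) := by
      rw [inner_sub_left, inner_sub_right, inner_smul_left, inner_smul_right, Complex.conj_ofReal]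
      exact congrArg (· - _) this.symm
    _ = inner ℂ u (R v) := by rw [h]

/-- If `R f = w f` with `w ≠ 0`, then `f = R (w⁻¹ f)` lies in the domain of `T` and is an
eigenvector for `z + w⁻¹`. -/
theorem IsResolvent.finiteDimensional_ker {z : ℂ} {R : H →L[ℂ] H} (hR : T.IsResolvent z R) {w : ℂ}
    (hw : w ≠ 0) (hfin : FiniteDimensional ℂ (T.eigenspace (z + w⁻¹))) :
    FiniteDimensional ℂ (LinearMap.ker ((R - w • 1 : H →L[ℂ] H) : H →ₗ[ℂ] H)) := by
  have hle : LinearMap.ker ((R - w • 1 : H →L[ℂ] H) : H →ₗ[ℂ] H) ≤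
      (T.eigenspace (z + w⁻¹)).map T.domain.subtype := by
    intro f hf
    have hf' : R f = w • f := by
      simpa [sub_eq_zero] using hf
    obtain ⟨hu, h⟩ := hR.1 (w⁻¹ • f)
    have h1 : R (w⁻¹ • f) = f := by rw [_root_.map_smul, hf', smul_smul, inv_mul_cancel₀ hw, one_smul]
    refine ⟨⟨R (w⁻¹ • f), hu⟩, ?_, h1⟩
    simp only [eigenspace, SetLike.mem_coe, LinearMap.mem_ker, LinearMap.sub_apply,
      LinearMap.smul_apply, Submodule.subtype_apply]
    have : T ⟨R (w⁻¹ • f), hu⟩ = w⁻¹ • f + z • R (w⁻¹ • f) := sub_eq_iff_eq_add.1 h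
    change T ⟨R (w⁻¹ • f), hu⟩ - _ = 0
    rw [this, h1]
    module
  exact Submodule.finiteDimensional_of_le hle

variable [CompleteSpace H]

/-- The map `w ↦ z + w⁻¹` is a continuous injection of this compact set into the discrete spectrum
of `T`; a compact discrete set is finite. -/
theorem IsResolvent.finite_spectrum {z : ℝ} {R : H →L[ℂ] H} (hR : T.IsResolvent (z : ℂ) R)
    (hdisc : DiscreteTopology T.unboundedSpectrum) {ε : ℝ} (hε : 0 < ε) :
    {w ∈ spectrum ℝ R | ε ≤ |w|}.Finite := by
  have hcomp : IsCompact {w ∈ spectrum ℝ R | ε ≤ |w|} :=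
    (spectrum.isCompact (𝕜 := ℝ) R).inter_right (isClosed_le continuous_const continuous_abs)
  have hne : ∀ w ∈ {w ∈ spectrum ℝ R | ε ≤ |w|}, w ≠ 0 := by
    rintro w ⟨-, hw⟩ rfl
    simp at hw; linarith
  have hmem : ∀ w ∈ {w ∈ spectrum ℝ R | ε ≤ |w|}, ((z : ℂ) + (w : ℂ)⁻¹) ∈ T.unboundedSpectrum := by
    intro w hw hw'
    refine hR.isUnit_sub (by exact_mod_cast hne w hw) hw' ?_
    exact (spectrum.algebraMap_mem_iff ℂ (R := ℝ)).2 hw.1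
  let φ : {w ∈ spectrum ℝ R | ε ≤ |w|} → T.unboundedSpectrum := fun w => ⟨_, hmem w w.2⟩
  have hφ : Continuous φ := by
    refine Continuous.subtype_mk (continuous_const.add (Continuous.inv₀ (by fun_prop) ?_)) _
    intro w
    exact_mod_cast hne w w.2
  have hinj : Function.Injective φ := by
    intro a b hab
    have := congrArg Subtype.val hab
    simp only [φ, add_right_inj, inv_inj, Complex.ofReal_inj] at this
    exact Subtype.ext this
  have : DiscreteTopology {w ∈ spectrum ℝ R | ε ≤ |w|} := DiscreteTopology.of_continuous_injective hφ hinj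
  exact hcomp.finite ⟨this⟩

/-- The approximant is `k(R)`, with `k` the soft threshold. On the spectrum of `R`, `k` vanishes
except at finitely many points `w`, so `∏ (R - w)` annihilates `k(R)`. The range of `k(R)` therefore
lies in the kernel of that product, which is finite-dimensional because each factor has a
finite-dimensional kernel. No spectral projections are needed. -/
theorem IsResolvent.exists_finiteRank_approx {z : ℝ} {R : H →L[ℂ] H}
    (hR : T.IsResolvent (z : ℂ) R)
    (hT : ∀ f g : T.domain, inner ℂ (T f) (g : H) = inner ℂ (f : H) (T g))
    (hdisc : T.HasPurelyDiscreteSpectrum) {ε : ℝ} (hε : 0 < ε) :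
    ∃ F : H →L[ℂ] H, ‖R - F‖ ≤ ε ∧ FiniteDimensional ℂ (LinearMap.range (F : H →ₗ[ℂ] H)) := by
  have hsa : IsSelfAdjoint R :=
    ContinuousLinearMap.isSelfAdjoint_iff_isSymmetric.2 (hR.isSymmetric hT)
  have hfin := hR.finite_spectrum hdisc.1 hε
  set k : ℝ → ℝ := fun x => x - max (-ε) (min x ε) with hk
  have hkc : Continuous k := continuous_softThreshold ε
  refine ⟨cfc k R, ?_, ?_⟩
  · have h1 : R - cfc k R = cfc (fun x => x - k x) R := by
      conv_lhs => rw [← cfc_id' ℝ R]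
      rw [cfc_sub (fun x : ℝ => x) k R (by fun_prop) hkc.continuousOn, cfc_id' ℝ R]
    rw [h1]
    refine norm_cfc_le hε.le fun x _ => ?_
    simp only [hk, sub_sub_cancel, Real.norm_eq_abs]
    exact abs_le.2 ⟨le_max_left _ _, max_le (by linarith) (min_le_right _ _)⟩
  · set S := hfin.toFinset
    have hprod : ∀ s : Finset ℝ, s ⊆ S → FiniteDimensional ℂ
        (LinearMap.ker ((cfc (fun x => ∏ w ∈ s, (x - w)) R : H →L[ℂ] H) : H →ₗ[ℂ] H)) := by
      intro s
      induction s using Finset.induction_on with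
      | empty =>
        intro _
        have h1 : cfc (fun x : ℝ => ∏ w ∈ (∅ : Finset ℝ), (x - w)) R = 1 := by
          simpa using cfc_const_one ℝ R
        have h2 : LinearMap.ker ((1 : H →L[ℂ] H) : H →ₗ[ℂ] H) = ⊥ := LinearMap.ker_id
        rw [h1, h2]
        infer_instance
      | insert a s ha ih =>
        intro hs
        have := ih ((Finset.subset_insert _ _).trans hs)
        have haS : a ∈ {w ∈ spectrum ℝ R | ε ≤ |w|} := by
          simpa [S] using hs (Finset.mem_insert_self a s)
        have ha0 : (a : ℂ) ≠ 0 := by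
          rintro h
          have : a = 0 := by exact_mod_cast h
          have h2 := haS.2
          simp [this] at h2; linarith
        have hmem : ((z : ℂ) + (a : ℂ)⁻¹) ∈ T.unboundedSpectrum := fun hw' =>
          hR.isUnit_sub ha0 hw' ((spectrum.algebraMap_mem_iff ℂ (R := ℝ)).2 haS.1)
        have h1 := hR.finiteDimensional_ker ha0 (hdisc.2 _ hmem).2
        have h2 : cfc (fun x => ∏ w ∈ insert a s, (x - w)) R
            = (R - (a : ℂ) • 1) * cfc (fun x => ∏ w ∈ s, (x - w)) R := by
          simp only [Finset.prod_insert ha]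
          rw [cfc_mul (fun x : ℝ => x - a) _ R (by fun_prop) (by fun_prop),
            cfc_sub (fun x : ℝ => x) (fun _ => a) R (by fun_prop) (by fun_prop), cfc_id' ℝ R,
            cfc_const a R, Algebra.algebraMap_eq_smul_one]
          rfl
        rw [h2]
        exact LinearMap.finiteDimensional_ker_comp
          ((R - (a : ℂ) • 1 : H →L[ℂ] H) : H →ₗ[ℂ] H)
          ((cfc (fun x => ∏ w ∈ s, (x - w)) R : H →L[ℂ] H) : H →ₗ[ℂ] H)
    have := hprod S subset_rfl
    refine Submodule.finiteDimensional_of_le (S₂ := LinearMap.ker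
      ((cfc (fun x => ∏ w ∈ S, (x - w)) R : H →L[ℂ] H) : H →ₗ[ℂ] H)) ?_
    rintro _ ⟨u, rfl⟩
    -- The product of the two functions vanishes on the spectrum: the first factor where `ε ≤ |x|`,
    -- the second elsewhere.
    have hz : cfc (fun x => ∏ w ∈ S, (x - w)) R * cfc k R = 0 := by
      rw [← cfc_mul _ k R (by fun_prop) hkc.continuousOn]
      rw [cfc_congr (g := fun _ => (0 : ℝ)), cfc_const_zero ℝ R]
      intro x hx
      by_cases hxe : ε ≤ |x|
      · have : x ∈ S := by simp [S, hx, hxe]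
        simp [Finset.prod_eq_zero this (sub_self x)]
      · have hxe := abs_lt.1 (not_le.1 hxe)
        have : k x = 0 := by
          simp only [hk]
          rw [min_eq_left hxe.2.le, max_eq_right hxe.1.le, sub_self]
        simp [this]
    exact congrArg (fun A : H →L[ℂ] H => A u) hz

theorem IsResolvent.tendsto_inner_orthonormal {z : ℝ} {R : H →L[ℂ] H}
    (hR : T.IsResolvent (z : ℂ) R)
    (hT : ∀ f g : T.domain, inner ℂ (T f) (g : H) = inner ℂ (f : H) (T g))
    (hdisc : T.HasPurelyDiscreteSpectrum) {e : ℕ → H} (he : Orthonormal ℂ e) :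
    Tendsto (fun k => inner ℂ (e k) (R (e k))) atTop (𝓝 0) := by
  rw [Metric.tendsto_atTop]
  intro ε hε
  obtain ⟨F, hF, hfin⟩ := hR.exists_finiteRank_approx hT hdisc (half_pos hε)
  obtain ⟨N, hN⟩ := Metric.tendsto_atTop.1 (he.tendsto_inner_of_finiteDimensional F hfin) _
    (half_pos hε)
  refine ⟨N, fun k hk => ?_⟩
  have h1 := hN k hk
  rw [dist_zero_right] at h1 ⊢
  have h2 : inner ℂ (e k) (R (e k)) = inner ℂ (e k) ((R - F) (e k)) + inner ℂ (e k) (F (e k)) := by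
    rw [← inner_add_right]; simp
  have h3 : ‖inner ℂ (e k) ((R - F) (e k))‖ ≤ ε / 2 := by
    refine (norm_inner_le_norm _ _).trans ?_
    have := (R - F).le_opNorm (e k)
    rw [he.1 k, mul_one] at this
    rw [he.1 k, one_mul]
    exact this.trans hF
  rw [h2]
  exact (norm_add_le _ _).trans_lt (by linarith)

end LinearPMap

namespace SubRiem

/-! ### The group law in the chart at the identity -/

section ChartCalculus

variable {n : ℕ} {G : Type*} [TopologicalSpace G] [ChartedSpace (EuclideanSpace ℝ (Fin n)) G]
  [Group G]

variable (n G) in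
/-- The chart at the identity, as a map to the model vector space. -/
noncomputable def chartOne (x : G) : EuclideanSpace ℝ (Fin n) := extChartAt (𝓡 n) (1 : G) x

variable (G) in
/-- The inverse of the chart at the identity. -/
noncomputable def chartInv (p : EuclideanSpace ℝ (Fin n)) : G := (extChartAt (𝓡 n) (1 : G)).symm p

variable (n G) in
/-- The image of the identity in the chart. -/
noncomputable def chartOrigin : EuclideanSpace ℝ (Fin n) := chartOne n G 1

variable (n G) in
/-- The group law in the chart at the identity. -/
noncomputable def chartMul (p : EuclideanSpace ℝ (Fin n) × EuclideanSpace ℝ (Fin n)) :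
    EuclideanSpace ℝ (Fin n) := chartOne n G (chartInv G p.1 * chartInv G p.2)

variable (n G) in
/-- Conjugation in the chart at the identity. -/
noncomputable def chartConj (p : EuclideanSpace ℝ (Fin n) × EuclideanSpace ℝ (Fin n)) :
    EuclideanSpace ℝ (Fin n) :=
  chartOne n G (chartInv G p.1 * chartInv G p.2 * (chartInv G p.1)⁻¹)

@[simp] theorem chartInv_origin : chartInv G (chartOrigin n G) = 1 :=
  extChartAt_to_inv (I := 𝓡 n) (1 : G)

theorem eventually_chartInv_chartOne : ∀ᶠ x in 𝓝 (1 : G), chartInv G (chartOne n G x) = x := by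
  filter_upwards [extChartAt_source_mem_nhds (I := 𝓡 n) (1 : G)] with x hx
  exact (extChartAt (𝓡 n) (1 : G)).left_inv hx

theorem eventually_chartOne_chartInv :
    ∀ᶠ p in 𝓝 (chartOrigin n G), chartOne n G (chartInv G p) = p := by
  filter_upwards [extChartAt_target_mem_nhds (I := 𝓡 n) (1 : G)] with p hp
  exact (extChartAt (𝓡 n) (1 : G)).right_inv hp

theorem chartMul_origin_left : ∀ᶠ b in 𝓝 (chartOrigin n G),
    chartMul n G (chartOrigin n G, b) = b := by
  filter_upwards [eventually_chartOne_chartInv (n := n) (G := G)] with b hb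
  simpa [chartMul] using hb

theorem chartMul_origin_right : ∀ᶠ a in 𝓝 (chartOrigin n G),
    chartMul n G (a, chartOrigin n G) = a := by
  filter_upwards [eventually_chartOne_chartInv (n := n) (G := G)] with b hb
  simpa [chartMul] using hb

theorem chartConj_origin_left : ∀ᶠ b in 𝓝 (chartOrigin n G),
    chartConj n G (chartOrigin n G, b) = b := by
  filter_upwards [eventually_chartOne_chartInv (n := n) (G := G)] with b hb
  simpa [chartConj] using hb

theorem chartConj_origin_right (a : EuclideanSpace ℝ (Fin n)) :
    chartConj n G (a, chartOrigin n G) = chartOrigin n G := by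
  rw [chartConj, chartInv_origin]; simp [chartOrigin]

theorem contMDiffAt_chartOne : ContMDiffAt (𝓡 n) 𝓘(ℝ, EuclideanSpace ℝ (Fin n)) ∞
    (chartOne n G) 1 := contMDiffAt_extChartAt

theorem continuousAt_chartOne : ContinuousAt (chartOne n G) 1 := contMDiffAt_chartOne.continuousAt

theorem contDiffAt_chartOne_comp {F : Type*} [NormedAddCommGroup F] [NormedSpace ℝ F]
    {f : F → G} {x : F} (hf : ContMDiffAt 𝓘(ℝ, F) (𝓡 n) ∞ f x) (hx : f x = 1) :
    ContDiffAt ℝ ∞ (fun y => chartOne n G (f y)) x := by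
  have h : ContMDiffAt (𝓡 n) 𝓘(ℝ, EuclideanSpace ℝ (Fin n)) ∞ (chartOne n G) (f x) :=
    hx ▸ contMDiffAt_chartOne
  exact contMDiffAt_iff_contDiffAt.1 (h.comp x hf)

variable [LieGroup (𝓡 n) ∞ G]

theorem contMDiffAt_chartInv : ContMDiffAt 𝓘(ℝ, EuclideanSpace ℝ (Fin n)) (𝓡 n) ∞
    (chartInv G) (chartOrigin n G) :=
  (contMDiffOn_extChartAt_symm (I := 𝓡 n) (n := ∞) (1 : G)).contMDiffAt
    (extChartAt_target_mem_nhds (I := 𝓡 n) (1 : G))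

theorem continuousAt_chartInv : ContinuousAt (chartInv G) (chartOrigin n G) :=
  contMDiffAt_chartInv.continuousAt

theorem tendsto_chartInv : Tendsto (chartInv G) (𝓝 (chartOrigin n G)) (𝓝 1) := by
  simpa using (continuousAt_chartInv (n := n) (G := G)).tendsto

theorem contMDiffAt_chartInv_comp {F : Type*} [NormedAddCommGroup F] [NormedSpace ℝ F]
    {f : F → EuclideanSpace ℝ (Fin n)} {x : F} (hf : ContDiffAt ℝ ∞ f x)
    (hx : f x = chartOrigin n G) :
    ContMDiffAt 𝓘(ℝ, F) (𝓡 n) ∞ (fun y => chartInv G (f y)) x := by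
  have h : ContMDiffAt 𝓘(ℝ, EuclideanSpace ℝ (Fin n)) (𝓡 n) ∞ (chartInv G) (f x) :=
    hx ▸ contMDiffAt_chartInv
  exact h.comp x hf.contMDiffAt

theorem contDiffAt_chartMul :
    ContDiffAt ℝ ∞ (chartMul n G) (chartOrigin n G, chartOrigin n G) := by
  refine contDiffAt_chartOne_comp (ContMDiffAt.mul
    (contMDiffAt_chartInv_comp contDiffAt_fst rfl) (contMDiffAt_chartInv_comp contDiffAt_snd rfl)) ?_
  simp

theorem contDiffAt_chartConj :
    ContDiffAt ℝ ∞ (chartConj n G) (chartOrigin n G, chartOrigin n G) := by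
  refine contDiffAt_chartOne_comp (ContMDiffAt.mul (ContMDiffAt.mul
    (contMDiffAt_chartInv_comp contDiffAt_fst rfl) (contMDiffAt_chartInv_comp contDiffAt_snd rfl))
    (ContMDiffAt.inv (contMDiffAt_chartInv_comp contDiffAt_fst rfl))) ?_
  simp

/-- The identity `(a b a⁻¹) a = a b`, valid in the chart once the conjugate lies in the chart
domain. -/
theorem chartMul_chartConj : ∀ᶠ p in 𝓝 (chartOrigin n G, chartOrigin n G),
    chartMul n G (chartConj n G p, p.1) = chartMul n G p := by
  have : IsTopologicalGroup G := topologicalGroup_of_lieGroup (𝓡 n) ∞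
  have h1 : Tendsto (fun p : EuclideanSpace ℝ (Fin n) × EuclideanSpace ℝ (Fin n) =>
      chartInv G p.1 * chartInv G p.2 * (chartInv G p.1)⁻¹)
      (𝓝 (chartOrigin n G, chartOrigin n G)) (𝓝 1) := by
    have ha : Tendsto (fun p : EuclideanSpace ℝ (Fin n) × EuclideanSpace ℝ (Fin n) =>
        chartInv G p.1) (𝓝 (chartOrigin n G, chartOrigin n G)) (𝓝 1) :=
      tendsto_chartInv.comp continuousAt_fst
    have hb : Tendsto (fun p : EuclideanSpace ℝ (Fin n) × EuclideanSpace ℝ (Fin n) =>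
        chartInv G p.2) (𝓝 (chartOrigin n G, chartOrigin n G)) (𝓝 1) :=
      tendsto_chartInv.comp continuousAt_snd
    simpa using (ha.mul hb).mul ha.inv
  filter_upwards [h1.eventually (eventually_chartInv_chartOne (n := n))] with p hp
  simp only [chartMul, chartConj, hp]
  simp

theorem fderiv_eq_id_of_eventuallyEq {E : Type*} [NormedAddCommGroup E] [NormedSpace ℝ E]
    {f : E → E} {x : E} (h : ∀ᶠ y in 𝓝 x, f y = y) : fderiv ℝ f x = ContinuousLinearMap.id ℝ E := by
  have : f =ᶠ[𝓝 x] id := h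
  rw [this.fderiv_eq, fderiv_id]

/-! ### Derivative of the adjoint action -/

section Adjoint

variable {E : Type*} [NormedAddCommGroup E] [NormedSpace ℝ E] {m k : E × E → E} {o : E}

theorem fderiv_partial_snd {a b : E} (hm : DifferentiableAt ℝ m (a, b)) (v : E) :
    fderiv ℝ (fun y => m (a, y)) b v = fderiv ℝ m (a, b) (0, v) := by
  have h := hm.hasFDerivAt.comp b ((hasFDerivAt_const a b).prodMk (hasFDerivAt_id b))
  have h2 := h.fderiv
  simp only [Function.comp_def] at h2
  rw [h2]
  simp

theorem fderiv_partial_fst {a b : E} (hm : DifferentiableAt ℝ m (a, b)) (v : E) :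
    fderiv ℝ (fun y => m (y, b)) a v = fderiv ℝ m (a, b) (v, 0) := by
  have h := HasFDerivAt.comp (f := fun y => (y, b)) a hm.hasFDerivAt
    ((hasFDerivAt_id a).prodMk (hasFDerivAt_const b a))
  have h2 := h.fderiv
  simp only [Function.comp_def] at h2
  rw [h2]
  simp

theorem hasFDerivAt_fderiv_left (hm : ContDiffAt ℝ 2 m (o, o)) (v : E × E) :
    HasFDerivAt (fun a => fderiv ℝ m (a, o) v)
      (((fderiv ℝ (fderiv ℝ m) (o, o)).flip v).comp (ContinuousLinearMap.inl ℝ E E)) o := by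
  have h1 : HasFDerivAt (fderiv ℝ m) (fderiv ℝ (fderiv ℝ m) (o, o)) (o, o) :=
    ((hm.fderiv_right (m := 1) le_rfl).differentiableAt one_ne_zero).hasFDerivAt
  have h2 := HasFDerivAt.comp (f := fun y => (y, o)) o h1
    ((hasFDerivAt_id o).prodMk (hasFDerivAt_const o o))
  have h3 := h2.clm_apply (hasFDerivAt_const v o)
  refine h3.congr_fderiv ?_
  ext w
  simp

theorem hasFDerivAt_fderiv_right (hm : ContDiffAt ℝ 2 m (o, o)) {A : E → E} {A' : E →L[ℝ] E}
    (hA : HasFDerivAt A A' o) :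
    HasFDerivAt (fun a => fderiv ℝ m (o, a) (A a, 0))
      ((((fderiv ℝ (fderiv ℝ m) (o, o)).flip (A o, 0)).comp (ContinuousLinearMap.inr ℝ E E)) +
        ((fderiv ℝ m (o, o)).comp (ContinuousLinearMap.inl ℝ E E)).comp A') o := by
  have h1 : HasFDerivAt (fderiv ℝ m) (fderiv ℝ (fderiv ℝ m) (o, o)) (o, o) :=
    ((hm.fderiv_right (m := 1) le_rfl).differentiableAt one_ne_zero).hasFDerivAt
  have h2 := h1.comp o ((hasFDerivAt_const o o).prodMk (hasFDerivAt_id o))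
  have h3 := h2.clm_apply (hA.prodMk (hasFDerivAt_const (0 : E) o))
  refine h3.congr_fderiv ?_
  ext w
  simp [add_comm]

/-- If `k` is the conjugation of a group law `m`, then the derivative of the adjoint action is the
antisymmetrization of the mixed second derivative of `m`. -/
theorem hasFDerivAt_adjoint (hm : ContDiffAt ℝ 2 m (o, o)) (hk : ContDiffAt ℝ 2 k (o, o))
    (hm2 : ∀ᶠ a in 𝓝 o, m (a, o) = a)
    (hk1 : ∀ᶠ a in 𝓝 o, k (o, a) = a) (hk2 : ∀ a, k (a, o) = o)
    (hmk : ∀ᶠ p in 𝓝 (o, o), m (k p, p.1) = m p) (v x : E) :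
    DifferentiableAt ℝ (fun a => fderiv ℝ k (a, o) (0, v)) o ∧
    fderiv ℝ (fun a => fderiv ℝ k (a, o) (0, v)) o x =
      fderiv ℝ (fderiv ℝ m) (o, o) (x, 0) (0, v) -
        fderiv ℝ (fderiv ℝ m) (o, o) (v, 0) (0, x) := by
  have hdA := hasFDerivAt_fderiv_left hk (0, v)
  refine ⟨hdA.differentiableAt, ?_⟩
  set A : E → E := fun a => fderiv ℝ k (a, o) (0, v)
  have hA : HasFDerivAt A (fderiv ℝ A o) o := hdA.differentiableAt.hasFDerivAt
  have hmd : ∀ᶠ p in 𝓝 (o, o), DifferentiableAt ℝ m p :=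
    (hm.eventually (by simp)).mono fun p hp => hp.differentiableAt two_ne_zero
  have hkd : ∀ᶠ p in 𝓝 (o, o), DifferentiableAt ℝ k p :=
    (hk.eventually (by simp)).mono fun p hp => hp.differentiableAt two_ne_zero
  have t1 : Tendsto (fun a : E => (a, o)) (𝓝 o) (𝓝 (o, o)) :=
    (continuous_id.prodMk continuous_const).tendsto o
  have t2 : Tendsto (fun a : E => (o, a)) (𝓝 o) (𝓝 (o, o)) :=
    (continuous_const.prodMk continuous_id).tendsto o
  have hA0 : A o = v := by
    have := fderiv_partial_snd (hkd.self_of_nhds) v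
    rw [fderiv_eq_id_of_eventuallyEq hk1] at this
    exact this.symm
  -- Differentiate `m (k (a, z), a) = m (a, z)` in `z` at `z = o`, where `k (a, o) = o`.
  have key : (fun a => fderiv ℝ m (o, a) (A a, 0)) =ᶠ[𝓝 o] fun a => fderiv ℝ m (a, o) (0, v) := by
    filter_upwards [t1.eventually hmd, t2.eventually hmd, t1.eventually hkd,
      t1.eventually hmk.eventually_nhds] with a h1 h2 h3 h4
    have e1 : (fun z => m (k (a, z), a)) =ᶠ[𝓝 o] fun z => m (a, z) := by
      have t3 : Tendsto (fun z : E => (a, z)) (𝓝 o) (𝓝 (a, o)) :=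
        (continuous_const.prodMk continuous_id).tendsto o
      exact t3.eventually h4
    have e2 := e1.fderiv_eq (𝕜 := ℝ)
    have e3 := fderiv_partial_snd h1 v
    rw [← e2] at e3
    rw [← e3]
    have h2' : HasFDerivAt m (fderiv ℝ m (o, a)) (k (a, o), a) := by
      rw [hk2 a]; exact h2.hasFDerivAt
    have h5 := h3.hasFDerivAt.comp o ((hasFDerivAt_const a o).prodMk (hasFDerivAt_id o))
    have h6 := h2'.comp o (h5.prodMk (hasFDerivAt_const a o))
    have h7 := h6.fderiv
    simp only [Function.comp_def] at h7
    rw [h7]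
    simp [A]
  have d1 := hasFDerivAt_fderiv_right hm hA
  have d2 := (hasFDerivAt_fderiv_left hm (0, v)).congr_of_eventuallyEq key
  -- Differentiating `key` in `a` at `o` gives `D²m (0,x) (v,0) + A' x = D²m (x,0) (0,v)`; symmetry
  -- of `D²m` then yields the claim.
  have d3 := congrArg (fun L : E →L[ℝ] E => L x) (d1.unique d2)
  have hm0 : ∀ w, fderiv ℝ m (o, o) (w, 0) = w := fun w => by
    rw [← fderiv_partial_fst hmd.self_of_nhds w, fderiv_eq_id_of_eventuallyEq hm2]
    rfl
  have hsymm : IsSymmSndFDerivAt ℝ m (o, o) :=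
    hm.isSymmSndFDerivAt (by simp)
  simp only [add_apply, ContinuousLinearMap.comp_apply,
    ContinuousLinearMap.flip_apply, ContinuousLinearMap.inr_apply, ContinuousLinearMap.inl_apply,
    hm0, hA0] at d3
  rw [hsymm.eq (v, 0) (0, x), ← d3]
  abel

end Adjoint

end ChartCalculus

end SubRiem

namespace SubRiem

/-! ### Left-invariant fields in the chart at the identity -/

section InvariantFields

variable {n : ℕ} {G : Type*} [TopologicalSpace G] [ChartedSpace (EuclideanSpace ℝ (Fin n)) G]
  [Group G] [LieGroup (𝓡 n) ∞ G]

theorem mdifferentiable_mul_left (g : G) : MDifferentiable (𝓡 n) (𝓡 n) (fun x : G => g * x) :=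
  (contMDiff_mul_left (I := 𝓡 n) (n := ∞) (a := g)).mdifferentiable (by simp)

/-- Left translations map left-invariant fields to themselves. -/
theorem mfderiv_mul_left_mulInvariantVectorField (v : GroupLieAlgebra (𝓡 n) G) (g x : G) :
    (mfderiv (𝓡 n) (𝓡 n) (fun y : G => g * y) x (mulInvariantVectorField (I := 𝓡 n) v x) :
      EuclideanSpace ℝ (Fin n)) = mulInvariantVectorField (I := 𝓡 n) v (g * x) := by
  have h := mfderiv_comp (I' := 𝓡 n) (1 : G) (mdifferentiable_mul_left (n := n) g (x * 1))
    (mdifferentiable_mul_left (n := n) x 1)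
  have h1 : (fun y : G => g * x * y) = (fun y : G => g * y) ∘ (fun y : G => x * y) := by
    ext y; simp [mul_assoc]
  -- The tangent spaces at `x * 1` and at `x` are different types, so the change of base point is
  -- made for vectors of the model space.
  have h2 : ∀ (y : G) (w : EuclideanSpace ℝ (Fin n)), y = x →
      (mfderiv (𝓡 n) (𝓡 n) (fun y : G => g * y) x w : EuclideanSpace ℝ (Fin n)) =
        mfderiv (𝓡 n) (𝓡 n) (fun y : G => g * y) y w := fun y w hy => by rw [hy]
  have h3 : (mfderiv (𝓡 n) (𝓡 n) (fun y : G => g * x * y) 1 v : EuclideanSpace ℝ (Fin n)) =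
      mfderiv (𝓡 n) (𝓡 n) ((fun y : G => g * y) ∘ (fun y : G => x * y)) 1 v := by rw [h1]; rfl
  exact (h2 (x * 1) _ (mul_one x)).trans ((congrArg (fun L => L v) h).symm.trans h3.symm)

theorem mdifferentiableAt_comp_mul_left {F : Type*} [NormedAddCommGroup F] [NormedSpace ℝ F]
    {f : G → F} {g : G} (hf : MDifferentiableAt (𝓡 n) 𝓘(ℝ, F) f g) :
    MDifferentiableAt (𝓡 n) 𝓘(ℝ, F) (fun x => f (g * x)) (1 : G) := by
  have hf' : MDifferentiableAt (𝓡 n) 𝓘(ℝ, F) f (g * 1) := by rwa [mul_one]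
  exact hf'.comp (1 : G) (mdifferentiable_mul_left (n := n) g 1)

theorem mfderiv_apply_mulInvariantVectorField {F : Type*} [NormedAddCommGroup F] [NormedSpace ℝ F]
    {f : G → F} {g : G} (hf : MDifferentiableAt (𝓡 n) 𝓘(ℝ, F) f g) (v : GroupLieAlgebra (𝓡 n) G) :
    (mfderiv (𝓡 n) 𝓘(ℝ, F) f g (mulInvariantVectorField (I := 𝓡 n) v g) : F) =
      mfderiv (𝓡 n) 𝓘(ℝ, F) (fun x => f (g * x)) (1 : G) v := by
  have hf' : MDifferentiableAt (𝓡 n) 𝓘(ℝ, F) f (g * 1) := by rwa [mul_one]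
  have h := mfderiv_comp (1 : G) hf' (mdifferentiable_mul_left (n := n) g 1)
  have h2 : (mfderiv (𝓡 n) 𝓘(ℝ, F) (fun x => f (g * x)) (1 : G) v : F) =
      mfderiv (𝓡 n) 𝓘(ℝ, F) f (g * 1) (mfderiv (𝓡 n) (𝓡 n) (fun x : G => g * x) 1 v) :=
    congrArg (fun L => L v) h
  have h3 : ∀ (y : G) (w : EuclideanSpace ℝ (Fin n)), y = g →
      (mfderiv (𝓡 n) 𝓘(ℝ, F) f g w : F) = mfderiv (𝓡 n) 𝓘(ℝ, F) f y w := fun y w hy => by rw [hy]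
  exact (h3 (g * 1) _ (mul_one g)).trans h2.symm

/-- At the identity `mfderiv` is by definition the derivative read in the chart at the identity; the
model has no boundary, so the derivative within the range is the full one. -/
theorem fderiv_comp_chartInv {n : ℕ} {G : Type*} [TopologicalSpace G]
    [ChartedSpace (EuclideanSpace ℝ (Fin n)) G] [Group G] {F : Type*} [NormedAddCommGroup F]
    [NormedSpace ℝ F] {f : G → F} (hf : MDifferentiableAt (𝓡 n) 𝓘(ℝ, F) f 1) :
    DifferentiableAt ℝ (fun b => f (chartInv G b)) (chartOrigin n G) ∧
      ∀ v : EuclideanSpace ℝ (Fin n),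
        fderiv ℝ (fun b => f (chartInv G b)) (chartOrigin n G) v =
          (mfderiv (𝓡 n) 𝓘(ℝ, F) f 1 v : F) := by
  have h := hf.hasMFDerivAt.2
  rw [ModelWithCorners.range_eq_univ] at h
  have h' : HasFDerivAt (fun b => f (chartInv G b))
      (mfderiv (𝓡 n) 𝓘(ℝ, F) f 1 : EuclideanSpace ℝ (Fin n) →L[ℝ] F) (chartOrigin n G) :=
    HasFDerivWithinAt.hasFDerivAt h univ_mem
  exact ⟨HasFDerivAt.differentiableAt (E := EuclideanSpace ℝ (Fin n)) h', fun v => congrArg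
    (fun L : EuclideanSpace ℝ (Fin n) →L[ℝ] F => L v)
      (HasFDerivAt.fderiv (E := EuclideanSpace ℝ (Fin n)) h')⟩

/-- The differential at `g` of a vector-valued function, read by left translation in the chart at
the identity. -/
noncomputable def leftDeriv {F : Type*} [NormedAddCommGroup F] [NormedSpace ℝ F]
    (f : G → F) (g : G) : EuclideanSpace ℝ (Fin n) →L[ℝ] F :=
  fderiv ℝ (fun b => f (g * chartInv G b)) (chartOrigin n G)

theorem hasFDerivAt_mul_chartInv {F : Type*} [NormedAddCommGroup F] [NormedSpace ℝ F]
    {f : G → F} {g : G} (hf : MDifferentiableAt (𝓡 n) 𝓘(ℝ, F) f g) :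
    HasFDerivAt (fun b => f (g * chartInv G b)) (leftDeriv (n := n) f g) (chartOrigin n G) :=
  (fderiv_comp_chartInv (mdifferentiableAt_comp_mul_left hf)).1.hasFDerivAt

/-- The derivative of `f` along a left-invariant field is read off the chart at the identity. -/
theorem mfderiv_mulInvariantVectorField_eq_leftDeriv {F : Type*} [NormedAddCommGroup F]
    [NormedSpace ℝ F] {f : G → F} {g : G} (hf : MDifferentiableAt (𝓡 n) 𝓘(ℝ, F) f g)
    (v : GroupLieAlgebra (𝓡 n) G) :
    (mfderiv (𝓡 n) 𝓘(ℝ, F) f g (mulInvariantVectorField (I := 𝓡 n) v g) : F) =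
      leftDeriv (n := n) f g v :=
  (mfderiv_apply_mulInvariantVectorField hf v).trans
    ((fderiv_comp_chartInv (mdifferentiableAt_comp_mul_left hf)).2 v).symm

theorem eventually_mdifferentiableAt_chartOne :
    ∀ᶠ g in 𝓝 (1 : G), MDifferentiableAt (𝓡 n) 𝓘(ℝ, EuclideanSpace ℝ (Fin n)) (chartOne n G) g := by
  filter_upwards [chart_source_mem_nhds (EuclideanSpace ℝ (Fin n)) (1 : G)] with g hg
  exact mdifferentiableAt_extChartAt hg

theorem eventually_differentiableAt_chartMul :
    ∀ᶠ p in 𝓝 (chartOrigin n G), DifferentiableAt ℝ (chartMul n G) (p, chartOrigin n G) := by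
  have t1 : Tendsto (fun a => (a, chartOrigin n G)) (𝓝 (chartOrigin n G))
      (𝓝 (chartOrigin n G, chartOrigin n G)) :=
    (continuous_id.prodMk continuous_const).tendsto _
  have := (contDiffAt_chartMul (n := n) (G := G)).of_le (m := 1) (by simp)
  filter_upwards [t1.eventually (this.eventually (by simp))] with p hp
  exact hp.differentiableAt one_ne_zero

/-- A left-invariant field in the chart at the identity. -/
theorem eventually_leftDeriv_chartOne (v : EuclideanSpace ℝ (Fin n)) :
    ∀ᶠ g in 𝓝 (1 : G), leftDeriv (n := n) (chartOne n G) g v =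
      fderiv ℝ (chartMul n G) (chartOne n G g, chartOrigin n G) (0, v) := by
  filter_upwards [eventually_chartInv_chartOne (n := n) (G := G),
    (continuousAt_chartOne (n := n) (G := G)).eventually
      (eventually_differentiableAt_chartMul (n := n) (G := G))] with g h2 h3
  rw [← fderiv_partial_snd h3 v, leftDeriv]
  simp only [chartMul, h2]

theorem eventually_mfderiv_chartOne_mulInvariantVectorField (v : GroupLieAlgebra (𝓡 n) G) :
    ∀ᶠ g in 𝓝 (1 : G), (mfderiv (𝓡 n) 𝓘(ℝ, EuclideanSpace ℝ (Fin n)) (chartOne n G) g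
      (mulInvariantVectorField (I := 𝓡 n) v g) : EuclideanSpace ℝ (Fin n)) =
      fderiv ℝ (chartMul n G) (chartOne n G g, chartOrigin n G) (0, v) := by
  filter_upwards [eventually_mdifferentiableAt_chartOne (n := n),
    eventually_leftDeriv_chartOne (n := n) (G := G) v] with g h1 h2
  exact (mfderiv_mulInvariantVectorField_eq_leftDeriv h1 v).trans h2

/-- In the chart the left-invariant field generated by `w` is `p ↦ ∂₂m(p, o) w`, with value `w` at
the origin `o`. The bracket of two such fields at `o` is the antisymmetrised derivative of one along
the other. The same expression arises as the derivative of the adjoint action in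
`hasFDerivAt_adjoint`. -/
theorem bracket_eq_chart (x v : GroupLieAlgebra (𝓡 n) G) :
    (⁅x, v⁆ : GroupLieAlgebra (𝓡 n) G) =
      (fderiv ℝ (fderiv ℝ (chartMul n G)) (chartOrigin n G, chartOrigin n G) (x, 0) (0, v) -
        fderiv ℝ (fderiv ℝ (chartMul n G)) (chartOrigin n G, chartOrigin n G) (v, 0) (0, x) :
        EuclideanSpace ℝ (Fin n)) := by
  have hY : ∀ w : GroupLieAlgebra (𝓡 n) G,
      VectorField.mpullbackWithin 𝓘(ℝ, EuclideanSpace ℝ (Fin n)) (𝓡 n)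
        (extChartAt (𝓡 n) (1 : G)).symm (mulInvariantVectorField w) (range (𝓡 n))
      =ᶠ[𝓝 (chartOrigin n G)]
      fun p => fderiv ℝ (chartMul n G) (p, chartOrigin n G) (0, w) := by
    intro w
    filter_upwards [extChartAt_target_mem_nhds (I := 𝓡 n) (1 : G),
      tendsto_chartInv.eventually (eventually_mfderiv_chartOne_mulInvariantVectorField w),
      eventually_chartOne_chartInv (n := n) (G := G)] with p hp h1 h2
    rw [h2] at h1
    rw [← h1, VectorField.mpullbackWithin_apply,
      ContinuousLinearMap.inverse_eq (mfderivWithin_extChartAt_symm_comp_mfderiv_extChartAt hp)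
        (mfderiv_extChartAt_comp_mfderivWithin_extChartAt_symm hp)]
    rfl
  have hd : ∀ w : GroupLieAlgebra (𝓡 n) G, HasFDerivAt
      (fun p => fderiv ℝ (chartMul n G) (p, chartOrigin n G) (0, w)) _ (chartOrigin n G) :=
    fun w => hasFDerivAt_fderiv_left
      ((contDiffAt_chartMul (n := n) (G := G)).of_le ENat.LEInfty.out) (0, w)
  have h0 : ∀ w : EuclideanSpace ℝ (Fin n),
      fderiv ℝ (chartMul n G) (chartOrigin n G, chartOrigin n G) (0, w) = w := fun w => by
    rw [← fderiv_partial_snd (eventually_differentiableAt_chartMul (n := n) (G := G)).self_of_nhds w,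
      fderiv_eq_id_of_eventuallyEq chartMul_origin_left]
    rfl
  have hset : (extChartAt (𝓡 n) (1 : G)).symm ⁻¹' univ ∩ range (𝓡 n) = univ := by
    rw [ModelWithCorners.range_eq_univ, preimage_univ, inter_univ]
  -- The bracket on the manifold is pulled back from the chart by the inverse of the chart's
  -- differential, which is the identity at the base point.
  have hinv : ∀ w : EuclideanSpace ℝ (Fin n),
      (mfderiv (𝓡 n) 𝓘(ℝ, EuclideanSpace ℝ (Fin n)) (extChartAt (𝓡 n) (1 : G)) 1).inverse w = w := by
    intro w
    have h1 : mfderiv (𝓡 n) 𝓘(ℝ, EuclideanSpace ℝ (Fin n)) (extChartAt (𝓡 n) (1 : G)) 1 =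
      ContinuousLinearMap.id ℝ (EuclideanSpace ℝ (Fin n)) := mfderiv_extChartAt_self
    rw [h1]
    exact congrArg (fun L : EuclideanSpace ℝ (Fin n) →L[ℝ] EuclideanSpace ℝ (Fin n) => L w)
      ContinuousLinearMap.inverse_id
  have hbr := Filter.EventuallyEq.lieBracket_vectorField_eq (𝕜 := ℝ)
    (E := EuclideanSpace ℝ (Fin n)) (hY x) (hY v)
  have e1 : (VectorField.lieBracket ℝ
      (fun p => fderiv ℝ (chartMul n G) (p, chartOrigin n G) (0, x))
      (fun p => fderiv ℝ (chartMul n G) (p, chartOrigin n G) (0, v)) (chartOrigin n G) :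
      EuclideanSpace ℝ (Fin n)) =
      fderiv ℝ (fderiv ℝ (chartMul n G)) (chartOrigin n G, chartOrigin n G) (x, 0) (0, v) -
        fderiv ℝ (fderiv ℝ (chartMul n G)) (chartOrigin n G, chartOrigin n G) (v, 0) (0, x) := by
    change fderiv ℝ (fun p => fderiv ℝ (chartMul n G) (p, chartOrigin n G) (0, v)) _
        (fderiv ℝ (chartMul n G) (chartOrigin n G, chartOrigin n G) (0, x)) -
      fderiv ℝ (fun p => fderiv ℝ (chartMul n G) (p, chartOrigin n G) (0, x)) _
        (fderiv ℝ (chartMul n G) (chartOrigin n G, chartOrigin n G) (0, v)) = _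
    have a1 := (hd v).fderiv
    have a2 := (hd x).fderiv
    have a3 := h0 v
    have a4 := h0 x
    rw [a3, a4]
    erw [a1, a2]
    rfl
  refine Eq.trans ?_ (hbr.trans e1)
  refine (hinv _).trans ?_
  rw [hset]
  exact congrFun (VectorField.lieBracketWithin_univ (𝕜 := ℝ) (E := EuclideanSpace ℝ (Fin n)))
    (chartOrigin n G)

end InvariantFields

end SubRiem

/-! ### Subspaces generating a Lie algebra -/

/-- By the Jacobi identity the elements `x` with `[x, W] ⊆ W` form a Lie subalgebra `N`. It contains
`𝓗`, so it is everything. Then `W` is itself a subalgebra containing `𝓗`. -/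
theorem Submodule.eq_top_of_lieSpan_eq_top {L : Type*} [LieRing L] [LieAlgebra ℝ L]
    {𝓗 W : Submodule ℝ L} (h𝓗 : LieSubalgebra.lieSpan ℝ L (𝓗 : Set L) = ⊤) (hle : 𝓗 ≤ W)
    (hW : ∀ x ∈ 𝓗, ∀ w ∈ W, ⁅x, w⁆ ∈ W) : W = ⊤ := by
  let N : LieSubalgebra ℝ L :=
    { carrier := {x | ∀ w ∈ W, ⁅x, w⁆ ∈ W}
      add_mem' := fun {a b} ha hb w hw => by
        rw [add_lie]; exact W.add_mem (ha w hw) (hb w hw)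
      zero_mem' := fun w _ => by rw [zero_lie]; exact W.zero_mem
      smul_mem' := fun c a ha w hw => by rw [smul_lie]; exact W.smul_mem c (ha w hw)
      lie_mem' := fun {a b} ha hb w hw => by
        rw [lie_lie]; exact W.sub_mem (ha _ (hb w hw)) (hb _ (ha w hw)) }
  have hN : N = ⊤ := by
    rw [eq_top_iff, ← h𝓗, LieSubalgebra.lieSpan_le]
    exact fun x hx w hw => hW x hx w hw
  let M : LieSubalgebra ℝ L :=
    { W with
      lie_mem' := fun {a b} _ hb => by
        have : a ∈ N := by rw [hN]; exact LieSubalgebra.mem_top a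
        exact this b hb }
  have hM : M = ⊤ := by
    rw [eq_top_iff, ← h𝓗, LieSubalgebra.lieSpan_le]
    exact fun x hx => hle hx
  rw [eq_top_iff]
  intro x _
  have : x ∈ M := by rw [hM]; exact LieSubalgebra.mem_top x
  exact this

theorem Submodule.mem_of_hasDerivAt {E : Type*} [NormedAddCommGroup E] [NormedSpace ℝ E]
    [FiniteDimensional ℝ E] (W : Submodule ℝ E) {f : ℝ → E} {f' : E} {t : ℝ}
    (hf : HasDerivAt f f' t) (hW : ∀ᶠ s in 𝓝 t, f s ∈ W) : f' ∈ W := by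
  have hcl : IsClosed (W : Set E) := W.closed_of_finiteDimensional
  refine hcl.mem_of_tendsto (hasDerivAt_iff_tendsto_slope.1 hf) ?_
  filter_upwards [hW.filter_mono nhdsWithin_le_nhds] with s hs
  exact W.smul_mem _ (W.sub_mem hs hW.self_of_nhds)

theorem exists_basis_mem_of_span_eq_top {E : Type*} [AddCommGroup E] [Module ℝ E]
    [FiniteDimensional ℝ E] {S : Set E} (hS : Submodule.span ℝ S = ⊤) :
    ∃ b : Module.Basis (Fin (Module.finrank ℝ E)) ℝ E, ∀ i, b i ∈ S := by
  let b := Module.Basis.ofSpan hS.ge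
  have : Fintype _ := FiniteDimensional.fintypeBasisIndex b
  let e := Fintype.equivFinOfCardEq (Module.finrank_eq_card_basis b).symm
  refine ⟨b.reindex e, fun i => ?_⟩
  rw [Module.Basis.reindex_apply]
  exact Module.Basis.ofSpan_subset hS.ge ⟨_, rfl⟩

namespace SubRiem

/-! ### Accessibility: Chow's theorem for a filtered family of symmetric sets -/

section Accessibility

variable {n : ℕ} {G : Type*} [TopologicalSpace G] [ChartedSpace (EuclideanSpace ℝ (Fin n)) G]
  [Group G] 

/-- `c` is a curve through the identity, strictly differentiable there with velocity `v`. -/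
structure HasVelocityOne (c : ℝ → G) (v : GroupLieAlgebra (𝓡 n) G) : Prop where
  zero : c 0 = 1
  continuousAt : ContinuousAt c 0
  hasStrictDerivAt : HasStrictDerivAt (fun t => chartOne n G (c t))
    (v : EuclideanSpace ℝ (Fin n)) 0

/-- The velocities at the identity of the curves which stay in `B ε'` for some `ε' < ε`. -/
def tangentDirs (n : ℕ) {G : Type*} [TopologicalSpace G]
    [ChartedSpace (EuclideanSpace ℝ (Fin n)) G] [Group G] (B : ℝ → Set G) (ε : ℝ) :
    Set (GroupLieAlgebra (𝓡 n) G) :=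
  {v | ∃ ε' < ε, ∃ c : ℝ → G, HasVelocityOne c v ∧ ∀ᶠ t in 𝓝 0, c t ∈ B ε'}

variable [LieGroup (𝓡 n) ∞ G] {B : ℝ → Set G}

theorem HasVelocityOne.conj {c : ℝ → G} {v : GroupLieAlgebra (𝓡 n) G} (hc : HasVelocityOne c v)
    {a : EuclideanSpace ℝ (Fin n)}
    (ha : ContDiffAt ℝ 1 (chartConj n G) (a, chartOrigin n G)) :
    HasVelocityOne (fun t => chartInv G a * c t * (chartInv G a)⁻¹)
      (fderiv ℝ (chartConj n G) (a, chartOrigin n G) (0, v) : EuclideanSpace ℝ (Fin n)) := by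
  have : IsTopologicalGroup G := topologicalGroup_of_lieGroup (𝓡 n) ∞
  refine ⟨by simp [hc.zero], (continuousAt_const.mul hc.continuousAt).mul continuousAt_const, ?_⟩
  have h0 : chartOne n G (c 0) = chartOrigin n G := by rw [hc.zero]; rfl
  have h1 : HasStrictFDerivAt (chartConj n G)
      (fderiv ℝ (chartConj n G) (a, chartOrigin n G)) (a, chartOne n G (c 0)) := by
    rw [h0]; exact ha.hasStrictFDerivAt one_ne_zero
  have h2 := h1.comp_hasStrictDerivAt (0 : ℝ)
    ((hasStrictDerivAt_const (0 : ℝ) a).prodMk hc.hasStrictDerivAt)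
  refine h2.congr_of_eventuallyEq ?_
  have hc1 : Tendsto c (𝓝 0) (𝓝 1) := by rw [← hc.zero]; exact hc.continuousAt
  filter_upwards [hc1.eventually (eventually_chartInv_chartOne (n := n) (G := G))] with t ht
  simp only [Function.comp_apply, chartConj, ht]

/-- Conjugating by an element of `B δ` enlarges the radius by `2δ`. The strict inequality in
`tangentDirs` leaves room for this with `δ = (ε - ε') / 3`. -/
theorem adjoint_mem_tangentDirs
    (hmul : ∀ s t, ∀ x ∈ B s, ∀ y ∈ B t, x * y ∈ B (s + t))
    (hinv : ∀ s, ∀ x ∈ B s, x⁻¹ ∈ B s) {ε : ℝ} {v : GroupLieAlgebra (𝓡 n) G}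
    (hv : v ∈ tangentDirs n B ε) : ∃ δ > 0, ∀ᶠ a in 𝓝 (chartOrigin n G), chartInv G a ∈ B δ →
      (fderiv ℝ (chartConj n G) (a, chartOrigin n G) (0, v) : EuclideanSpace ℝ (Fin n)) ∈
        tangentDirs n B ε := by
  obtain ⟨ε', hε', c, hc, hcB⟩ := hv
  refine ⟨(ε - ε') / 3, by linarith, ?_⟩
  have t1 : Tendsto (fun a => (a, chartOrigin n G)) (𝓝 (chartOrigin n G))
      (𝓝 (chartOrigin n G, chartOrigin n G)) :=
    (continuous_id.prodMk continuous_const).tendsto _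
  have hC := ((contDiffAt_chartConj (n := n) (G := G)).of_le (m := 1) (by simp)).eventually
    (by simp)
  filter_upwards [t1.eventually hC] with a ha haB
  refine ⟨(ε - ε') / 3 + ε' + (ε - ε') / 3, by linarith, _, hc.conj ha, ?_⟩
  filter_upwards [hcB] with t ht
  exact hmul _ _ _ (hmul _ _ _ haB _ ht) _ (hinv _ _ haB)

/-- Along `γ` the vectors `Ad(γ t) v` remain in `tangentDirs n B ε` for small `t`. Their derivative
at `0` is `⁅x, v⁆`, and it stays in the span because a finite-dimensional subspace is closed. -/
theorem bracket_mem_span_tangentDirs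
    (hmul : ∀ s t, ∀ x ∈ B s, ∀ y ∈ B t, x * y ∈ B (s + t))
    (hinv : ∀ s, ∀ x ∈ B s, x⁻¹ ∈ B s) {ε : ℝ} {x v : GroupLieAlgebra (𝓡 n) G} {γ : ℝ → G}
    (hγ : HasVelocityOne γ x) (hγB : ∀ δ > 0, ∀ᶠ t in 𝓝 0, γ t ∈ B δ)
    (hv : v ∈ tangentDirs n B ε) : ⁅x, v⁆ ∈ Submodule.span ℝ (tangentDirs n B ε) := by
  obtain ⟨δ, hδ, hev⟩ := adjoint_mem_tangentDirs hmul hinv hv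
  have hγ1 : Tendsto γ (𝓝 0) (𝓝 1) := by rw [← hγ.zero]; exact hγ.continuousAt
  have hγo : Tendsto (fun t => chartOne n G (γ t)) (𝓝 0) (𝓝 (chartOrigin n G)) :=
    (continuousAt_chartOne (n := n) (G := G)).tendsto.comp hγ1
  have hadj := hasFDerivAt_adjoint (E := EuclideanSpace ℝ (Fin n))
    ((contDiffAt_chartMul (n := n) (G := G)).of_le ENat.LEInfty.out)
    ((contDiffAt_chartConj (n := n) (G := G)).of_le ENat.LEInfty.out)
    chartMul_origin_right chartConj_origin_left chartConj_origin_right chartMul_chartConj v x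
  have hbr := (bracket_eq_chart x v).trans hadj.2.symm
  have hd : HasDerivAt (fun t => fderiv ℝ (chartConj n G)
      (chartOne n G (γ t), chartOrigin n G) (0, v)) (⁅x, v⁆ : GroupLieAlgebra (𝓡 n) G) 0 := by
    rw [hbr]
    have h1 : HasFDerivAt (𝕜 := ℝ)
        (fun a => fderiv ℝ (chartConj n G) (a, chartOrigin n G) (0, v))
        (fderiv ℝ (fun a => fderiv ℝ (chartConj n G) (a, chartOrigin n G) (0, v))
          (chartOrigin n G)) (chartOne n G (γ 0)) := by
      rw [hγ.zero]; exact hadj.1.hasFDerivAt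
    exact h1.comp_hasDerivAt (0 : ℝ) hγ.hasStrictDerivAt.hasDerivAt
  refine Submodule.mem_of_hasDerivAt (E := EuclideanSpace ℝ (Fin n))
    (Submodule.span ℝ (tangentDirs n B ε)) hd ?_
  filter_upwards [hγo.eventually hev, hγB δ hδ,
    hγ1.eventually (eventually_chartInv_chartOne (n := n) (G := G))] with t h1 h2 h3
  exact Submodule.subset_span (h1 (by rwa [h3]))

theorem span_tangentDirs_eq_top
    (hmul : ∀ s t, ∀ x ∈ B s, ∀ y ∈ B t, x * y ∈ B (s + t))
    (hinv : ∀ s, ∀ x ∈ B s, x⁻¹ ∈ B s) {𝓗 : Submodule ℝ (GroupLieAlgebra (𝓡 n) G)}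
    (h𝓗 : LieSubalgebra.lieSpan ℝ (GroupLieAlgebra (𝓡 n) G)
      (𝓗 : Set (GroupLieAlgebra (𝓡 n) G)) = ⊤)
    (hcurve : ∀ x ∈ 𝓗, ∃ γ : ℝ → G, HasVelocityOne γ x ∧ ∀ δ > 0, ∀ᶠ t in 𝓝 0, γ t ∈ B δ)
    {ε : ℝ} (hε : 0 < ε) : Submodule.span ℝ (tangentDirs n B ε) = ⊤ := by
  refine Submodule.eq_top_of_lieSpan_eq_top h𝓗 (fun x hx => ?_) fun x hx w hw => ?_
  · obtain ⟨γ, hγ, hγB⟩ := hcurve x hx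
    exact Submodule.subset_span ⟨ε / 2, by linarith, γ, hγ, hγB _ (by linarith)⟩
  · obtain ⟨γ, hγ, hγB⟩ := hcurve x hx
    induction hw using Submodule.span_induction with
    | mem v hv => exact bracket_mem_span_tangentDirs hmul hinv hγ hγB hv
    | zero => rw [lie_zero]; exact Submodule.zero_mem _
    | add a b _ _ ha hb => rw [lie_add]; exact Submodule.add_mem _ ha hb
    | smul c a _ ha => rw [lie_smul]; exact Submodule.smul_mem _ c ha

/-- Both partial derivatives of the group law at the origin are the identity, so velocities add.
Strict derivatives are carried along because the inverse function theorem requires them. -/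
theorem hasStrictFDerivAt_chartOne_mul {F : Type*} [NormedAddCommGroup F] [NormedSpace ℝ F]
    {f g : F → G} {f' g' : F →L[ℝ] EuclideanSpace ℝ (Fin n)} {x : F} (hf1 : f x = 1)
    (hg1 : g x = 1) (hfc : ContinuousAt f x) (hgc : ContinuousAt g x)
    (hf : HasStrictFDerivAt (fun y => chartOne n G (f y)) f' x)
    (hg : HasStrictFDerivAt (fun y => chartOne n G (g y)) g' x) :
    HasStrictFDerivAt (fun y => chartOne n G (f y * g y)) (f' + g') x := by
  have hm : HasStrictFDerivAt (chartMul n G) (fderiv ℝ (chartMul n G)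
      (chartOrigin n G, chartOrigin n G)) (chartOne n G (f x), chartOne n G (g x)) := by
    rw [hf1, hg1]
    exact (contDiffAt_chartMul (n := n) (G := G)).hasStrictFDerivAt (by simp)
  have h := hm.comp x (hf.prodMk hg)
  have hd : DifferentiableAt ℝ (chartMul n G) (chartOrigin n G, chartOrigin n G) :=
    (contDiffAt_chartMul (n := n) (G := G)).differentiableAt (by simp)
  have hL : (fderiv ℝ (chartMul n G) (chartOrigin n G, chartOrigin n G)).comp (f'.prod g')
      = f' + g' := by
    ext1 w
    have h1 : (f' w, g' w) = ((f' w, 0) + (0, g' w) :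
      EuclideanSpace ℝ (Fin n) × EuclideanSpace ℝ (Fin n)) := by simp
    rw [ContinuousLinearMap.comp_apply, ContinuousLinearMap.prod_apply, h1, map_add,
      ← fderiv_partial_fst hd, ← fderiv_partial_snd hd,
      fderiv_eq_id_of_eventuallyEq chartMul_origin_left,
      fderiv_eq_id_of_eventuallyEq chartMul_origin_right]
    rfl
  rw [hL] at h
  refine h.congr_of_eventuallyEq ?_
  have tf : Tendsto f (𝓝 x) (𝓝 1) := by rw [← hf1]; exact hfc
  have tg : Tendsto g (𝓝 x) (𝓝 1) := by rw [← hg1]; exact hgc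
  filter_upwards [tf.eventually (eventually_chartInv_chartOne (n := n) (G := G)),
    tg.eventually (eventually_chartInv_chartOne (n := n) (G := G))] with y h1 h2
  simp only [chartMul, h1, h2]

theorem hasStrictFDerivAt_chartOne_list_prod {ι : Type*} [Fintype ι] {c : ι → ℝ → G}
    {v : ι → EuclideanSpace ℝ (Fin n)} (hc : ∀ i, HasVelocityOne (c i) (v i)) (l : List ι) :
    (l.map fun i => c i 0).prod = 1 ∧
    ContinuousAt (fun t : ι → ℝ => (l.map fun i => c i (t i)).prod) 0 ∧
    HasStrictFDerivAt (fun t : ι → ℝ => chartOne n G (l.map fun i => c i (t i)).prod)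
      (l.map fun i => (ContinuousLinearMap.proj (R := ℝ) (φ := fun _ : ι => ℝ) i).smulRight
        (v i)).sum 0 := by
  have : IsTopologicalGroup G := topologicalGroup_of_lieGroup (𝓡 n) ∞
  induction l with
  | nil =>
    refine ⟨rfl, continuousAt_const (y := (1 : G)), ?_⟩
    exact hasStrictFDerivAt_const (𝕜 := ℝ) (chartOne n G 1) (0 : ι → ℝ)
  | cons i l ih =>
    obtain ⟨h1, h2, h3⟩ := ih
    have hci : ContinuousAt (fun t : ι → ℝ => c i (t i)) 0 :=
      ContinuousAt.comp (f := fun t : ι → ℝ => t i) (g := c i) (x := 0) (hc i).continuousAt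
        (continuous_apply i).continuousAt
    have hdi : HasStrictFDerivAt (fun t : ι → ℝ => chartOne n G (c i (t i)))
        ((ContinuousLinearMap.proj (R := ℝ) (φ := fun _ : ι => ℝ) i).smulRight (v i)) 0 := by
      have hp : HasStrictFDerivAt (fun t : ι → ℝ => t i)
          (ContinuousLinearMap.proj (R := ℝ) (φ := fun _ : ι => ℝ) i) 0 :=
        (ContinuousLinearMap.proj (R := ℝ) (φ := fun _ : ι => ℝ) i).hasStrictFDerivAt
      have := HasStrictFDerivAt.comp (f := fun t : ι → ℝ => t i)
        (g := fun s => chartOne n G (c i s)) (0 : ι → ℝ)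
        (hc i).hasStrictDerivAt.hasStrictFDerivAt hp
      refine this.congr_fderiv ?_
      ext w j
      simp
    refine ⟨by simp [h1, (hc i).zero], ?_, ?_⟩
    · simp only [List.map_cons, List.prod_cons]
      exact hci.mul h2
    · simp only [List.map_cons, List.prod_cons, List.sum_cons]
      exact hasStrictFDerivAt_chartOne_mul (hc i).zero h1 hci h2 hdi h3

/-- If `B` is a filtered family of symmetric sets containing, for each `ε`, a germ of a curve in
every direction of a subspace generating the Lie algebra, then each `B ε` is a neighbourhood of the
identity. -/
theorem mem_nhds_one_of_lieSpan_eq_top (hmono : Monotone B) (hone : (1 : G) ∈ B 0)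
    (hmul : ∀ s t, ∀ x ∈ B s, ∀ y ∈ B t, x * y ∈ B (s + t))
    (hinv : ∀ s, ∀ x ∈ B s, x⁻¹ ∈ B s) {𝓗 : Submodule ℝ (GroupLieAlgebra (𝓡 n) G)}
    (h𝓗 : LieSubalgebra.lieSpan ℝ (GroupLieAlgebra (𝓡 n) G)
      (𝓗 : Set (GroupLieAlgebra (𝓡 n) G)) = ⊤)
    (hcurve : ∀ x ∈ 𝓗, ∃ γ : ℝ → G, HasVelocityOne γ x ∧ ∀ δ > 0, ∀ᶠ t in 𝓝 0, γ t ∈ B δ)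
    {ε : ℝ} (hε : 0 < ε) : B ε ∈ 𝓝 (1 : G) := by
  -- A product of `n` factors from `B η` lies in `B (n * η)`, and `n * η ≤ ε`; the `+ 1` keeps the
  -- denominator nonzero when `n = 0`.
  set η := ε / (n + 1) with hη
  have hη0 : 0 < η := by positivity
  let S : Set (EuclideanSpace ℝ (Fin n)) := tangentDirs n B η
  have hS : Submodule.span ℝ S = ⊤ := span_tangentDirs_eq_top hmul hinv h𝓗 hcurve hη0
  obtain ⟨b, hb⟩ := exists_basis_mem_of_span_eq_top hS
  choose ε' hε' c hc hcB using hb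
  set l := (Finset.univ : Finset (Fin (Module.finrank ℝ (EuclideanSpace ℝ (Fin n))))).toList with hl
  obtain ⟨h1, h2, h3⟩ := hasStrictFDerivAt_chartOne_list_prod hc l
  have hsurj : Function.Surjective (l.map fun i => (ContinuousLinearMap.proj (R := ℝ)
      (φ := fun _ => ℝ) i).smulRight (b i)).sum := by
    intro w
    refine ⟨fun i => b.repr w i, ?_⟩
    have hs : (l.map fun i => (ContinuousLinearMap.proj (R := ℝ)
      (φ := fun _ => ℝ) i).smulRight (b i)).sum = ∑ i, (ContinuousLinearMap.proj (R := ℝ)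
      (φ := fun _ => ℝ) i).smulRight (b i) := Finset.sum_map_toList _ _
    rw [hs]
    simp [b.sum_repr w]
  -- The derivative of `t ↦ ∏ c i (t i)` at `0` sends the coordinate vectors to a basis. A map with
  -- surjective strict derivative is open at the point, so these products fill a neighbourhood.
  have hmap := h3.map_nhds_eq_of_surj (LinearMap.range_eq_top.2 hsurj)
  have hB : ∀ l' : List _, ∀ᶠ t : _ → ℝ in 𝓝 0,
      (l'.map fun i => c i (t i)).prod ∈ B (l'.length * η) := by
    intro l'
    induction l' with
    | nil => exact Eventually.of_forall fun t => by simpa using hone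
    | cons i l' ih =>
      have ht : Tendsto (fun t : _ → ℝ => t i) (𝓝 0) (𝓝 0) := (continuous_apply i).tendsto 0
      filter_upwards [ih, ht.eventually (hcB i)] with t ha hb'
      have := hmul _ _ _ (hmono (hε' i).le hb') _ ha
      simp only [List.map_cons, List.prod_cons, List.length_cons]
      convert this using 2
      push_cast; ring
  have hlen : (l.length : ℝ) * η ≤ ε := by
    rw [hl, Finset.length_toList, Finset.card_univ, Fintype.card_fin,
      finrank_euclideanSpace_fin, hη]
    rw [mul_div_assoc', div_le_iff₀ (by positivity)]
    nlinarith
  have h4 : Tendsto (fun t : _ → ℝ => (l.map fun i => c i (t i)).prod) (𝓝 0) (𝓝 1) := by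
    have := h2.tendsto
    simp only [Pi.zero_apply] at this
    rwa [h1] at this
  have h5 : ∀ᶠ p in 𝓝 (chartOrigin n G), chartInv G p ∈ B ε := by
    have e1 : (fun t : _ → ℝ => chartOne n G (l.map fun i => c i (t i)).prod) 0
        = chartOrigin n G := by
      simp only [Pi.zero_apply, h1]; rfl
    rw [← e1, ← hmap, eventually_map]
    filter_upwards [hB l, h4.eventually (eventually_chartInv_chartOne (n := n) (G := G))]
      with t ha hb'
    rw [hb']
    exact hmono hlen ha
  filter_upwards [(continuousAt_chartOne (n := n) (G := G)).eventually h5,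
    eventually_chartInv_chartOne (n := n) (G := G)] with g ha hb'
  rwa [hb'] at ha

end Accessibility

end SubRiem

namespace SubRiem

/-! ### Horizontal curves -/

section Curves

variable {n : ℕ} {G : Type*} [TopologicalSpace G] [ChartedSpace (EuclideanSpace ℝ (Fin n)) G]
  [Group G]

/-- The curve `γ` is differentiable at `t` with velocity the value at `γ t` of the left-invariant
field generated by `v`. -/
def HasVel (γ : ℝ → G) (t : ℝ) (v : GroupLieAlgebra (𝓡 n) G) : Prop :=
  HasMFDerivAt 𝓘(ℝ, ℝ) (𝓡 n) γ t
    ((1 : ℝ →L[ℝ] ℝ).smulRight (mulInvariantVectorField (I := 𝓡 n) v (γ t)))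

theorem HasVel.congr {γ γ' : ℝ → G} {t : ℝ} {v : GroupLieAlgebra (𝓡 n) G} (h : HasVel γ t v)
    (he : γ' =ᶠ[𝓝 t] γ) : HasVel γ' t v := by
  have h1 := HasMFDerivAt.congr_of_eventuallyEq (f := γ) (f₁ := γ') h he
  have hw : (mulInvariantVectorField (I := 𝓡 n) v (γ t) : EuclideanSpace ℝ (Fin n)) =
    mulInvariantVectorField (I := 𝓡 n) v (γ' t) := by rw [he.eq_of_nhds]
  refine HasMFDerivAt.congr_mfderiv h1 ?_
  exact congrArg (fun w : EuclideanSpace ℝ (Fin n) => (1 : ℝ →L[ℝ] ℝ).smulRight w) hw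

theorem HasVel.comp_affine {γ : ℝ → G} {a b t : ℝ} {v : GroupLieAlgebra (𝓡 n) G}
    (h : HasVel γ (a * t + b) v) : HasVel (fun s => γ (a * s + b)) t (a • v) := by
  have h1 : HasMFDerivAt 𝓘(ℝ, ℝ) 𝓘(ℝ, ℝ) (fun s : ℝ => a * s + b) t
      (a • (1 : ℝ →L[ℝ] ℝ)) := by
    apply HasFDerivAt.hasMFDerivAt
    have := (((hasDerivAt_id t).const_mul a).add_const b).hasFDerivAt
    refine this.congr_fderiv ?_
    ext; simp
  have h2 := HasMFDerivAt.comp (g := γ) (f := fun s : ℝ => a * s + b) t h h1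
  unfold HasVel
  refine HasMFDerivAt.congr_mfderiv h2 ?_
  rw [mulInvariantVectorField_smul]
  let w : EuclideanSpace ℝ (Fin n) := mulInvariantVectorField (I := 𝓡 n) v (γ (a * t + b))
  refine ContinuousLinearMap.ext fun (s : ℝ) => ?_
  change (a * s) • w = s • a • w
  rw [smul_smul, mul_comm]

theorem hasVel_const (x : G) (t : ℝ) : HasVel (n := n) (fun _ => x) t 0 := by
  have h : HasMFDerivAt 𝓘(ℝ, ℝ) (𝓡 n) (fun _ : ℝ => x) t 0 := hasMFDerivAt_const x t
  refine HasMFDerivAt.congr_mfderiv h ?_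
  refine ContinuousLinearMap.ext fun (s : ℝ) => ?_
  have h0 : (mulInvariantVectorField (I := 𝓡 n) (0 : GroupLieAlgebra (𝓡 n) G) x :
      EuclideanSpace ℝ (Fin n)) = 0 := by
    unfold mulInvariantVectorField
    exact map_zero (mfderiv (𝓡 n) (𝓡 n) (fun y => x * y) (1 : G))
  exact ((congrArg (fun w : EuclideanSpace ℝ (Fin n) => s • w) h0).trans (smul_zero s)).symm

variable [LieGroup (𝓡 n) ∞ G]

theorem HasVel.mul_left {γ : ℝ → G} {t : ℝ} {v : GroupLieAlgebra (𝓡 n) G} (h : HasVel γ t v)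
    (g : G) : HasVel (fun s => g * γ s) t v := by
  have h2 := HasMFDerivAt.comp (g := fun y : G => g * y) (f := γ) t
    (mdifferentiable_mul_left (n := n) g (γ t)).hasMFDerivAt h
  unfold HasVel
  refine HasMFDerivAt.congr_mfderiv h2 ?_
  refine ContinuousLinearMap.ext fun (s : ℝ) => ?_
  let w : EuclideanSpace ℝ (Fin n) := mulInvariantVectorField (I := 𝓡 n) v (γ t)
  refine (map_smul (mfderiv (𝓡 n) (𝓡 n) (fun y : G => g * y) (γ t)) s w).trans ?_
  exact congrArg (fun w : EuclideanSpace ℝ (Fin n) => s • w)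
    (mfderiv_mul_left_mulInvariantVectorField v g (γ t))

theorem HasVel.hasDerivAt {γ : ℝ → G} {t : ℝ} {v : GroupLieAlgebra (𝓡 n) G} (h : HasVel γ t v)
    {F : Type*} [NormedAddCommGroup F] [NormedSpace ℝ F] {φ : G → F}
    (hφ : MDifferentiableAt (𝓡 n) 𝓘(ℝ, F) φ (γ t)) :
    HasDerivAt (fun s => φ (γ s)) (leftDeriv (n := n) φ (γ t) v) t := by
  have h2 := HasMFDerivAt.comp (g := φ) (f := γ) t hφ.hasMFDerivAt h
  have h3 : HasFDerivAt (fun s => φ (γ s))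
      ((1 : ℝ →L[ℝ] ℝ).smulRight (leftDeriv (n := n) φ (γ t) v)) t := by
    refine HasMFDerivAt.hasFDerivAt (HasMFDerivAt.congr_mfderiv h2 ?_)
    refine ContinuousLinearMap.ext fun (s : ℝ) => ?_
    let w : EuclideanSpace ℝ (Fin n) := mulInvariantVectorField (I := 𝓡 n) v (γ t)
    refine (map_smul (mfderiv (𝓡 n) 𝓘(ℝ, F) φ (γ t)) s w).trans ?_
    exact congrArg (fun w : F => s • w) (mfderiv_mulInvariantVectorField_eq_leftDeriv hφ v)
  simpa using h3.hasDerivAt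

theorem continuous_leftDeriv_apply {F : Type*} [NormedAddCommGroup F] [NormedSpace ℝ F] {φ : G → F}
    (hφ : ContMDiff (𝓡 n) 𝓘(ℝ, F) ∞ φ) (v : EuclideanSpace ℝ (Fin n)) :
    Continuous fun x => leftDeriv (n := n) φ x v := by
  have h1 := hφ.continuous_tangentMap (by simp)
  have h2 := (contMDiff_mulInvariantVectorField (I := 𝓡 n) (G := G) v).continuous
  have h3 := (tangentBundleModelSpaceHomeomorph 𝓘(ℝ, F)).continuous
  have h4 := (continuous_snd.comp (h3.comp (h1.comp h2)))
  refine h4.congr fun x => ?_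
  exact mfderiv_mulInvariantVectorField_eq_leftDeriv (hφ.mdifferentiable (by simp) x) v

theorem continuous_leftDeriv {F : Type*} [NormedAddCommGroup F] [NormedSpace ℝ F] {φ : G → F}
    (hφ : ContMDiff (𝓡 n) 𝓘(ℝ, F) ∞ φ) : Continuous fun x => leftDeriv (n := n) φ x :=
  continuous_clm_apply.2 fun v => continuous_leftDeriv_apply hφ v

/-- Existence of an integral curve of a left-invariant field through the identity. -/
theorem exists_hasVel_hasVelocityOne (v : GroupLieAlgebra (𝓡 n) G) :
    ∃ γ : ℝ → G, HasVelocityOne γ v ∧ ∀ᶠ t in 𝓝 0, HasVel γ t v := by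
  have h1 : ContMDiffAt (𝓡 n) ((𝓡 n).prod 𝓘(ℝ, EuclideanSpace ℝ (Fin n))) 1
      (fun x => (⟨x, mulInvariantVectorField (I := 𝓡 n) v x⟩ : TangentBundle (𝓡 n) G)) 1 :=
    (contMDiffAt_mulInvariantVectorField (I := 𝓡 n) v).of_le
      (by rw [minSmoothness_of_isRCLikeNormedField]; norm_num)
  have : IsManifold (𝓡 n) 1 G := IsManifold.of_le (n := ∞) (by simp)
  obtain ⟨γ, hγ0, hγ⟩ := exists_isMIntegralCurveAt_of_contMDiffAt_boundaryless (t₀ := (0 : ℝ)) h1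
  have hvel : ∀ᶠ t in 𝓝 0, HasVel γ t v := hγ
  have hc : ContinuousAt γ 0 := hγ.continuousAt
  refine ⟨γ, ⟨hγ0, hc, ?_⟩, hvel⟩
  have t1 : Tendsto γ (𝓝 0) (𝓝 1) := by rw [← hγ0]; exact hc
  have t2 : Tendsto (fun t => chartOne n G (γ t)) (𝓝 0) (𝓝 (chartOrigin n G)) :=
    (continuousAt_chartOne (n := n) (G := G)).tendsto.comp t1
  have hd : ∀ᶠ t in 𝓝 0, HasDerivAt (fun s => chartOne n G (γ s))
      (fderiv ℝ (chartMul n G) (chartOne n G (γ t), chartOrigin n G) (0, v)) t := by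
    filter_upwards [hvel, t1.eventually (eventually_mdifferentiableAt_chartOne (n := n)),
      t1.eventually (eventually_leftDeriv_chartOne (n := n) (G := G) v)] with t ha hb hc'
    rw [← hc']
    exact ha.hasDerivAt hb
  -- An integral curve is differentiable at each time near `0`; continuity of its velocity upgrades
  -- this to strict differentiability at `0`.
  have hcont : ContinuousAt (fun t => fderiv ℝ (chartMul n G)
      (chartOne n G (γ t), chartOrigin n G) (0, v)) 0 := by
    have h2 : ContinuousAt (fderiv ℝ (chartMul n G)) (chartOrigin n G, chartOrigin n G) :=
      (((contDiffAt_chartMul (n := n) (G := G)).of_le (m := 2) ENat.LEInfty.out).fderiv_right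
        (m := 1) le_rfl).continuousAt
    have h5 : chartOne n G (γ 0) = chartOrigin n G := by rw [hγ0]; rfl
    have h3 : ContinuousAt (fun t => (chartOne n G (γ t), chartOrigin n G)) 0 := by
      refine ContinuousAt.prodMk ?_ continuousAt_const
      rw [← h5] at t2
      exact t2
    have h2' : ContinuousAt (fderiv ℝ (chartMul n G)) (chartOne n G (γ 0), chartOrigin n G) := by
      rwa [h5]
    exact (ContinuousAt.comp (f := fun t => (chartOne n G (γ t), chartOrigin n G)) (x := (0 : ℝ))
      h2' h3).clm_apply continuousAt_const
  have hs := hasStrictDerivAt_of_hasDerivAt_of_continuousAt hd hcont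
  have h0 : fderiv ℝ (chartMul n G) (chartOne n G (γ 0), chartOrigin n G) (0, v) = v := by
    rw [hγ0]
    change fderiv ℝ (chartMul n G) (chartOrigin n G, chartOrigin n G) (0, v) = v
    have h7 := fderiv_partial_snd (E := EuclideanSpace ℝ (Fin n))
      (eventually_differentiableAt_chartMul (n := n) (G := G)).self_of_nhds v
    rw [← h7, fderiv_eq_id_of_eventuallyEq chartMul_origin_left]
    rfl
  rw [h0] at hs
  exact hs

end Curves

end SubRiem

/-! ### Subunit curves, the points they reach, and balls as neighbourhoods -/

theorem LipschitzOnWith.Icc_append {X : Type*} [PseudoMetricSpace X] {f : ℝ → X} {a b c : ℝ}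
    {K L : NNReal} (h₁ : LipschitzOnWith K f (Icc a b)) (h₂ : LipschitzOnWith L f (Icc b c)) :
    LipschitzOnWith (max K L) f (Icc a c) := by
  have key : ∀ x ∈ Icc a c, ∀ y ∈ Icc a c, x ≤ y → dist (f x) (f y) ≤ (max K L : NNReal) * (y - x) := by
    intro x hx y hy hxy
    have hK : (K : ℝ) ≤ (max K L : NNReal) := by exact_mod_cast le_max_left K L
    have hL : (L : ℝ) ≤ (max K L : NNReal) := by exact_mod_cast le_max_right K L
    rcases le_total y b with hyb | hyb
    · have := h₁.dist_le_mul x ⟨hx.1, hxy.trans hyb⟩ y ⟨hy.1, hyb⟩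
      rw [Real.dist_eq, abs_sub_comm, abs_of_nonneg (sub_nonneg.2 hxy)] at this
      exact this.trans (mul_le_mul_of_nonneg_right hK (sub_nonneg.2 hxy))
    · rcases le_total x b with hxb | hxb
      · have e1 := h₁.dist_le_mul x ⟨hx.1, hxb⟩ b ⟨hx.1.trans hxb, le_rfl⟩
        have e2 := h₂.dist_le_mul b ⟨le_rfl, hyb.trans hy.2⟩ y ⟨hyb, hy.2⟩
        rw [Real.dist_eq, abs_sub_comm, abs_of_nonneg (sub_nonneg.2 hxb)] at e1
        rw [Real.dist_eq, abs_sub_comm, abs_of_nonneg (sub_nonneg.2 hyb)] at e2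
        have e3 := mul_le_mul_of_nonneg_right hK (sub_nonneg.2 hxb)
        have e4 := mul_le_mul_of_nonneg_right hL (sub_nonneg.2 hyb)
        calc dist (f x) (f y) ≤ dist (f x) (f b) + dist (f b) (f y) := dist_triangle _ _ _
          _ ≤ (max K L : NNReal) * (b - x) + (max K L : NNReal) * (y - b) := by linarith
          _ = _ := by ring
      · have := h₂.dist_le_mul x ⟨hxb, hx.2⟩ y ⟨hyb, hy.2⟩
        rw [Real.dist_eq, abs_sub_comm, abs_of_nonneg (sub_nonneg.2 hxy)] at this
        exact this.trans (mul_le_mul_of_nonneg_right hL (sub_nonneg.2 hxy))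
  refine LipschitzOnWith.of_dist_le_mul fun x hx y hy => ?_
  rcases le_total x y with h | h
  · rw [Real.dist_eq, abs_sub_comm, abs_of_nonneg (sub_nonneg.2 h)]
    exact key x hx y hy h
  · rw [dist_comm, Real.dist_eq, abs_of_nonneg (sub_nonneg.2 h)]
    exact key y hy x hx h

namespace SubRiem

section Reachable

variable {n : ℕ} {G : Type*} [TopologicalSpace G] [ChartedSpace (EuclideanSpace ℝ (Fin n)) G]
  [Group G]

theorem core_inner_smul_smul (ip : InnerProductSpace.Core ℝ (GroupLieAlgebra (𝓡 n) G)) (a : ℝ)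
    (v : GroupLieAlgebra (𝓡 n) G) :
    ip.inner (a • v) (a • v) = a ^ 2 * ip.inner v v := by
  have h1 : ip.inner (a • v) (a • v) = a * ip.inner v (a • v) := ip.smul_left v (a • v) a
  have h2 : ip.inner v (a • v) = ip.inner (a • v) v := ip.conj_inner_symm (a • v) v |>.symm ▸ rfl
  have h3 : ip.inner (a • v) v = a * ip.inner v v := ip.smul_left v v a
  rw [h1, h2, h3]
  ring

/-- A curve on `[0, T]` which is Lipschitz when read through smooth functions and which, off a
finite set of times, is horizontal with speed at most one. -/
structure IsSubunitCurve (ip : InnerProductSpace.Core ℝ (GroupLieAlgebra (𝓡 n) G))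
    (𝓗 : Submodule ℝ (GroupLieAlgebra (𝓡 n) G)) (T : ℝ) (γ : ℝ → G)
    (u : ℝ → GroupLieAlgebra (𝓡 n) G) (F : Set ℝ) : Prop where
  continuousOn : ContinuousOn γ (Icc 0 T)
  lipschitz : ∀ φ : G → ℝ, ContMDiff (𝓡 n) 𝓘(ℝ, ℝ) ∞ φ →
    ∃ K, LipschitzOnWith K (fun t => φ (γ t)) (Icc 0 T)
  finite : F.Finite
  velocity : ∀ t ∈ Icc 0 T, t ∉ F → u t ∈ 𝓗 ∧ ip.inner (u t) (u t) ≤ 1 ∧ HasVel γ t (u t)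

variable {ip : InnerProductSpace.Core ℝ (GroupLieAlgebra (𝓡 n) G)}
  {𝓗 : Submodule ℝ (GroupLieAlgebra (𝓡 n) G)} {S T : ℝ} {γ γ' : ℝ → G}
  {u u' : ℝ → GroupLieAlgebra (𝓡 n) G} {F F' : Set ℝ}

/-- Changes of time are written `a * t + b` throughout, and the velocity as `a • u`, to match
`HasVel.comp_affine`. -/
theorem IsSubunitCurve.reverse (h : IsSubunitCurve ip 𝓗 T γ u F) :
    IsSubunitCurve ip 𝓗 T (fun t => γ ((-1) * t + T)) (fun t => (-1 : ℝ) • u ((-1) * t + T))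
      ((fun t => (-1) * t + T) ⁻¹' F) := by
  have hmaps : MapsTo (fun t => (-1) * t + T) (Icc 0 T) (Icc 0 T) := by
    rintro t ⟨h0, h1⟩
    exact ⟨by linarith, by linarith⟩
  refine ⟨h.continuousOn.comp (by fun_prop) hmaps, fun φ hφ => ?_, ?_, fun t ht htF => ?_⟩
  · obtain ⟨K, hK⟩ := h.lipschitz φ hφ
    have h1 : LipschitzOnWith 1 (fun t : ℝ => (-1) * t + T) (Icc 0 T) :=
      LipschitzOnWith.of_dist_le_mul fun x _ y _ => by
        rw [Real.dist_eq, Real.dist_eq, abs_sub_comm x y]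
        simp only [NNReal.coe_one, one_mul]
        exact le_of_eq (congrArg _ (by ring))
    exact ⟨_, hK.comp h1 hmaps⟩
  · refine h.finite.preimage (Function.Injective.injOn fun x y hxy => ?_)
    have hxy' : (_ : ℝ) = _ := hxy
    linarith
  · obtain ⟨h1, h2, h3⟩ := h.velocity _ (hmaps ht) htF
    refine ⟨𝓗.smul_mem _ h1, ?_, h3.comp_affine⟩
    rw [core_inner_smul_smul]
    linarith

/-- The velocities on the two sides of the junction may differ, so the time `S` joins the
exceptional set. -/
theorem IsSubunitCurve.append (hS : 0 ≤ S) (h : IsSubunitCurve ip 𝓗 S γ u F)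
    (h' : IsSubunitCurve ip 𝓗 T γ' u' F') (hT : 0 ≤ T) (he : γ S = γ' 0) :
    IsSubunitCurve ip 𝓗 (S + T) (fun t => if t ≤ S then γ t else γ' (1 * t + (-S)))
      (fun t => if t ≤ S then u t else (1 : ℝ) • u' (1 * t + (-S)))
      (F ∪ {S} ∪ (fun t => 1 * t + (-S)) ⁻¹' F') := by
  have hmaps : MapsTo (fun t => 1 * t + (-S)) (Icc S (S + T)) (Icc 0 T) := by
    rintro t ⟨h0, h1⟩
    exact ⟨by linarith, by linarith⟩
  have e1 : EqOn (fun t => if t ≤ S then γ t else γ' (1 * t + (-S))) γ (Icc 0 S) := fun t ht => by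
    simp [ht.2]
  have e2 : EqOn (fun t => if t ≤ S then γ t else γ' (1 * t + (-S)))
      (fun t => γ' (1 * t + (-S))) (Icc S (S + T)) := fun t ht => by
    rcases ht.1.eq_or_lt with rfl | hlt
    · simp [he]
    · simp [not_le.2 hlt]
  have hunion : Icc 0 (S + T) = Icc 0 S ∪ Icc S (S + T) :=
    (Icc_union_Icc_eq_Icc hS (by linarith)).symm
  refine ⟨?_, fun φ hφ => ?_, ?_, fun t ht htF => ?_⟩
  · rw [hunion]
    refine ContinuousOn.union_of_isClosed ?_ ?_ isClosed_Icc isClosed_Icc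
    · exact h.continuousOn.congr e1
    · exact (h'.continuousOn.comp (by fun_prop) hmaps).congr e2
  · obtain ⟨K, hK⟩ := h.lipschitz φ hφ
    obtain ⟨L, hL⟩ := h'.lipschitz φ hφ
    have h1 : LipschitzOnWith 1 (fun t : ℝ => 1 * t + (-S)) (Icc S (S + T)) :=
      LipschitzOnWith.of_dist_le_mul fun x _ y _ => by
        rw [Real.dist_eq, Real.dist_eq]
        simp only [NNReal.coe_one, one_mul]
        exact le_of_eq (congrArg _ (by ring))
    have hL' := hL.comp h1 hmaps
    refine ⟨_, LipschitzOnWith.Icc_append (b := S) (K := K) (L := L * 1) ?_ ?_⟩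
    · intro x hx y hy
      have ex := e1 hx
      have ey := e1 hy
      simp only at ex ey ⊢
      rw [ex, ey]
      exact hK hx hy
    · intro x hx y hy
      have ex := e2 hx
      have ey := e2 hy
      simp only at ex ey ⊢
      rw [ex, ey]
      exact hL' hx hy
  · refine (h.finite.union (finite_singleton S)).union
      (h'.finite.preimage (Function.Injective.injOn fun x y hxy => ?_))
    have hxy' : (_ : ℝ) = _ := hxy
    linarith
  · simp only [mem_union, mem_singleton_iff, mem_preimage, not_or] at htF
    obtain ⟨⟨hF, hne⟩, hF'⟩ := htF
    rcases lt_or_gt_of_ne hne with hlt | hgt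
    · obtain ⟨h1, h2, h3⟩ := h.velocity t ⟨ht.1, hlt.le⟩ hF
      simp only [hlt.le, if_true]
      refine ⟨h1, h2, h3.congr ?_⟩
      filter_upwards [Iio_mem_nhds hlt] with s hs
      simp [le_of_lt (mem_Iio.1 hs)]
    · obtain ⟨h1, h2, h3⟩ := h'.velocity _ (hmaps ⟨hgt.le, ht.2⟩) hF'
      simp only [not_le.2 hgt, if_false]
      refine ⟨𝓗.smul_mem _ h1, ?_, h3.comp_affine.congr ?_⟩
      · rw [core_inner_smul_smul]; linarith
      · filter_upwards [Ioi_mem_nhds hgt] with s hs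
        simp [not_le.2 (mem_Ioi.1 hs)]

variable (ip 𝓗) in
/-- The points reached from the identity by a subunit curve in time at most `s`. -/
def reachable (s : ℝ) : Set G :=
  {y | ∃ T, 0 ≤ T ∧ T ≤ s ∧ ∃ γ u F, IsSubunitCurve ip 𝓗 T γ u F ∧ γ 0 = 1 ∧ γ T = y}

theorem reachable_mono : Monotone (reachable ip 𝓗) := by
  rintro s t hst y ⟨T, h0, hT, h⟩
  exact ⟨T, h0, hT.trans hst, h⟩

theorem isSubunitCurve_const (x : G) (T : ℝ) : IsSubunitCurve ip 𝓗 T (fun _ => x) (fun _ => 0) ∅ := by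
  refine ⟨continuousOn_const, fun φ _ => ⟨0, LipschitzOnWith.of_dist_le_mul fun _ _ _ _ => by simp⟩,
    finite_empty, fun t _ _ => ⟨𝓗.zero_mem, ?_, hasVel_const x t⟩⟩
  have := core_inner_smul_smul ip 0 0
  simp only [smul_zero] at this
  rw [this]; norm_num

theorem one_mem_reachable : (1 : G) ∈ reachable ip 𝓗 0 :=
  ⟨0, le_rfl, le_rfl, _, _, _, isSubunitCurve_const 1 0, rfl, rfl⟩

/-- Rescaling time to `[0,1]` multiplies the velocity by `T`, so the speed is at most `T` almost
everywhere. -/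
theorem IsSubunitCurve.ccDist_le (h : IsSubunitCurve ip 𝓗 T γ u F) (hT : 0 < T) :
    ccDist ip 𝓗 (γ 0) (γ T) ≤ ENNReal.ofReal T := by
  have hmaps : MapsTo (fun t => T * t + 0) (Icc 0 1) (Icc 0 T) := by
    rintro t ⟨h0, h1⟩
    exact ⟨by positivity, by nlinarith⟩
  have hfin : ((fun t => T * t + 0) ⁻¹' F).Finite := by
    refine h.finite.preimage (Function.Injective.injOn fun x y hxy => ?_)
    simpa [hT.ne'] using hxy
  have hae : ∀ᵐ t ∂(volume.restrict (Icc (0 : ℝ) 1)), t ∈ Icc (0 : ℝ) 1 ∧ T * t + 0 ∉ F := by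
    refine (ae_restrict_mem measurableSet_Icc).and (ae_restrict_of_ae ?_)
    exact hfin.countable.ae_notMem volume
  refine (iInf_le_of_le (fun t => γ (T * t + 0)) (iInf_le_of_le (fun t => T • u (T * t + 0))
    (iInf_le_of_le ⟨⟨?_, fun φ hφ => ?_, ?_⟩, by simp, by simp⟩ ?_)))
  · exact h.continuousOn.comp (by fun_prop) hmaps
  · obtain ⟨K, hK⟩ := h.lipschitz φ hφ
    have h1 : LipschitzOnWith T.toNNReal (fun t : ℝ => T * t + 0) (Icc 0 1) :=
      LipschitzOnWith.of_dist_le_mul fun x _ y _ => by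
        rw [Real.dist_eq, Real.dist_eq, Real.coe_toNNReal _ hT.le, ← abs_of_pos hT, ← abs_mul,
          abs_of_pos hT]
        exact le_of_eq (congrArg _ (by ring))
    have := hK.comp h1 hmaps
    refine LipschitzOnWith.absolutelyContinuousOnInterval (K := K * T.toNNReal) ?_
    rw [uIcc_of_le zero_le_one]
    exact this
  · filter_upwards [hae] with t ht
    obtain ⟨h1, h2, h3⟩ := h.velocity _ (hmaps ht.1) ht.2
    exact ⟨𝓗.smul_mem _ h1, h3.comp_affine⟩
  · unfold curveLength
    calc _ ≤ ∫⁻ _ in Icc (0 : ℝ) 1, ENNReal.ofReal T := by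
          refine lintegral_mono_ae ?_
          filter_upwards [hae] with t ht
          obtain ⟨h1, h2, h3⟩ := h.velocity _ (hmaps ht.1) ht.2
          refine ENNReal.ofReal_le_ofReal ?_
          rw [core_inner_smul_smul]
          refine Real.sqrt_le_iff.2 ⟨hT.le, ?_⟩
          nlinarith [sq_nonneg T]
      _ = ENNReal.ofReal T := by simp

theorem ccDist_self (x : G) : ccDist ip 𝓗 x x = 0 := by
  have h : ∀ T > 0, ccDist ip 𝓗 x x ≤ ENNReal.ofReal T := fun T hT =>
    (isSubunitCurve_const (ip := ip) (𝓗 := 𝓗) x T).ccDist_le hT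
  refine le_antisymm (le_of_forall_pos_le_add fun ε hε => ?_) bot_le
  rw [zero_add]
  by_cases htop : ε = ⊤
  · simp [htop]
  · have := h ε.toReal (ENNReal.toReal_pos hε.ne' htop)
    rwa [ENNReal.ofReal_toReal htop] at this

theorem reachable_subset_ccBall {s r : ℝ} (hs : s < r) (hr : 0 < r) :
    reachable ip 𝓗 s ⊆ ccBall ip 𝓗 (1 : G) r := by
  rintro y ⟨T, h0, hT, γ, u, F, h, hγ0, hγT⟩
  change ccDist ip 𝓗 1 y < ENNReal.ofReal r
  rcases h0.eq_or_lt with rfl | hpos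
  · rw [← hγT, hγ0, ccDist_self]
    simpa using hr
  · rw [← hγ0, ← hγT]
    refine (h.ccDist_le hpos).trans_lt ?_
    exact (ENNReal.ofReal_lt_ofReal_iff hr).2 (hT.trans_lt hs)

variable [LieGroup (𝓡 n) ∞ G]

theorem IsSubunitCurve.mul_left (h : IsSubunitCurve ip 𝓗 T γ u F) (g : G) :
    IsSubunitCurve ip 𝓗 T (fun t => g * γ t) u F := by
  have : IsTopologicalGroup G := topologicalGroup_of_lieGroup (𝓡 n) ∞
  refine ⟨continuousOn_const.mul h.continuousOn, fun φ hφ => ?_, h.finite, fun t ht htF => ?_⟩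
  · exact h.lipschitz (fun x => φ (g * x)) (hφ.comp (contMDiff_mul_left (a := g)))
  · obtain ⟨h1, h2, h3⟩ := h.velocity t ht htF
    exact ⟨h1, h2, h3.mul_left g⟩

/-- The reversed curve runs from `x` to `1`; its left translate by `x⁻¹` runs from `1` to `x⁻¹`. -/
theorem inv_mem_reachable (s : ℝ) (x : G) (hx : x ∈ reachable ip 𝓗 s) :
    x⁻¹ ∈ reachable ip 𝓗 s := by
  obtain ⟨T, h0, hT, γ, u, F, h, hγ0, hγT⟩ := hx
  refine ⟨T, h0, hT, _, _, _, h.reverse.mul_left x⁻¹, ?_, ?_⟩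
  · simp [hγT]
  · simp [hγ0]

/-- A curve from `1` to `x` is followed by the translate by `x` of a curve from `1` to `y`. -/
theorem mul_mem_reachable (s t : ℝ) (x : G) (hx : x ∈ reachable ip 𝓗 s) (y : G)
    (hy : y ∈ reachable ip 𝓗 t) : x * y ∈ reachable ip 𝓗 (s + t) := by
  obtain ⟨S, h0, hS, γ, u, F, h, hγ0, hγS⟩ := hx
  obtain ⟨T, h0', hT, γ', u', F', h', hγ0', hγT'⟩ := hy
  refine ⟨S + T, by linarith, by linarith, _, _, _,
    h.append h0 (h'.mul_left x) h0' (by simp [hγS, hγ0']), ?_, ?_⟩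
  · simp [h0, hγ0]
  · by_cases hle : S + T ≤ S
    · have : T = 0 := by linarith
      subst this
      simp [hγS, ← hγT', hγ0']
    · simp [hle, hγT']

theorem exists_curve_reachable (x : GroupLieAlgebra (𝓡 n) G) (hx : x ∈ 𝓗) :
    ∃ γ : ℝ → G, HasVelocityOne γ x ∧ ∀ δ > 0, ∀ᶠ t in 𝓝 0, γ t ∈ reachable ip 𝓗 δ := by
  obtain ⟨γ, hγ, hvel⟩ := exists_hasVel_hasVelocityOne x
  refine ⟨γ, hγ, fun δ hδ => ?_⟩
  obtain ⟨η, hη, hball⟩ := Metric.eventually_nhds_iff_ball.1 hvel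
  -- As `⟨x, x⟩ ≤ A ≤ A²`, the vector `a • x` has length at most one whenever `|a| ≤ 1 / A`. The
  -- point `γ t` is thus reached in time `A * |t|`, by running `γ` at the rate `a = t / T`.
  set A : ℝ := ip.inner x x + 1 with hA
  have hnn : 0 ≤ ip.inner x x := by simpa using ip.re_inner_nonneg x
  have hA1 : 1 ≤ A := by linarith
  have hA0 : 0 < A := by linarith
  have hev : ∀ᶠ t : ℝ in 𝓝 0, A * |t| < δ ∧ |t| < η := by
    have h1 : Tendsto (fun t : ℝ => A * |t|) (𝓝 0) (𝓝 0) := by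
      have h : Continuous fun t : ℝ => A * |t| := by fun_prop
      simpa using h.tendsto 0
    have h2 : Tendsto (fun t : ℝ => |t|) (𝓝 0) (𝓝 0) := by
      simpa using continuous_abs.tendsto (0 : ℝ)
    exact (h1.eventually (gt_mem_nhds hδ)).and (h2.eventually (gt_mem_nhds hη))
  filter_upwards [hev] with t ⟨ht1, ht2⟩
  set T := A * |t| with hT
  have hT0 : 0 ≤ T := by positivity
  -- For `t = 0` this is `0 / 0 = 0`, and `a * T = t` still holds.
  set a := t / T with ha
  have habs : |a| ≤ 1 / A := by
    rw [ha, abs_div, abs_of_nonneg hT0, hT]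
    by_cases h0 : |t| = 0
    · simp [h0]; positivity
    · rw [div_le_div_iff₀ (by positivity) hA0]
      linarith
  have haT : a * T = t := by
    by_cases h0 : t = 0
    · simp [ha, h0]
    · have : T ≠ 0 := by rw [hT]; exact mul_ne_zero hA0.ne' (abs_ne_zero.2 h0)
      rw [ha]; field_simp
  have hin : ∀ s ∈ Icc 0 T, a * s + 0 ∈ Metric.ball (0 : ℝ) η := by
    intro s hs
    rw [mem_ball_zero_iff, Real.norm_eq_abs, add_zero, abs_mul, abs_of_nonneg hs.1]
    calc |a| * s ≤ |a| * T := mul_le_mul_of_nonneg_left hs.2 (abs_nonneg a)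
      _ = |t| := by rw [← haT, abs_mul, abs_of_nonneg hT0]
      _ < η := ht2
  have hv : ∀ s ∈ Icc 0 T, HasVel (fun s => γ (a * s + 0)) s (a • x) := fun s hs =>
    (hball _ (hin s hs)).comp_affine
  have hc : ContinuousOn (fun s => γ (a * s + 0)) (Icc 0 T) := fun s hs => by
    have : ContinuousAt (fun s => γ (a * s + 0)) s := HasMFDerivAt.continuousAt (hv s hs)
    exact this.continuousWithinAt
  refine ⟨T, hT0, ht1.le, fun s => γ (a * s + 0), fun _ => a • x, ∅,
    ⟨hc, fun φ hφ => ?_, finite_empty, fun s hs _ => ⟨𝓗.smul_mem _ hx, ?_, hv s hs⟩⟩, ?_, ?_⟩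
  · have hcomp : IsCompact ((fun s => γ (a * s + 0)) '' Icc 0 T) := isCompact_Icc.image_of_continuousOn hc
    obtain ⟨C, hC⟩ := hcomp.exists_bound_of_continuousOn
      (continuous_leftDeriv_apply hφ (a • x : GroupLieAlgebra (𝓡 n) G)).continuousOn
    refine ⟨C.toNNReal, Convex.lipschitzOnWith_of_nnnorm_hasDerivWithin_le (convex_Icc 0 T)
      (fun s hs => ((hv s hs).hasDerivAt (hφ.mdifferentiable (by simp) _)).hasDerivWithinAt)
      fun s hs => ?_⟩
    rw [← NNReal.coe_le_coe, coe_nnnorm]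
    exact (hC _ ⟨s, hs, rfl⟩).trans (Real.le_coe_toNNReal C)
  · rw [core_inner_smul_smul]
    have h1 : a ^ 2 ≤ (1 / A) ^ 2 := by
      rw [← sq_abs a]; exact pow_le_pow_left₀ (abs_nonneg a) habs 2
    calc a ^ 2 * ip.inner x x ≤ (1 / A) ^ 2 * ip.inner x x := mul_le_mul_of_nonneg_right h1 hnn
      _ ≤ (1 / A) ^ 2 * A ^ 2 := by
        refine mul_le_mul_of_nonneg_left ?_ (by positivity)
        nlinarith
      _ = 1 := by field_simp
  · simp [hγ.zero]
  · simp [haT]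

/-- If the horizontal directions generate the Lie algebra, the balls of the Carnot–Carathéodory
distance are neighbourhoods of their centre. -/
theorem ccBall_one_mem_nhds (h𝓗 : LieSubalgebra.lieSpan ℝ (GroupLieAlgebra (𝓡 n) G)
      (𝓗 : Set (GroupLieAlgebra (𝓡 n) G)) = ⊤) {r : ℝ} (hr : 0 < r) :
    ccBall ip 𝓗 (1 : G) r ∈ 𝓝 (1 : G) :=
  mem_of_superset (mem_nhds_one_of_lieSpan_eq_top reachable_mono one_mem_reachable
    mul_mem_reachable inv_mem_reachable h𝓗 exists_curve_reachable (half_pos hr))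
    (reachable_subset_ccBall (half_lt_self hr) hr)

/-- Left translation by `x` preserves horizontality and the velocity `u` in the Lie algebra, hence
the length. -/
theorem mul_mem_ccBall {x y : G} {r : ℝ} (hy : y ∈ ccBall ip 𝓗 (1 : G) r) :
    x * y ∈ ccBall ip 𝓗 x r := by
  have : IsTopologicalGroup G := topologicalGroup_of_lieGroup (𝓡 n) ∞
  refine lt_of_le_of_lt (b := ccDist ip 𝓗 1 y) ?_ hy
  refine le_iInf fun γ => le_iInf fun u => le_iInf fun ⟨h, h0, h1⟩ => ?_
  refine iInf_le_of_le (fun t => x * γ t) (iInf_le_of_le u (iInf_le_of_le ⟨⟨?_, fun φ hφ => ?_, ?_⟩,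
    by simp [h0], by simp [h1]⟩ le_rfl))
  · exact continuousOn_const.mul h.continuousOn
  · exact h.absolutelyContinuous (fun y => φ (x * y)) (hφ.comp (contMDiff_mul_left (a := x)))
  · filter_upwards [h.velocity] with t ht
    exact ⟨ht.1, HasVel.mul_left ht.2 x⟩

end Reachable

end SubRiem

/-! ### Balls lie in translates of one compact set -/

theorem InnerProductSpace.Core.exists_norm_le {V E : Type*} [AddCommGroup V] [Module ℝ V]
    [FiniteDimensional ℝ V] [NormedAddCommGroup E] [NormedSpace ℝ E]
    (ip : InnerProductSpace.Core ℝ V) (L : V →ₗ[ℝ] E) :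
    ∃ C, 0 ≤ C ∧ ∀ v, ‖L v‖ ≤ C * √(ip.inner v v) := by
  let _ : NormedAddCommGroup V := ip.toNormedAddCommGroup
  let _ : InnerProductSpace ℝ V := InnerProductSpace.ofCore ip.toCore
  refine ⟨‖L.toContinuousLinearMap‖, ContinuousLinearMap.opNorm_nonneg _, fun v => ?_⟩
  have h := L.toContinuousLinearMap.le_opNorm v
  have hn : ‖v‖ = √(ip.inner v v) := rfl
  rw [hn] at h
  exact h

namespace SubRiem

section Bounded

variable {n : ℕ} {G : Type*} [TopologicalSpace G] [ChartedSpace (EuclideanSpace ℝ (Fin n)) G]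
  [Group G]

theorem leftDeriv_comp_mul_left {F : Type*} [NormedAddCommGroup F] [NormedSpace ℝ F] (φ : G → F)
    (g x : G) : leftDeriv (n := n) (fun y => φ (g * y)) x = leftDeriv φ (g * x) := by
  simp only [leftDeriv, mul_assoc]

variable [LieGroup (𝓡 n) ∞ G]

theorem leftDeriv_eq_zero {F : Type*} [NormedAddCommGroup F] [NormedSpace ℝ F] {φ : G → F} {x : G}
    (hx : x ∉ tsupport φ) : leftDeriv (n := n) φ x = 0 := by
  have : IsTopologicalGroup G := topologicalGroup_of_lieGroup (𝓡 n) ∞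
  have h0 : φ =ᶠ[𝓝 x] fun _ => 0 := notMem_tsupport_iff_eventuallyEq.1 hx
  have ht : Tendsto (fun b => x * chartInv G b) (𝓝 (chartOrigin n G)) (𝓝 x) := by
    simpa using (tendsto_const_nhds (x := x)).mul (tendsto_chartInv (n := n) (G := G))
  have h1 : (fun b => φ (x * chartInv G b)) =ᶠ[𝓝 (chartOrigin n G)] fun _ => (0 : F) :=
    ht.eventually h0
  rw [leftDeriv, h1.fderiv_eq]
  simp

theorem hasCompactSupport_leftDeriv {F : Type*} [NormedAddCommGroup F] [NormedSpace ℝ F] {φ : G → F}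
    (hc : HasCompactSupport φ) : HasCompactSupport fun x => leftDeriv (n := n) φ x :=
  hc.mono' fun _ hx => not_not.1 fun hx' => hx (leftDeriv_eq_zero hx')

/-- The left-invariant differential is continuous with compact support, hence bounded, and the two
norms on the finite-dimensional Lie algebra are comparable. -/
theorem exists_leftDeriv_bound {φ : G → ℝ} (hφ : ContMDiff (𝓡 n) 𝓘(ℝ, ℝ) ∞ φ)
    (hc : HasCompactSupport φ) (ip : InnerProductSpace.Core ℝ (GroupLieAlgebra (𝓡 n) G)) :
    ∃ C, 0 < C ∧ ∀ (x : G) (v : GroupLieAlgebra (𝓡 n) G),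
      ‖leftDeriv (n := n) φ x v‖ ≤ C * √(ip.inner v v) := by
  obtain ⟨C₁, hC₁⟩ := (continuous_leftDeriv hφ).bounded_above_of_compact_support
    (hasCompactSupport_leftDeriv hc)
  have : FiniteDimensional ℝ (GroupLieAlgebra (𝓡 n) G) :=
    inferInstanceAs (FiniteDimensional ℝ (EuclideanSpace ℝ (Fin n)))
  let L : GroupLieAlgebra (𝓡 n) G →ₗ[ℝ] EuclideanSpace ℝ (Fin n) :=
    (LinearMap.id : EuclideanSpace ℝ (Fin n) →ₗ[ℝ] EuclideanSpace ℝ (Fin n))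
  obtain ⟨C₂, hC₂0, hC₂⟩ := ip.exists_norm_le L
  have hC₁0 : 0 ≤ C₁ := (norm_nonneg _).trans (hC₁ 1)
  -- The `+ 1` makes the constant strictly positive, so that it can be divided by.
  refine ⟨C₁ * C₂ + 1, by positivity, fun x v => ?_⟩
  calc ‖leftDeriv (n := n) φ x v‖ ≤ ‖leftDeriv (n := n) φ x‖ * ‖L v‖ :=
        (leftDeriv (n := n) φ x).le_opNorm (L v)
    _ ≤ C₁ * (C₂ * √(ip.inner v v)) := mul_le_mul (hC₁ x) (hC₂ v) (norm_nonneg _) hC₁0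
    _ ≤ (C₁ * C₂ + 1) * √(ip.inner v v) := by
      have := Real.sqrt_nonneg (ip.inner v v)
      nlinarith

/-- A horizontal curve moves slowly, when read through a translate of a smooth function. -/
theorem IsHorizontalCurve.enorm_sub_le {𝓗 : Submodule ℝ (GroupLieAlgebra (𝓡 n) G)}
    {ip : InnerProductSpace.Core ℝ (GroupLieAlgebra (𝓡 n) G)} {γ : ℝ → G}
    {u : ℝ → GroupLieAlgebra (𝓡 n) G} (h : IsHorizontalCurve 𝓗 γ u) {φ : G → ℝ}
    (hφ : ContMDiff (𝓡 n) 𝓘(ℝ, ℝ) ∞ φ) {C : ℝ} (hC0 : 0 < C)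
    (hC : ∀ (x : G) (v : GroupLieAlgebra (𝓡 n) G),
      ‖leftDeriv (n := n) φ x v‖ ≤ C * √(ip.inner v v)) (g : G) {s t : ℝ} (hs : 0 ≤ s) (hst : s ≤ t)
    (ht : t ≤ 1) : ‖φ (g * γ t) - φ (g * γ s)‖ₑ ≤
      ENNReal.ofReal C * ∫⁻ τ in Ioc s t, ENNReal.ofReal (√(ip.inner (u τ) (u τ))) := by
  have hψ : ContMDiff (𝓡 n) 𝓘(ℝ, ℝ) ∞ fun y => φ (g * y) := hφ.comp (contMDiff_mul_left (a := g))
  have hac := (h.absolutelyContinuous _ hψ).mono (c := s) (d := t) (by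
    rw [uIcc_of_le hst, uIcc_of_le zero_le_one]
    exact Icc_subset_Icc hs ht)
  have hftc := hac.integral_deriv_eq_sub
  simp only [Function.comp_apply] at hftc
  rw [← hftc, intervalIntegral.integral_of_le hst]
  refine (enorm_integral_le_lintegral_enorm _).trans ?_
  rw [← lintegral_const_mul' _ _ ENNReal.ofReal_ne_top]
  refine lintegral_mono_ae ?_
  have hvel := ae_restrict_of_ae_restrict_of_subset
    (Ioc_subset_Icc_self.trans (Icc_subset_Icc hs ht)) h.velocity
  filter_upwards [hvel] with τ hτ
  have hd := HasVel.hasDerivAt (γ := γ) hτ.2 (hψ.mdifferentiable (by simp) (γ τ))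
  have hd' : deriv ((fun y => φ (g * y)) ∘ γ) τ = leftDeriv (n := n) φ (g * γ τ) (u τ) := by
    rw [← leftDeriv_comp_mul_left]
    exact hd.deriv
  rw [hd', ← ENNReal.ofReal_mul hC0.le, ← ofReal_norm]
  exact ENNReal.ofReal_le_ofReal (hC _ _)

/-- Absolute continuity of the integral. No measurability of `f` is assumed, since the velocity `u`
of a horizontal curve is an arbitrary function; additivity over measurable sets holds for the lower
integral all the same. -/
theorem continuousOn_primitive_lintegral {f : ℝ → ℝ≥0∞}
    (hf : ∫⁻ t in Icc (0 : ℝ) 1, f t ≠ ⊤) :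
    ContinuousOn (fun t => (∫⁻ τ in Ioc 0 t, f τ).toReal) (Icc 0 1) := by
  have hsub : ∀ t ≤ 1, Ioc (0 : ℝ) t ⊆ Icc 0 1 := fun t ht =>
    Ioc_subset_Icc_self.trans (Icc_subset_Icc le_rfl ht)
  have hfin : ∀ t ≤ 1, ∫⁻ τ in Ioc 0 t, f τ ≠ ⊤ := fun t ht =>
    ne_top_of_le_ne_top hf (lintegral_mono_set (hsub t ht))
  have hadd : ∀ s t, 0 ≤ s → s ≤ t → t ≤ 1 → (∫⁻ τ in Ioc 0 t, f τ).toReal =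
      (∫⁻ τ in Ioc 0 s, f τ).toReal + (∫⁻ τ in Ioc s t, f τ).toReal := by
    intro s t hs hst ht
    have h1 : Ioc s t ⊆ Icc 0 1 := Ioc_subset_Icc_self.trans (Icc_subset_Icc hs ht)
    rw [← ENNReal.toReal_add (hfin s (hst.trans ht))
      (ne_top_of_le_ne_top hf (lintegral_mono_set h1)), ← lintegral_union measurableSet_Ioc
      (Ioc_disjoint_Ioc_of_le le_rfl), Ioc_union_Ioc_eq_Ioc hs hst]
  rw [Metric.continuousOn_iff]
  intro t ht ε hε
  obtain ⟨δ, hδ, hδε⟩ := exists_pos_setLIntegral_lt_of_measure_lt hf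
    (ENNReal.ofReal_pos.2 hε).ne'
  have key : ∀ s t, 0 ≤ s → s ≤ t → t ≤ 1 → ENNReal.ofReal (t - s) < δ →
      |(∫⁻ τ in Ioc 0 t, f τ).toReal - (∫⁻ τ in Ioc 0 s, f τ).toReal| < ε := by
    intro s t hs hst ht hd
    rw [hadd s t hs hst ht, add_sub_cancel_left, abs_of_nonneg ENNReal.toReal_nonneg]
    have h1 : Ioc s t ⊆ Icc 0 1 := Ioc_subset_Icc_self.trans (Icc_subset_Icc hs ht)
    have h2 := hδε (Ioc s t) (by
      refine (Measure.restrict_apply_le _ _).trans_lt ?_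
      rwa [Real.volume_Ioc])
    rw [Measure.restrict_restrict measurableSet_Ioc, inter_eq_left.2 h1] at h2
    exact (ENNReal.lt_ofReal_iff_toReal_lt h2.ne_top).1 h2
  by_cases hδtop : δ = ⊤
  · refine ⟨1, one_pos, fun s hs _ => ?_⟩
    rw [Real.dist_eq]
    rcases le_total s t with h | h
    · rw [abs_sub_comm]
      exact key s t hs.1 h ht.2 (by simp [hδtop])
    · exact key t s ht.1 h hs.2 (by simp [hδtop])
  · refine ⟨δ.toReal, ENNReal.toReal_pos hδ.ne' hδtop, fun s hs hd => ?_⟩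
    rw [Real.dist_eq] at hd ⊢
    have hlt : ∀ x : ℝ, x < δ.toReal → ENNReal.ofReal x < δ := fun x hx =>
      (ENNReal.ofReal_lt_ofReal_iff (ENNReal.toReal_pos hδ.ne' hδtop)).2 hx |>.trans_eq
        (ENNReal.ofReal_toReal hδtop)
    rcases le_total s t with h | h
    · rw [abs_sub_comm]
      refine key s t hs.1 h ht.2 (hlt _ ?_)
      rwa [abs_sub_comm, abs_of_nonneg (sub_nonneg.2 h)] at hd
    · refine key t s ht.1 h hs.2 (hlt _ ?_)
      rwa [abs_of_nonneg (sub_nonneg.2 h)] at hd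

open scoped Pointwise in
/-- Carnot–Carathéodory balls of a fixed radius are contained in the translates of a fixed compact
set. -/
theorem exists_isCompact_ccBall_subset [T2Space G]
    (ip : InnerProductSpace.Core ℝ (GroupLieAlgebra (𝓡 n) G))
    (𝓗 : Submodule ℝ (GroupLieAlgebra (𝓡 n) G)) (r : ℝ) :
    ∃ K : Set G, IsCompact K ∧ ∀ x, ccBall ip 𝓗 x r ⊆ (fun y => x * y) '' K := by
  have : IsTopologicalGroup G := topologicalGroup_of_lieGroup (𝓡 n) ∞
  obtain ⟨φ⟩ : Nonempty (SmoothBumpFunction (𝓡 n) (1 : G)) := inferInstance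
  have hφ : ContMDiff (𝓡 n) 𝓘(ℝ, ℝ) ∞ φ := φ.contMDiff
  have hcs : HasCompactSupport φ := φ.hasCompactSupport
  obtain ⟨C, hC0, hC⟩ := exists_leftDeriv_bound hφ hcs ip
  set K := tsupport φ with hK
  have hKc : IsCompact K := hcs
  have h1K : (1 : G) ∈ K := subset_tsupport _ (by simp)
  -- Along a piece of length at most `ε` a translate of `φ` varies by at most `C * ε = 1 / 2`, so it
  -- cannot drop from `φ 1 = 1` to `0`. The displacement over such a piece therefore stays in `K`.
  set ε := 1 / (2 * C) with hε
  have hε0 : 0 < ε := by positivity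
  obtain ⟨N, hN⟩ := exists_nat_ge (r / ε)
  have hpow : ∀ k : ℕ, IsCompact (K ^ k) := fun k => by
    induction k with
    | zero => rw [pow_zero]; exact isCompact_singleton
    | succ k ih => rw [pow_succ]; exact ih.mul hKc
  -- The length is below `r ≤ N * ε`, so `N + 1` pieces of length at most `ε` suffice; each
  -- contributes one factor in `K`.
  refine ⟨K ^ (N + 1), hpow _, fun x y hy => ?_⟩
  have hy' : ccDist ip 𝓗 x y < ENNReal.ofReal r := hy
  simp only [ccDist, iInf_lt_iff] at hy'
  obtain ⟨γ, u, ⟨h, h0, h1⟩, hlen⟩ := hy'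
  set f : ℝ → ℝ≥0∞ := fun t => ENNReal.ofReal (√(ip.inner (u t) (u t))) with hf
  have hlen' : ∫⁻ t in Icc (0 : ℝ) 1, f t < ENNReal.ofReal r := hlen
  have hcont := continuousOn_primitive_lintegral hlen'.ne_top
  have hfin : ∀ s t : ℝ, 0 ≤ s → t ≤ 1 → ∫⁻ τ in Ioc s t, f τ ≠ ⊤ := fun s t hs ht =>
    ne_top_of_le_ne_top hlen'.ne_top
      (lintegral_mono_set (Ioc_subset_Icc_self.trans (Icc_subset_Icc hs ht)))
  have key : ∀ (k : ℕ) (t : ℝ), t ∈ Icc (0 : ℝ) 1 → (∫⁻ τ in Ioc 0 t, f τ).toReal ≤ (k + 1) * ε →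
      ∃ z ∈ K ^ (k + 1), γ t = x * z := by
    have step : ∀ s t : ℝ, 0 ≤ s → s ≤ t → t ≤ 1 → (∫⁻ τ in Ioc s t, f τ).toReal ≤ ε →
        (γ s)⁻¹ * γ t ∈ K := by
      intro s t hs hst ht hle
      by_contra hnot
      have hb := h.enorm_sub_le hφ hC0 hC (γ s)⁻¹ hs hst ht
      rw [image_eq_zero_of_notMem_tsupport hnot, inv_mul_cancel, φ.eq_one] at hb
      have h2 : ∫⁻ τ in Ioc s t, f τ ≤ ENNReal.ofReal ε :=
        (ENNReal.le_ofReal_iff_toReal_le (hfin s t hs ht) hε0.le).2 hle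
      have h3 : ‖(0 : ℝ) - 1‖ₑ ≤ ENNReal.ofReal (C * ε) := by
        rw [ENNReal.ofReal_mul hC0.le]
        exact hb.trans (mul_le_mul_right h2 _)
      have h4 : C * ε = 1 / 2 := by rw [hε]; field_simp
      rw [h4, ← ofReal_norm, ENNReal.ofReal_le_ofReal_iff (by norm_num)] at h3
      norm_num at h3
    intro k
    induction k with
    | zero =>
      intro t ht hle
      have hs := step 0 t le_rfl ht.1 ht.2 (hle.trans_eq (by simp))
      exact ⟨_, by simpa using hs, by rw [h0, mul_inv_cancel_left]⟩
    | succ k ih =>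
      intro t ht hle
      rw [pow_succ]
      by_cases hk : (∫⁻ τ in Ioc 0 t, f τ).toReal ≤ (k + 1) * ε
      · obtain ⟨z, hz, hzt⟩ := ih t ht hk
        exact ⟨z, ⟨z, hz, 1, h1K, mul_one z⟩, hzt⟩
      · have hivt := intermediate_value_Icc ht.1
          (hcont.mono (Icc_subset_Icc le_rfl ht.2))
        obtain ⟨s, hs, hsk⟩ := hivt (show ((k + 1) * ε : ℝ) ∈ _ from
          ⟨by simp; positivity, (not_le.1 hk).le⟩)
        obtain ⟨z, hz, hzs⟩ := ih s ⟨hs.1, hs.2.trans ht.2⟩ hsk.le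
        have hadd : (∫⁻ τ in Ioc 0 t, f τ).toReal =
            (∫⁻ τ in Ioc 0 s, f τ).toReal + (∫⁻ τ in Ioc s t, f τ).toReal := by
          rw [← ENNReal.toReal_add (hfin 0 s le_rfl (hs.2.trans ht.2)) (hfin s t hs.1 ht.2),
            ← lintegral_union measurableSet_Ioc (Ioc_disjoint_Ioc_of_le le_rfl),
            Ioc_union_Ioc_eq_Ioc hs.1 hs.2]
        have hst := step s t hs.1 hs.2 ht.2 (by
          simp only at hsk
          push_cast at hle
          linarith)
        refine ⟨z * ((γ s)⁻¹ * γ t), ⟨z, hz, _, hst, rfl⟩, ?_⟩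
        rw [← mul_assoc, ← hzs, mul_inv_cancel_left]
  obtain ⟨z, hz, hzt⟩ := key N 1 ⟨zero_le_one, le_rfl⟩ (by
    have h2 : ∫⁻ τ in Ioc 0 1, f τ ≤ ENNReal.ofReal r :=
      (lintegral_mono_set Ioc_subset_Icc_self).trans hlen'.le
    have hr : 0 < r := by
      by_contra hr
      rw [ENNReal.ofReal_of_nonpos (not_lt.1 hr)] at hlen'
      exact not_lt_bot hlen'
    refine ((ENNReal.le_ofReal_iff_toReal_le (hfin 0 1 le_rfl le_rfl) hr.le).1 h2).trans ?_
    have := (div_le_iff₀ hε0).1 hN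
    linarith)
  exact ⟨z, hz, hzt.symm.trans h1⟩

end Bounded

end SubRiem

namespace SubRiem

/-! ### Integration by parts -/

section Parts

theorem IsTestFun.mul {n : ℕ} {G : Type*} [TopologicalSpace G]
    [ChartedSpace (EuclideanSpace ℝ (Fin n)) G] {φ ψ : G → ℂ} (hφ : IsTestFun n φ) (hψ : IsTestFun n ψ) :
    IsTestFun n fun x => φ x * ψ x :=
  ⟨(contDiff_mul (𝕜 := ℝ) (𝔸 := ℂ)).contMDiff.comp (hφ.1.prodMk_space hψ.1), hφ.2.mul_right⟩
variable {n : ℕ} {G : Type*} [TopologicalSpace G] [ChartedSpace (EuclideanSpace ℝ (Fin n)) G]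
  [Group G] [LieGroup (𝓡 n) ∞ G]

variable (n G) in
/-- Left division `a⁻¹ b` in the chart at the identity. -/
noncomputable def chartLDiv (p : EuclideanSpace ℝ (Fin n) × EuclideanSpace ℝ (Fin n)) :
    EuclideanSpace ℝ (Fin n) := chartOne n G ((chartInv G p.1)⁻¹ * chartInv G p.2)

theorem contDiffAt_chartLDiv :
    ContDiffAt ℝ ∞ (chartLDiv n G) (chartOrigin n G, chartOrigin n G) := by
  refine contDiffAt_chartOne_comp (ContMDiffAt.mul
    (ContMDiffAt.inv (contMDiffAt_chartInv_comp contDiffAt_fst rfl))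
    (contMDiffAt_chartInv_comp contDiffAt_snd rfl)) ?_
  simp

/-- The differential of the translate of a function at a point of the chart at the identity is
governed by its left-invariant differential, uniformly in the translation. -/
theorem exists_hasFDerivAt_mul_chartInv :
    ∃ (D : EuclideanSpace ℝ (Fin n) → EuclideanSpace ℝ (Fin n) →L[ℝ] EuclideanSpace ℝ (Fin n))
      (M : ℝ), ∀ᶠ z in 𝓝 (chartOrigin n G), ‖D z‖ ≤ M ∧
        ∀ {F : Type*} [NormedAddCommGroup F] [NormedSpace ℝ F] {φ : G → F},
          ContMDiff (𝓡 n) 𝓘(ℝ, F) ∞ φ → ∀ x, HasFDerivAt (fun b => φ (x * chartInv G b))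
            ((leftDeriv (n := n) φ (x * chartInv G z)).comp (D z)) z := by
  have : IsTopologicalGroup G := topologicalGroup_of_lieGroup (𝓡 n) ∞
  have hsm := contDiffAt_chartLDiv (n := n) (G := G)
  have t1 : Tendsto (fun z : EuclideanSpace ℝ (Fin n) => (z, z)) (𝓝 (chartOrigin n G))
      (𝓝 (chartOrigin n G, chartOrigin n G)) := (continuous_id.prodMk continuous_id).tendsto _
  have hc : ContinuousAt (fderiv ℝ (chartLDiv n G)) (chartOrigin n G, chartOrigin n G) :=
    (hsm.fderiv_right (m := 0) (by simp)).continuousAt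
  have hinv : Tendsto (fun p : EuclideanSpace ℝ (Fin n) × EuclideanSpace ℝ (Fin n) =>
      (chartInv G p.1)⁻¹ * chartInv G p.2) (𝓝 (chartOrigin n G, chartOrigin n G)) (𝓝 1) := by
    have ha : Tendsto (fun p : EuclideanSpace ℝ (Fin n) × EuclideanSpace ℝ (Fin n) =>
        chartInv G p.1) (𝓝 (chartOrigin n G, chartOrigin n G)) (𝓝 1) :=
      tendsto_chartInv.comp (continuous_fst.tendsto _)
    have hb : Tendsto (fun p : EuclideanSpace ℝ (Fin n) × EuclideanSpace ℝ (Fin n) =>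
        chartInv G p.2) (𝓝 (chartOrigin n G, chartOrigin n G)) (𝓝 1) :=
      tendsto_chartInv.comp (continuous_snd.tendsto _)
    simpa using ha.inv.mul hb
  have hrec := (hinv.eventually (eventually_chartInv_chartOne (n := n) (G := G))).eventually_nhds
  -- Write `x b = (x z) (z⁻¹ b)` for `b` near `z`. Then `D z` is the derivative of `b ↦ z⁻¹ b` at `b
  -- = z`, which involves neither `x` nor `φ`.
  refine ⟨fun z => (fderiv ℝ (chartLDiv n G) (z, z)).comp (ContinuousLinearMap.inr ℝ _ _),
    (‖fderiv ℝ (chartLDiv n G) (chartOrigin n G, chartOrigin n G)‖ + 1) * 1, ?_⟩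
  have hbd := (hc.norm.eventually_lt_const (lt_add_one _))
  filter_upwards [t1.eventually hbd, t1.eventually hrec, t1.eventually
    ((hsm.of_le (m := 1) (by simp)).eventually (by simp))] with z h1 h2 h3
  refine ⟨(ContinuousLinearMap.opNorm_comp_le _ _).trans (mul_le_mul h1.le
    (ContinuousLinearMap.norm_inr_le_one _ _ _) (norm_nonneg _) (by positivity)), ?_⟩
  intro F _ _ φ hφ x
  have hz : HasFDerivAt (fun b => chartLDiv n G (z, b))
      ((fderiv ℝ (chartLDiv n G) (z, z)).comp (ContinuousLinearMap.inr ℝ _ _)) z := by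
    have := (h3.differentiableAt one_ne_zero).hasFDerivAt.comp z
      ((hasFDerivAt_const z z).prodMk (hasFDerivAt_id z))
    exact this
  have h0 : chartLDiv n G (z, z) = chartOrigin n G := by simp [chartLDiv, chartOrigin]
  have hd := hasFDerivAt_mul_chartInv (hφ.mdifferentiable (by simp) (x * chartInv G z))
  rw [← h0] at hd
  have hcomp := HasFDerivAt.comp (f := fun b => chartLDiv n G (z, b)) z hd hz
  refine hcomp.congr_of_eventuallyEq ?_
  have t2 : Tendsto (fun b : EuclideanSpace ℝ (Fin n) => (z, b)) (𝓝 z) (𝓝 (z, z)) :=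
    (continuous_const.prodMk continuous_id).tendsto _
  filter_upwards [t2.eventually h2] with b hb
  simp only [Function.comp_apply, chartLDiv, hb]
  congr 1
  group

theorem IsTestFun.fieldDeriv_eq {φ : G → ℂ} (h : IsTestFun n φ) (v : GroupLieAlgebra (𝓡 n) G)
    (x : G) : fieldDeriv v φ x = leftDeriv (n := n) φ x v :=
  mfderiv_mulInvariantVectorField_eq_leftDeriv (h.1.mdifferentiable (by simp) x) v

theorem IsTestFun.fieldDeriv_mul {φ ψ : G → ℂ} (hφ : IsTestFun n φ) (hψ : IsTestFun n ψ)
    (v : GroupLieAlgebra (𝓡 n) G) (x : G) :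
    fieldDeriv v (fun y => φ y * ψ y) x = φ x * fieldDeriv v ψ x + ψ x * fieldDeriv v φ x := by
  rw [(hφ.mul hψ).fieldDeriv_eq, hφ.fieldDeriv_eq, hψ.fieldDeriv_eq]
  let w : EuclideanSpace ℝ (Fin n) := v
  have h1 := hasFDerivAt_mul_chartInv (hφ.1.mdifferentiable (by simp) x)
  have h2 := hasFDerivAt_mul_chartInv (hψ.1.mdifferentiable (by simp) x)
  have h3 := (h1.mul h2).fderiv
  have h4 := congrArg (fun L : EuclideanSpace ℝ (Fin n) →L[ℝ] ℂ => L w) h3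
  simp only [chartInv_origin, mul_one] at h4
  exact h4

variable [T2Space G]

theorem exists_contMDiff_bump {U : Set G} (hU : U ∈ 𝓝 (1 : G)) :
    ∃ φ : G → ℝ, ContMDiff (𝓡 n) 𝓘(ℝ, ℝ) ∞ φ ∧ HasCompactSupport φ ∧ φ 1 = 1 ∧
      tsupport φ ⊆ U ∧ ∀ x, φ x ∈ Icc (0 : ℝ) 1 := by
  obtain ⟨f, -, hf⟩ := (SmoothBumpFunction.nhds_basis_tsupport (I := 𝓡 n) (1 : G)).mem_iff.1 hU
  exact ⟨f, f.contMDiff, f.hasCompactSupport, f.eq_one, hf, fun x => ⟨f.nonneg, f.le_one⟩⟩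

variable [MeasurableSpace G] [BorelSpace G] (μ : Measure G) [μ.IsHaarMeasure]

open scoped Pointwise in
-- Differentiation under the integral. For `z` near the origin `chartInv G z` stays in a compact
-- `W`, so the integrands are supported in the compact set `tsupport φ * W⁻¹` and a constant
-- dominates there.
theorem hasFDerivAt_integral_mul_chartInv {F : Type*} [NormedAddCommGroup F] [NormedSpace ℝ F]
    [CompleteSpace F] {φ : G → F} (hφ : ContMDiff (𝓡 n) 𝓘(ℝ, F) ∞ φ)
    (hc : HasCompactSupport φ) :
    HasFDerivAt (fun z => ∫ x, φ (x * chartInv G z) ∂μ)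
      (∫ x, leftDeriv (n := n) φ x ∂μ) (chartOrigin n G) := by
  have : IsTopologicalGroup G := topologicalGroup_of_lieGroup (𝓡 n) ∞
  have : LocallyCompactSpace G := Manifold.locallyCompact_of_finiteDimensional (𝓡 n)
  obtain ⟨D, M, hD⟩ := exists_hasFDerivAt_mul_chartInv (n := n) (G := G)
  obtain ⟨W, hWc, hW⟩ := exists_compact_mem_nhds (1 : G)
  obtain ⟨C, hC⟩ := (continuous_leftDeriv (n := n) hφ).bounded_above_of_compact_support
    (hasCompactSupport_leftDeriv hc)
  have hK : IsCompact (tsupport φ * W⁻¹) := hc.isCompact.mul hWc.inv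
  have hs := hD.and ((tendsto_chartInv (n := n) (G := G)).eventually hW)
  have hcont : ∀ z : EuclideanSpace ℝ (Fin n), Continuous fun x => φ (x * chartInv G z) := fun z =>
    hφ.continuous.comp (continuous_mul_const _)
  have hD0 := hs.self_of_nhds
  -- Uniqueness of the derivative identifies the integrand at the origin without computing `D`
  -- there.
  have hF'0 : ∀ x, (leftDeriv (n := n) φ (x * chartInv G (chartOrigin n G))).comp
      (D (chartOrigin n G)) = leftDeriv (n := n) φ x := fun x =>
    (hD0.1.2 hφ x).unique (hasFDerivAt_mul_chartInv (hφ.mdifferentiable (by simp) x))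
  have key := hasFDerivAt_integral_of_dominated_of_fderiv_le (𝕜 := ℝ) (μ := μ)
    (F := fun z x => φ (x * chartInv G z))
    (F' := fun z x => (leftDeriv (n := n) φ (x * chartInv G z)).comp (D z))
    (bound := (tsupport φ * W⁻¹).indicator fun _ => C * M) (x₀ := chartOrigin n G)
    hs (Eventually.of_forall fun z => ?_) ?_ ?_ (Eventually.of_forall fun x z hz => ?_) ?_
    (Eventually.of_forall fun x z hz => hz.1.2 hφ x)
  · simpa only [hF'0] using key
  · exact ((hcont z).integrable_of_hasCompactSupport
      (hc.comp_homeomorph (Homeomorph.mulRight _))).aestronglyMeasurable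
  · simpa using hφ.continuous.integrable_of_hasCompactSupport hc
  · simp only [hF'0]
    exact ((continuous_leftDeriv hφ).integrable_of_hasCompactSupport
      (hasCompactSupport_leftDeriv hc)).aestronglyMeasurable
  · by_cases hx : x ∈ tsupport φ * W⁻¹
    · rw [indicator_of_mem hx]
      have hC0 : 0 ≤ C := (norm_nonneg _).trans (hC 1)
      exact (ContinuousLinearMap.opNorm_comp_le _ _).trans
        (mul_le_mul (hC _) hz.1.1 (norm_nonneg _) hC0)
    · rw [indicator_of_notMem hx]
      have : x * chartInv G z ∉ tsupport φ := fun h => hx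
        ⟨_, h, (chartInv G z)⁻¹, inv_mem_inv.2 hz.2, by simp⟩
      simp [leftDeriv_eq_zero this]
  · exact (integrableOn_const hK.measure_ne_top).integrable_indicator hK.measurableSet

variable [SecondCountableTopology G]

theorem integral_mul_right_eq {F : Type*} [NormedAddCommGroup F] [NormedSpace ℝ F] (φ : G → F)
    (g : G) : modularFun n g • ∫ x, φ (x * g) ∂μ = ∫ x, φ x ∂μ := by
  have : IsTopologicalGroup G := topologicalGroup_of_lieGroup (𝓡 n) ∞
  have : LocallyCompactSpace G := Manifold.locallyCompact_of_finiteDimensional (𝓡 n)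
  have h1 : ∫ x, φ (x * g) ∂μ = ∫ x, φ x ∂(μ.map (· * g)) :=
    (MeasureTheory.integral_map_equiv (MeasurableEquiv.mulRight g) φ).symm
  rw [h1, Measure.map_right_mul_eq_modularCharacterFun_smul, integral_smul_nnreal_measure,
    NNReal.smul_def, smul_smul]
  have h2 : modularFun n g * (Measure.modularCharacterFun g : ℝ) = 1 := by
    rw [modularFun]
    have := Measure.modularCharacterFun_map_mul g⁻¹ g
    rw [inv_mul_cancel, Measure.modularCharacterFun_map_one] at this
    exact_mod_cast this.symm
  rw [h2, one_smul]

/-- The modular function is the quotient of `∫ φ` by `∫ φ (x * g)`, whose denominator is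
differentiable in `g` at the identity and nonzero. -/
theorem mdifferentiableAt_modularFun :
    MDifferentiableAt (𝓡 n) 𝓘(ℝ, ℝ) (modularFun n : G → ℝ) 1 := by
  have : IsTopologicalGroup G := topologicalGroup_of_lieGroup (𝓡 n) ∞
  have : LocallyCompactSpace G := Manifold.locallyCompact_of_finiteDimensional (𝓡 n)
  obtain ⟨φ, hφ, hc, h1, -, h01⟩ := exists_contMDiff_bump (n := n) (G := G) univ_mem
  have hpos : 0 < ∫ x, φ x ∂(Measure.haar : Measure G) :=
    hφ.continuous.integral_pos_of_hasCompactSupport_nonneg_nonzero hc (fun x => (h01 x).1)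
      (x := 1) (by simp [h1])
  have hd := (hasFDerivAt_integral_mul_chartInv (Measure.haar : Measure G) hφ hc).differentiableAt
  have heq : ∀ g : G, modularFun n g =
      (∫ x, φ x ∂(Measure.haar : Measure G)) / ∫ x, φ (x * g) ∂(Measure.haar : Measure G) := by
    intro g
    have h := integral_mul_right_eq (n := n) (Measure.haar : Measure G) φ g
    have h0 : ∫ x, φ (x * g) ∂(Measure.haar : Measure G) ≠ 0 := fun h0 => by
      rw [h0, smul_zero] at h
      exact hpos.ne h
    rw [eq_div_iff h0, ← h, smul_eq_mul]
  have hd' : DifferentiableAt ℝ (fun z => modularFun n (chartInv G z)) (chartOrigin n G) := by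
    simp only [heq, div_eq_mul_inv]
    exact (hd.inv (by simpa using hpos.ne')).const_mul _
  have hm : MDifferentiableAt (𝓡 n) 𝓘(ℝ, ℝ)
      ((fun z => modularFun n (chartInv G z)) ∘ chartOne n G) (1 : G) :=
    MDifferentiableAt.comp (I' := 𝓘(ℝ, EuclideanSpace ℝ (Fin n))) (1 : G)
      hd'.mdifferentiableAt (contMDiffAt_chartOne.mdifferentiableAt (by simp))
  refine hm.congr_of_eventuallyEq ?_
  filter_upwards [eventually_chartInv_chartOne (n := n) (G := G)] with x hx
  simp [hx]

/-- The function `g ↦ δ(g) ∫ φ (x * g)` is constant. Its derivative at the identity along `v`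
vanishes, and the product rule gives the formula. -/
theorem integral_leftDeriv {F : Type*} [NormedAddCommGroup F] [NormedSpace ℝ F]
    [CompleteSpace F] {φ : G → F} (hφ : ContMDiff (𝓡 n) 𝓘(ℝ, F) ∞ φ)
    (hc : HasCompactSupport φ) (v : GroupLieAlgebra (𝓡 n) G) :
    ∫ x, leftDeriv (n := n) φ x v ∂μ = -(modularDeriv v • ∫ x, φ x ∂μ) := by
  have : IsTopologicalGroup G := topologicalGroup_of_lieGroup (𝓡 n) ∞
  let w : EuclideanSpace ℝ (Fin n) := v
  have h1 := hasFDerivAt_integral_mul_chartInv μ hφ hc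
  have h2 := fderiv_comp_chartInv (mdifferentiableAt_modularFun (n := n) (G := G))
  have h3 := h2.1.hasFDerivAt.smul h1
  have h4 := h3.unique ((hasFDerivAt_const (∫ x, φ x ∂μ) (chartOrigin n G)).congr_of_eventuallyEq
    (Eventually.of_forall fun z => integral_mul_right_eq μ φ (chartInv G z)))
  have h5 := congrArg (fun L : EuclideanSpace ℝ (Fin n) →L[ℝ] F => L w) h4
  have : LocallyCompactSpace G := Manifold.locallyCompact_of_finiteDimensional (𝓡 n)
  have h6 : modularFun n (1 : G) = 1 := by
    rw [modularFun, inv_one, Measure.modularCharacterFun_map_one]; rfl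
  have h7 : fderiv ℝ (fun b => modularFun n (chartInv G b)) (chartOrigin n G) w = modularDeriv v :=
    h2.2 w
  have h8 : (∫ x, leftDeriv (n := n) φ x ∂μ) w = ∫ x, leftDeriv (n := n) φ x w ∂μ :=
    ContinuousLinearMap.integral_apply ((continuous_leftDeriv hφ).integrable_of_hasCompactSupport
      (hasCompactSupport_leftDeriv hc)) w
  simp [h6, h7, h8] at h5
  exact eq_neg_of_add_eq_zero_left h5

/-- Integration by parts for test functions. -/
theorem IsTestFun.integral_fieldDeriv_mul {φ ψ : G → ℂ} (hφ : IsTestFun n φ) (hψ : IsTestFun n ψ)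
    (v : GroupLieAlgebra (𝓡 n) G) :
    ∫ x, fieldDeriv v φ x * ψ x ∂μ =
      -∫ x, φ x * (fieldDeriv v ψ x + modularDeriv v * ψ x) ∂μ := by
  have h := integral_leftDeriv μ (hφ.mul hψ).1 (hφ.mul hψ).2 v
  have h2 : ∫ x, fieldDeriv v (fun y => φ y * ψ y) x ∂μ =
      -(modularDeriv v • ∫ x, φ x * ψ x ∂μ) := by
    rw [← h]
    exact integral_congr_ae (Eventually.of_forall fun x => (hφ.mul hψ).fieldDeriv_eq v x)
  have i1 : Integrable (fun x => φ x * fieldDeriv v ψ x) μ :=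
    (hφ.continuous.mul (hψ.continuous_fieldDeriv v)).integrable_of_hasCompactSupport hφ.2.mul_right
  have i2 : Integrable (fun x => ψ x * fieldDeriv v φ x) μ :=
    (hψ.continuous.mul (hφ.continuous_fieldDeriv v)).integrable_of_hasCompactSupport hψ.2.mul_right
  have i3 : Integrable (fun x => modularDeriv v * (φ x * ψ x)) μ :=
    ((hφ.continuous.mul hψ.continuous).integrable_of_hasCompactSupport hφ.2.mul_right).const_mul _
  simp only [hφ.fieldDeriv_mul hψ v] at h2
  rw [integral_add i1 i2] at h2
  have h3 : ∫ x, φ x * (fieldDeriv v ψ x + modularDeriv v * ψ x) ∂μ =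
      ∫ x, φ x * fieldDeriv v ψ x ∂μ + modularDeriv v * ∫ x, φ x * ψ x ∂μ := by
    rw [← integral_const_mul, ← integral_add i1 i3]
    exact integral_congr_ae (Eventually.of_forall fun x => by ring)
  have h4 : ∫ x, fieldDeriv v φ x * ψ x ∂μ = ∫ x, ψ x * fieldDeriv v φ x ∂μ := by
    simp only [mul_comm]
  rw [h3, h4]
  simp only [Complex.real_smul] at h2
  linear_combination h2

end Parts

end SubRiem

namespace SubRiem

/-! ### The form and its operator -/

section Form

theorem isTestFun_ofReal {n : ℕ} {G : Type*} [TopologicalSpace G]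
    [ChartedSpace (EuclideanSpace ℝ (Fin n)) G] {φ : G → ℝ} (hφ : ContMDiff (𝓡 n) 𝓘(ℝ, ℝ) ∞ φ)
    (hc : HasCompactSupport φ) : IsTestFun n fun x => (φ x : ℂ) :=
  ⟨Complex.ofRealCLM.contDiff.contMDiff.comp hφ, hc.comp_left (g := Complex.ofReal) rfl⟩

theorem integral_lp_zero_mul {G : Type*} [MeasurableSpace G] (μ : Measure G)
    (φ : G → ℂ) : ∫ x, (0 : Lp ℂ 2 μ) x * φ x ∂μ = 0 := by
  rw [← integral_zero G ℂ (μ := μ)]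
  refine integral_congr_ae ?_
  filter_upwards [Lp.coeFn_zero ℂ 2 μ] with x hx
  rw [hx, Pi.zero_apply, zero_mul]

theorem integral_norm_sq_lp {G : Type*} [MeasurableSpace G] (μ : Measure G) (f : Lp ℂ 2 μ) :
    ∫ x, ‖f x‖ ^ 2 ∂μ = ‖f‖ ^ 2 ∧ Integrable (fun x => ‖f x‖ ^ 2) μ := by
  have hi := (memLp_two_iff_integrable_sq_norm (Lp.aestronglyMeasurable f)).1 (Lp.memLp f)
  refine ⟨?_, hi⟩
  have h1 := inner_self_eq_norm_sq_to_K (𝕜 := ℂ) f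
  rw [L2.inner_def] at h1
  simp only [inner_self_eq_norm_sq_to_K] at h1
  have h2 : ∫ x, ((‖f x‖ ^ 2 : ℝ) : ℂ) ∂μ = ((‖f‖ ^ 2 : ℝ) : ℂ) := by
    push_cast
    exact h1
  rw [integral_complex_ofReal] at h2
  exact_mod_cast h2

variable {n : ℕ} {G : Type*} [TopologicalSpace G] [ChartedSpace (EuclideanSpace ℝ (Fin n)) G]
  [Group G] [MeasurableSpace G] [BorelSpace G] (μ : Measure G) [μ.IsHaarMeasure]

/-- The class in `L²` of a test function. -/
noncomputable def IsTestFun.toLp {φ : G → ℂ} (hφ : IsTestFun n φ) : Lp ℂ 2 μ :=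
  (hφ.continuous.memLp_of_hasCompactSupport hφ.2 : MemLp φ 2 μ).toLp

theorem IsTestFun.coeFn_toLp {φ : G → ℂ} (hφ : IsTestFun n φ) : hφ.toLp μ =ᵐ[μ] φ :=
  MemLp.coeFn_toLp _

variable [LieGroup (𝓡 n) ∞ G]

theorem IsTestFun.memLp_fieldDeriv {φ : G → ℂ} (hφ : IsTestFun n φ)
    (v : GroupLieAlgebra (𝓡 n) G) : MemLp (fieldDeriv v φ) 2 μ :=
  (hφ.continuous_fieldDeriv v).memLp_of_hasCompactSupport (hφ.hasCompactSupport_fieldDeriv v)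

variable {ν : ℕ} (X : Fin ν → GroupLieAlgebra (𝓡 n) G) {V : G → ℝ}

theorem form_conj_symm (f g : formDomain μ X V) : conj (form μ X V f g) = form μ X V g f := by
  rw [form, form, ← integral_conj]
  refine integral_congr_ae (Eventually.of_forall fun x => ?_)
  simp [mul_comm, mul_assoc]

theorem form_add_right (hVm : AEStronglyMeasurable V μ) (f g g' : formDomain μ X V) :
    form μ X V f (g + g') = form μ X V f g + form μ X V f g' := by
  rw [← form_conj_symm, form_add_left μ X V hVm, map_add, form_conj_symm, form_conj_symm]

theorem form_smul_right (c : ℂ) (f g : formDomain μ X V) :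
    form μ X V f (c • g) = conj c * form μ X V f g := by
  rw [← form_conj_symm, form_smul_left, map_mul, form_conj_symm]

theorem re_form_self (hVm : AEStronglyMeasurable V μ) (f : formDomain μ X V) :
    (form μ X V f f).re = ∫ x, ((∑ j, ‖weakGrad μ X V j f x‖ ^ 2) +
      V x * ‖(f : Lp ℂ 2 μ) x‖ ^ 2) ∂μ ∧
    Integrable (fun x => (∑ j, ‖weakGrad μ X V j f x‖ ^ 2) + V x * ‖(f : Lp ℂ 2 μ) x‖ ^ 2) μ := by
  have h : ∀ x, ((∑ j, weakGrad μ X V j f x * conj (weakGrad μ X V j f x)) +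
      (V x : ℂ) * (f : Lp ℂ 2 μ) x * conj ((f : Lp ℂ 2 μ) x)).re =
      (∑ j, ‖weakGrad μ X V j f x‖ ^ 2) + V x * ‖(f : Lp ℂ 2 μ) x‖ ^ 2 := by
    intro x
    simp only [mul_assoc, Complex.mul_conj, Complex.normSq_eq_norm_sq]
    norm_cast
  have hi := form_integrable μ X V hVm f f
  constructor
  · rw [form, ← RCLike.re_eq_complex_re, ← integral_re hi]
    exact integral_congr_ae (Eventually.of_forall h)
  · exact hi.re.congr (Eventually.of_forall h)

theorem le_re_form_self (hVm : AEStronglyMeasurable V μ) {c : ℝ} (hc : ∀ᵐ x ∂μ, c ≤ V x)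
    (f : formDomain μ X V) : c * ‖f‖ ^ 2 ≤ (form μ X V f f).re := by
  obtain ⟨h1, h2⟩ := re_form_self μ X hVm f
  obtain ⟨h3, h4⟩ := integral_norm_sq_lp μ (f : Lp ℂ 2 μ)
  rw [h1, Submodule.coe_norm, ← h3, ← integral_const_mul]
  refine integral_mono_ae (h4.const_mul c) h2 ?_
  filter_upwards [hc] with x hx
  have : 0 ≤ ∑ j, ‖weakGrad μ X V j f x‖ ^ 2 := Finset.sum_nonneg fun _ _ => sq_nonneg _
  have := mul_le_mul_of_nonneg_right hx (sq_nonneg ‖(f : Lp ℂ 2 μ) x‖)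
  linarith

variable [T2Space G] [SecondCountableTopology G]

theorem lp_eq_zero_of_integral_mul_eq_zero {g : Lp ℂ 2 μ}
    (h : ∀ φ : G → ℝ, ContMDiff (𝓡 n) 𝓘(ℝ, ℝ) ∞ φ → HasCompactSupport φ →
      ∫ x, g x * (φ x : ℂ) ∂μ = 0) : g = 0 := by
  have : LocallyCompactSpace G := Manifold.locallyCompact_of_finiteDimensional (𝓡 n)
  have hg : LocallyIntegrable g μ := (Lp.memLp g).locallyIntegrable (by norm_num)
  have := ae_eq_zero_of_integral_contMDiff_smul_eq_zero (𝓡 n) hg fun φ hφ hc => by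
    rw [← h φ hφ hc]
    exact integral_congr_ae (Eventually.of_forall fun x => by simp [mul_comm])
  exact (Lp.eq_zero_iff_ae_eq_zero).2 this

/-- Weak derivatives are unique. -/
theorem weakDerivGraph_snd_eq_zero (v : GroupLieAlgebra (𝓡 n) G) (p : Lp ℂ 2 μ × Lp ℂ 2 μ)
    (hp : p ∈ weakDerivGraph μ v) (h0 : p.1 = 0) : p.2 = 0 := by
  refine lp_eq_zero_of_integral_mul_eq_zero (n := n) μ fun φ hφ hc => ?_
  have h := hp _ (isTestFun_ofReal hφ hc)
  rwa [h0, integral_lp_zero_mul, neg_zero] at h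

/-- `Submodule.toLinearPMap` has the prescribed graph only for a single-valued relation; this is
where uniqueness of weak derivatives enters. -/
theorem mem_weakDeriv_graph {v : GroupLieAlgebra (𝓡 n) G} {p : Lp ℂ 2 μ × Lp ℂ 2 μ} :
    p ∈ (weakDeriv μ v).graph ↔ p ∈ weakDerivGraph μ v := by
  rw [weakDeriv, Submodule.toLinearPMap_graph_eq _ (weakDerivGraph_snd_eq_zero μ v)]

theorem IsTestFun.mem_weakDerivGraph {φ : G → ℂ} (hφ : IsTestFun n φ)
    (v : GroupLieAlgebra (𝓡 n) G) :
    (hφ.toLp μ, (hφ.memLp_fieldDeriv μ v).toLp) ∈ weakDerivGraph μ v := by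
  intro ψ hψ
  have h1 : ∫ x, (hφ.memLp_fieldDeriv μ v).toLp (fieldDeriv v φ) x * ψ x ∂μ = ∫ x, fieldDeriv v φ x * ψ x ∂μ := by
    refine integral_congr_ae ?_
    filter_upwards [(hφ.memLp_fieldDeriv μ v).coeFn_toLp] with x hx
    rw [hx]
  have h2 : ∫ x, hφ.toLp μ x * (fieldDeriv v ψ x + modularDeriv v * ψ x) ∂μ =
      ∫ x, φ x * (fieldDeriv v ψ x + modularDeriv v * ψ x) ∂μ := by
    refine integral_congr_ae ?_
    filter_upwards [hφ.coeFn_toLp μ] with x hx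
    rw [hx]
  exact h1.trans ((hφ.integral_fieldDeriv_mul μ hψ v).trans (congrArg Neg.neg h2.symm))

variable (hV : LocallyIntegrable V μ)

theorem weakGrad_eq_of_mem {j : Fin ν} {f : formDomain μ X V} {g : Lp ℂ 2 μ}
    (h : ((f : Lp ℂ 2 μ), g) ∈ weakDerivGraph μ (X j)) : weakGrad μ X V j f = g := by
  have h1 := (mem_weakDeriv_graph μ).2 h
  obtain ⟨y, hy1, hy2⟩ := (LinearPMap.mem_graph_iff _).1 h1
  refine Eq.trans ?_ hy2
  have : y = ⟨f, f.2.1 j⟩ := Subtype.ext hy1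
  rw [this]
  rfl

include hV in
theorem IsTestFun.mem_formDomain {φ : G → ℂ} (hφ : IsTestFun n φ) :
    hφ.toLp μ ∈ formDomain μ X V := by
  refine ⟨fun j => ?_, ?_⟩
  · exact ((LinearPMap.mem_graph_iff _).1
      ((mem_weakDeriv_graph μ).2 (hφ.mem_weakDerivGraph μ (X j)))).elim fun y hy => by
        have := y.2
        rwa [hy.1] at this
  · have h1 : MemLp (fun x => (√|V x| : ℂ) * φ x) 2 μ := by
      have hm : AEStronglyMeasurable (fun x => (√|V x| : ℂ) * φ x) μ :=
        ((Complex.continuous_ofReal.comp (Real.continuous_sqrt.comp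
          continuous_abs)).comp_aestronglyMeasurable hV.aestronglyMeasurable).mul
            hφ.continuous.aestronglyMeasurable
      rw [memLp_two_iff_integrable_sq_norm hm]
      have hc : Continuous fun x => ‖φ x‖ ^ 2 := hφ.continuous.norm.pow 2
      have hs : HasCompactSupport fun x => ‖φ x‖ ^ 2 :=
        hφ.2.comp_left (g := fun z : ℂ => ‖z‖ ^ 2) (by simp)
      refine (LocallyIntegrable.integrable_smul_left_of_hasCompactSupport
        (f := fun x => |V x|) (fun x => (hV x).norm) hc hs).congr
        (Eventually.of_forall fun x => ?_)
      simp [mul_pow, mul_comm]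
    refine (memLp_congr_ae ?_).2 h1
    filter_upwards [hφ.coeFn_toLp μ] with x hx
    rw [hx]

/-- Test functions lie in the form domain and separate the elements of `L²`, so the operator is
single-valued. -/
theorem schrodingerGraph_snd_eq_zero (p : Lp ℂ 2 μ × Lp ℂ 2 μ)
    (hp : p ∈ schrodingerGraph μ X hV) (h0 : p.1 = 0) : p.2 = 0 := by
  obtain ⟨f, hf, hfp⟩ := hp
  have hf0 : f = (0 : ℂ) • f := by
    rw [zero_smul]
    exact Subtype.ext (hf.trans h0)
  refine lp_eq_zero_of_integral_mul_eq_zero (n := n) μ fun φ hφ hc => ?_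
  have h := hfp ⟨_, (isTestFun_ofReal hφ hc).mem_formDomain μ X hV⟩
  rw [hf0, form_smul_left, zero_mul, L2.inner_def] at h
  rw [h]
  refine integral_congr_ae ?_
  filter_upwards [(isTestFun_ofReal hφ hc).coeFn_toLp μ] with x hx
  simp [hx]

/-- An element of the domain of the Schrödinger operator lies in the form domain, and the operator
is given there by the form. -/
theorem schrodinger_apply (f : (schrodinger μ X hV).domain) :
    ∃ u : formDomain μ X V, (u : Lp ℂ 2 μ) = f ∧
      ∀ g : formDomain μ X V, form μ X V u g = inner ℂ (g : Lp ℂ 2 μ) (schrodinger μ X hV f) := by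
  have h : ((f : Lp ℂ 2 μ), schrodinger μ X hV f) ∈ (schrodinger μ X hV).graph :=
    (schrodinger μ X hV).mem_graph f
  have hg : (schrodinger μ X hV).graph = schrodingerGraph μ X hV :=
    Submodule.toLinearPMap_graph_eq _ (schrodingerGraph_snd_eq_zero μ X hV)
  rw [hg] at h
  exact h

theorem schrodinger_symmetric (f g : (schrodinger μ X hV).domain) :
    inner ℂ (schrodinger μ X hV f) (g : Lp ℂ 2 μ) =
      inner ℂ (f : Lp ℂ 2 μ) (schrodinger μ X hV g) := by
  obtain ⟨u, hu, hu'⟩ := schrodinger_apply μ X hV f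
  obtain ⟨w, hw, hw'⟩ := schrodinger_apply μ X hV g
  rw [← hu, ← hw' u, ← form_conj_symm, hu' w, hw, inner_conj_symm]

/-- Points below the lower bound of the form belong to the resolvent set. -/
theorem exists_isResolvent (hdisc : (schrodinger μ X hV).HasPurelyDiscreteSpectrum) {c z : ℝ}
    (hc : ∀ᵐ x ∂μ, c ≤ V x) (hz : z < c) :
    ∃ R, (schrodinger μ X hV).IsResolvent (z : ℂ) R := by
  -- A point outside the resolvent set would be an eigenvalue, by pure discreteness; its eigenvector
  -- `u` has `Q(u,u) = z ‖u‖²`, below the bound `c ‖u‖²`.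
  by_contra hR
  have hmem : (z : ℂ) ∈ (schrodinger μ X hV).unboundedSpectrum := fun h => hR h
  obtain ⟨f, hf, hf0⟩ := Submodule.exists_mem_ne_zero_of_ne_bot (hdisc.2 _ hmem).1
  have hTf : schrodinger μ X hV f = (z : ℂ) • (f : Lp ℂ 2 μ) := sub_eq_zero.1 hf
  obtain ⟨u, hu, hu'⟩ := schrodinger_apply μ X hV f
  have h1 := hu' u
  rw [hTf, hu, inner_smul_right, inner_self_eq_norm_sq_to_K] at h1
  have h2 := le_re_form_self μ X hV.aestronglyMeasurable hc u
  have h3 : (form μ X V u u).re = z * ‖u‖ ^ 2 := by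
    have h4 : (z : ℂ) * (‖(f : Lp ℂ 2 μ)‖ : ℂ) ^ 2 =
        ((z * ‖(f : Lp ℂ 2 μ)‖ ^ 2 : ℝ) : ℂ) := by push_cast; rfl
    rw [Submodule.coe_norm, hu]
    exact (congrArg Complex.re (h1.trans h4)).trans (Complex.ofReal_re _)
  have h4 : 0 < ‖u‖ := by
    rw [Submodule.coe_norm, hu]
    exact norm_pos_iff.2 fun h => hf0 (Subtype.ext h)
  rw [h3] at h2
  nlinarith [pow_pos h4 2]

/-- The variational lower bound for the resolvent below the form. -/
theorem one_le_mul_re_inner_resolvent {c : ℝ} (hc : ∀ᵐ x ∂μ, c ≤ V x) {z : ℝ} (hz : z < c)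
    {R : Lp ℂ 2 μ →L[ℂ] Lp ℂ 2 μ} (hR : (schrodinger μ X hV).IsResolvent (z : ℂ) R)
    {f : formDomain μ X V} (hf : ‖(f : Lp ℂ 2 μ)‖ = 1) {C : ℝ} (hC0 : 0 < C)
    (hC : (form μ X V f f).re - z ≤ C) :
    1 ≤ C * (inner ℂ (f : Lp ℂ 2 μ) (R f)).re := by
  obtain ⟨hu, hu'⟩ := hR.1 f
  obtain ⟨u, huR, hform⟩ := schrodinger_apply μ X hV ⟨R f, hu⟩
  have hT : schrodinger μ X hV ⟨R f, hu⟩ = f + (z : ℂ) • R f := sub_eq_iff_eq_add.1 hu'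
  have hVm := hV.aestronglyMeasurable
  change (u : Lp ℂ 2 μ) = R f at huR
  -- Let `q = Q - z ≥ 0` and `u = R f`. Then `q(f,u) = ‖f‖² = 1` and `q(u,u)` has real part `Re ⟨f,
  -- R f⟩`. Thus `0 ≤ q(f - C u) ≤ C - 2 C + C² Re ⟨f, R f⟩`, and dividing by `C` gives the bound.
  have hlow := le_re_form_self μ X hVm hc (f + (-C : ℂ) • u)
  have huf : form μ X V u f = 1 + z * inner ℂ (f : Lp ℂ 2 μ) (R f) := by
    rw [hform, hT, inner_add_right, inner_smul_right, inner_self_eq_norm_sq_to_K, hf]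
    norm_num
  have hfu : form μ X V f u = 1 + z * conj (inner ℂ (f : Lp ℂ 2 μ) (R f)) := by
    rw [← form_conj_symm, huf]
    simp
  have huu : form μ X V u u = conj (inner ℂ (f : Lp ℂ 2 μ) (R f)) + z * (‖R f‖ : ℂ) ^ 2 := by
    rw [hform, hT, inner_add_right, inner_smul_right, huR, inner_self_eq_norm_sq_to_K,
      inner_conj_symm]
    rfl
  have hexp : (form μ X V (f + (-C : ℂ) • u) (f + (-C : ℂ) • u)).re =
      (form μ X V f f).re - 2 * C * (1 + z * (inner ℂ (f : Lp ℂ 2 μ) (R f)).re) +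
        C ^ 2 * ((inner ℂ (f : Lp ℂ 2 μ) (R f)).re + z * ‖R f‖ ^ 2) := by
    rw [form_add_left μ X V hVm, form_add_right μ X hVm, form_add_right μ X hVm, form_smul_left,
      form_smul_left, form_smul_right, form_smul_right, huf, hfu, huu]
    have : ((‖R f‖ : ℂ) ^ 2) = ((‖R f‖ ^ 2 : ℝ) : ℂ) := by push_cast; rfl
    rw [this]
    generalize (‖R f‖ ^ 2 : ℝ) = s
    generalize inner ℂ (f : Lp ℂ 2 μ) (R f) = w
    simp
    ring
  have hnorm : ‖f + (-C : ℂ) • u‖ ^ 2 =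
      1 - 2 * C * (inner ℂ (f : Lp ℂ 2 μ) (R f)).re + C ^ 2 * ‖R f‖ ^ 2 := by
    rw [Submodule.coe_norm, Submodule.coe_add, Submodule.coe_smul, huR, norm_add_sq (𝕜 := ℂ), hf,
      inner_smul_right, norm_smul]
    simp [abs_of_pos hC0]
    ring
  rw [hexp] at hlow
  have h0 : z * ‖f + (-C : ℂ) • u‖ ^ 2 ≤ c * ‖f + (-C : ℂ) • u‖ ^ 2 :=
    mul_le_mul_of_nonneg_right hz.le (sq_nonneg _)
  have h1 := h0.trans hlow
  rw [hnorm] at h1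
  have h2 : 0 ≤ C * (C * (inner ℂ (f : Lp ℂ 2 μ) (R f)).re - 1) := by nlinarith
  linarith [nonneg_of_mul_nonneg_right h2 hC0]

/-- If the spectrum is purely discrete, the form is unbounded along orthonormal sequences. -/
theorem not_bddAbove_form_orthonormal (hdisc : (schrodinger μ X hV).HasPurelyDiscreteSpectrum)
    {c : ℝ} (hc : ∀ᵐ x ∂μ, c ≤ V x) {f : ℕ → formDomain μ X V}
    (hf : Orthonormal ℂ fun k => (f k : Lp ℂ 2 μ)) (C : ℝ)
    (hC : ∀ k, (form μ X V (f k) (f k)).re ≤ C) : False := by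
  obtain ⟨R, hR⟩ := exists_isResolvent μ X hV hdisc hc (sub_one_lt c)
  have ht := hR.tendsto_inner_orthonormal (schrodinger_symmetric μ X hV) hdisc hf
  have ht' := (Complex.continuous_re.tendsto _).comp ht
  -- A positive constant dominating `C - z` for `z = c - 1`.
  have hpos : 0 < |C - (c - 1)| + 1 := by positivity
  have hb := fun k => one_le_mul_re_inner_resolvent μ X hV hc (sub_one_lt c) hR (hf.1 k) hpos
    (by linarith [hC k, le_abs_self (C - (c - 1))])
  have := ge_of_tendsto' (ht'.const_mul (|C - (c - 1)| + 1)) hb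
  norm_num at this

end Form

end SubRiem

namespace SubRiem

/-! ### Translates of a test function -/

section Translates

/-- The integral of the potential against a function supported in a ball, and bounded by one, is
controlled by its integral over the ball. -/
theorem integral_mul_le_setIntegral {G : Type*} [TopologicalSpace G] [T2Space G]
    [LocallyCompactSpace G] [MeasurableSpace G] [BorelSpace G] (μ : Measure G)
    [IsFiniteMeasureOnCompacts μ] {V : G → ℝ} (hV : LocallyIntegrable V μ) {c : ℝ} (hc : ∀ᵐ x ∂μ, c ≤ V x) {φ : G → ℝ}
    (hφ : Continuous φ) (hφc : HasCompactSupport φ) (h01 : ∀ x, φ x ∈ Icc (0 : ℝ) 1)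
    {B K : Set G} (hB : tsupport φ ⊆ B) (hBK : B ⊆ K) (hK : IsCompact K) :
    ∫ x, V x * φ x ∂μ ≤ ∫ x in B, V x ∂μ + |c| * μ.real K + c * ∫ x, φ x ∂μ := by
  have hVB : IntegrableOn V B μ := (hV.integrableOn_isCompact hK).mono_set hBK
  have hBfin : μ B ≠ ⊤ := measure_ne_top_of_subset hBK hK.measure_ne_top
  have hcB : IntegrableOn (fun _ => c) B μ := integrableOn_const hBfin
  have i1 : Integrable (fun x => V x * φ x) μ :=
    hV.integrable_smul_right_of_hasCompactSupport hφ hφc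
  have i2 : Integrable φ μ := hφ.integrable_of_hasCompactSupport hφc
  have hS : MeasurableSet (tsupport φ) := (isClosed_tsupport φ).measurableSet
  -- Subtracting `c` makes the integrand nonnegative. The comparison passes through the closed
  -- support of `φ`, since `B` is not assumed measurable.
  have hle : ∫ x, (V x - c) * φ x ∂μ ≤ ∫ x in tsupport φ, (V x - c) ∂μ := by
    rw [← integral_indicator hS]
    refine integral_mono_ae ?_ (((hVB.sub hcB).mono_set hB).integrable_indicator hS) ?_
    · refine (i1.sub (i2.const_mul c)).congr (Eventually.of_forall fun x => ?_)
      simp only [Pi.sub_apply]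
      ring
    · filter_upwards [hc] with x hx
      by_cases h : x ∈ tsupport φ
      · rw [indicator_of_mem h]
        exact mul_le_of_le_one_right (sub_nonneg.2 hx) (h01 x).2
      · rw [indicator_of_notMem h, image_eq_zero_of_notMem_tsupport h, mul_zero]
  have hle2 : ∫ x in tsupport φ, (V x - c) ∂μ ≤ ∫ x in B, (V x - c) ∂μ := by
    refine setIntegral_mono_set (hVB.sub hcB) (ae_restrict_of_ae ?_) (Eventually.of_forall hB)
    filter_upwards [hc] with x hx
    exact sub_nonneg.2 hx
  have e1 : ∫ x in B, (V x - c) ∂μ = ∫ x in B, V x ∂μ - c * μ.real B := by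
    rw [integral_sub hVB hcB, setIntegral_const, smul_eq_mul, mul_comm]
  have e2 : ∫ x, (V x - c) * φ x ∂μ = ∫ x, V x * φ x ∂μ - c * ∫ x, φ x ∂μ := by
    rw [← integral_const_mul, ← integral_sub i1 (i2.const_mul c)]
    exact integral_congr_ae (Eventually.of_forall fun x => by ring)
  have e3 : -(c * μ.real B) ≤ |c| * μ.real K :=
    calc -(c * μ.real B) ≤ |c * μ.real B| := neg_le_abs _
      _ = |c| * μ.real B := by rw [abs_mul, abs_of_nonneg measureReal_nonneg]
      _ ≤ |c| * μ.real K := mul_le_mul_of_nonneg_left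
        (measureReal_mono hBK hK.measure_ne_top) (abs_nonneg c)
  linarith

/-- A property which holds arbitrarily far away holds at the points of a sequence which have disjoint
translates of a given compact set. -/
theorem exists_seq_disjoint {G : Type*} [TopologicalSpace G] [Group G]
    [IsTopologicalGroup G] {P : G → Prop} (hP : ∃ᶠ x in cocompact G, P x) {K : Set G} (hK : IsCompact K) :
    ∃ x : ℕ → G, (∀ k, P (x k)) ∧
      ∀ k l, k ≠ l → ∀ y, (x k)⁻¹ * y ∉ K ∨ (x l)⁻¹ * y ∉ K := by
  obtain ⟨x, hx, hx'⟩ := exists_seq_of_forall_finset_exists P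
    (fun a b => ∀ y, a⁻¹ * y ∉ K ∨ b⁻¹ * y ∉ K) fun s _ => by
      have hc : ∀ a ∈ s, ∀ᶠ b in cocompact G, ∀ y, a⁻¹ * y ∉ K ∨ b⁻¹ * y ∉ K := by
        intro a _
        -- If `a⁻¹ y` and `b⁻¹ y` are both in `K`, then `b = a (a⁻¹ y) (b⁻¹ y)⁻¹` lies in the
        -- compact set `a K K⁻¹`.
        have hK2 : IsCompact ((fun p : G × G => a * p.1 * p.2⁻¹) '' K ×ˢ K) :=
          (hK.prod hK).image (by fun_prop)
        filter_upwards [hK2.compl_mem_cocompact] with b hb y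
        by_contra! h
        exact hb ⟨(a⁻¹ * y, b⁻¹ * y), ⟨h.1, h.2⟩, by group⟩
      obtain ⟨y, hy⟩ := (hP.and_eventually ((Finset.eventually_all s).2 hc)).exists
      exact ⟨y, hy⟩
  refine ⟨x, hx, fun k l hkl y => ?_⟩
  rcases lt_or_gt_of_ne hkl with h | h
  · exact hx' k l h y
  · exact (hx' l k h y).symm

variable {n : ℕ} {G : Type*} [TopologicalSpace G] [ChartedSpace (EuclideanSpace ℝ (Fin n)) G]
  [Group G]

section

variable [MeasurableSpace G] [BorelSpace G] (μ : Measure G) [μ.IsHaarMeasure]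

theorem IsTestFun.norm_toLp_sq {φ : G → ℂ} (hφ : IsTestFun n φ) :
    ‖hφ.toLp μ‖ ^ 2 = ∫ x, ‖φ x‖ ^ 2 ∂μ := by
  rw [← (integral_norm_sq_lp μ (hφ.toLp μ)).1]
  refine integral_congr_ae ?_
  filter_upwards [hφ.coeFn_toLp μ] with x hx
  rw [hx]

theorem IsTestFun.inner_toLp_eq_zero {φ ψ : G → ℂ} (hφ : IsTestFun n φ) (hψ : IsTestFun n ψ)
    (h : ∀ x, φ x = 0 ∨ ψ x = 0) : inner ℂ (hφ.toLp μ) (hψ.toLp μ) = 0 := by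
  rw [L2.inner_def, ← integral_zero G ℂ (μ := μ)]
  refine integral_congr_ae ?_
  filter_upwards [hφ.coeFn_toLp μ, hψ.coeFn_toLp μ] with x hx hx'
  rw [hx, hx']
  rcases h x with h | h <;> simp [h]

end

variable [LieGroup (𝓡 n) ∞ G]

theorem IsTestFun.comp_mul_left {φ : G → ℂ} (hφ : IsTestFun n φ) (g : G) :
    IsTestFun n fun y => φ (g * y) := by
  have : IsTopologicalGroup G := topologicalGroup_of_lieGroup (𝓡 n) ∞
  exact ⟨hφ.1.comp (contMDiff_mul_left (a := g)), hφ.2.comp_homeomorph (Homeomorph.mulLeft g)⟩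

theorem IsTestFun.fieldDeriv_comp_mul_left {φ : G → ℂ} (hφ : IsTestFun n φ) (g : G)
    (v : GroupLieAlgebra (𝓡 n) G) (y : G) :
    fieldDeriv v (fun y => φ (g * y)) y = fieldDeriv v φ (g * y) := by
  rw [(hφ.comp_mul_left g).fieldDeriv_eq, hφ.fieldDeriv_eq]
  exact congrArg (fun L : EuclideanSpace ℝ (Fin n) →L[ℝ] ℂ => L v) (leftDeriv_comp_mul_left φ g y)

variable [MeasurableSpace G] [BorelSpace G] (μ : Measure G) [μ.IsHaarMeasure]
  [T2Space G] [SecondCountableTopology G]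
  {ν : ℕ} (X : Fin ν → GroupLieAlgebra (𝓡 n) G) {V : G → ℝ} (hV : LocallyIntegrable V μ)

theorem IsTestFun.re_form {φ : G → ℂ} (hφ : IsTestFun n φ) :
    (form μ X V ⟨hφ.toLp μ, hφ.mem_formDomain μ X hV⟩ ⟨hφ.toLp μ, hφ.mem_formDomain μ X hV⟩).re =
      ∫ x, ∑ j, ‖fieldDeriv (X j) φ x‖ ^ 2 ∂μ + ∫ x, V x * ‖φ x‖ ^ 2 ∂μ := by
  have i1 : Integrable (fun x => ∑ j, ‖fieldDeriv (X j) φ x‖ ^ 2) μ :=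
    integrable_finsetSum _ fun j _ => (memLp_two_iff_integrable_sq_norm
      (hφ.memLp_fieldDeriv μ (X j)).1).1 (hφ.memLp_fieldDeriv μ (X j))
  have i2 : Integrable (fun x => V x * ‖φ x‖ ^ 2) μ :=
    hV.integrable_smul_right_of_hasCompactSupport (hφ.continuous.norm.pow 2)
      (hφ.2.comp_left (g := fun z : ℂ => ‖z‖ ^ 2) (by simp))
  rw [(re_form_self μ X hV.aestronglyMeasurable _).1, ← integral_add i1 i2]
  refine integral_congr_ae ?_
  have h : ∀ᵐ x ∂μ, ∀ j, weakGrad μ X V j ⟨hφ.toLp μ, hφ.mem_formDomain μ X hV⟩ x =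
      fieldDeriv (X j) φ x := ae_all_iff.2 fun j => by
    rw [weakGrad_eq_of_mem μ X (f := ⟨hφ.toLp μ, hφ.mem_formDomain μ X hV⟩)
      (hφ.mem_weakDerivGraph μ (X j))]
    exact MemLp.coeFn_toLp _
  filter_upwards [h, hφ.coeFn_toLp μ] with x hx hx'
  simp only [hx, hx']

end Translates

end SubRiem

/-! ### The translated bumps and the contradiction -/

theorem corollary4p2
    {n : ℕ} {G : Type*} [TopologicalSpace G] [T2Space G] [SecondCountableTopology G]
    [ChartedSpace (EuclideanSpace ℝ (Fin n)) G] [Group G] [LieGroup (𝓡 n) ∞ G]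
    [ConnectedSpace G] [NoncompactSpace G]
    [MeasurableSpace G] [BorelSpace G]
    -- a left Haar measure
    (μ : Measure G) [μ.IsHaarMeasure]
    -- a scalar product on the Lie algebra, and a subspace generating it as a Lie algebra
    (ip : InnerProductSpace.Core ℝ (GroupLieAlgebra (𝓡 n) G))
    (𝓗 : Submodule ℝ (GroupLieAlgebra (𝓡 n) G))
    (h𝓗 : LieSubalgebra.lieSpan ℝ (GroupLieAlgebra (𝓡 n) G) (𝓗 : Set (GroupLieAlgebra (𝓡 n) G)) = ⊤)
    -- an orthonormal basis of the subspace
    {ν : ℕ} (X : Fin ν → GroupLieAlgebra (𝓡 n) G)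
    (hX : ∀ i j, ip.inner (X i) (X j) = if i = j then 1 else 0)
    (hXspan : Submodule.span ℝ (Set.range X) = 𝓗)
    -- a locally integrable potential, essentially bounded from below
    (V : G → ℝ) (hV : LocallyIntegrable V μ) (hVbdd : ∃ c : ℝ, ∀ᵐ x ∂μ, c ≤ V x)
    (hdisc : (SubRiem.schrodinger μ X hV).HasPurelyDiscreteSpectrum) :
    ∀ r : ℝ, 0 < r →
      Tendsto (fun x : G => ∫ y in SubRiem.ccBall ip 𝓗 x r, V y ∂μ) (cocompact G) atTop := by
  have : IsTopologicalGroup G := topologicalGroup_of_lieGroup (𝓡 n) ∞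
  have : LocallyCompactSpace G := Manifold.locallyCompact_of_finiteDimensional (𝓡 n)
  obtain ⟨c, hc⟩ := hVbdd
  intro r hr
  by_contra hnot
  obtain ⟨M, hM⟩ : ∃ M, ∃ᶠ x in cocompact G, ∫ y in SubRiem.ccBall ip 𝓗 x r, V y ∂μ < M := by
    simp only [tendsto_atTop, not_forall, not_eventually, not_le] at hnot
    exact hnot
  obtain ⟨φ, hφ, hφc, hφ1, hφU, h01⟩ :=
    SubRiem.exists_contMDiff_bump (n := n) (SubRiem.ccBall_one_mem_nhds (ip := ip) h𝓗 hr)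
  obtain ⟨K, hK, hKB⟩ := SubRiem.exists_isCompact_ccBall_subset ip 𝓗 r
  obtain ⟨x, hxM, hdisj⟩ := SubRiem.exists_seq_disjoint hM hφc.isCompact
  have hΦ := SubRiem.isTestFun_ofReal hφ hφc
  have hΦk := fun k => hΦ.comp_mul_left (x k)⁻¹
  have hφsq : Continuous fun y => φ y ^ 2 := hφ.continuous.pow 2
  have hφsqc : HasCompactSupport fun y => φ y ^ 2 := hφc.comp_left (g := fun t : ℝ => t ^ 2) (by simp)
  -- By left invariance of `μ`, `N` is the squared norm of every translate.
  set N : ℝ := ∫ y, φ y ^ 2 ∂μ with hN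
  have hNpos : 0 < N := hφsq.integral_pos_of_hasCompactSupport_nonneg_nonzero hφsqc
    (fun y => sq_nonneg _) (x := 1) (by simp [hφ1])
  have hnorm : ∀ k, ‖(hΦk k).toLp μ‖ ^ 2 = N := fun k => by
    rw [(hΦk k).norm_toLp_sq μ, hN]
    simp only [Complex.norm_real, Real.norm_eq_abs, sq_abs]
    exact integral_mul_left_eq_self (fun y => φ y ^ 2) (x k)⁻¹
  have hform : ∀ k, (SubRiem.form μ X V ⟨_, (hΦk k).mem_formDomain μ X hV⟩
      ⟨_, (hΦk k).mem_formDomain μ X hV⟩).re ≤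
      ∫ y, ∑ j, ‖SubRiem.fieldDeriv (X j) (fun y => (φ y : ℂ)) y‖ ^ 2 ∂μ +
        (M + |c| * μ.real K + c * N) := fun k => by
    rw [(hΦk k).re_form μ X hV]
    simp only [hΦ.fieldDeriv_comp_mul_left, Complex.norm_real, Real.norm_eq_abs, sq_abs]
    rw [integral_mul_left_eq_self
      (fun y => ∑ j, ‖SubRiem.fieldDeriv (X j) (fun y => (φ y : ℂ)) y‖ ^ 2) (x k)⁻¹]
    have hsupp : tsupport (fun y => φ ((x k)⁻¹ * y) ^ 2) ⊆ SubRiem.ccBall ip 𝓗 (x k) r := by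
      intro y hy
      have hy' : (x k)⁻¹ * y ∈ tsupport φ := by
        by_contra h
        refine notMem_tsupport_iff_eventuallyEq.2 ?_ hy
        have ht : Tendsto (fun y => (x k)⁻¹ * y) (𝓝 y) (𝓝 ((x k)⁻¹ * y)) :=
          (continuous_const_mul _).tendsto _
        filter_upwards [ht.eventually (notMem_tsupport_iff_eventuallyEq.1 h)] with z hz
        simp [hz]
      simpa using SubRiem.mul_mem_ccBall (x := x k) (hφU hy')
    have hKx : IsCompact ((fun y => x k * y) '' K) := hK.image (continuous_const_mul _)
    -- The potential energy carries the weight `|φ|²`, so the comparison is applied to the square of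
    -- the translated bump.
    have h := SubRiem.integral_mul_le_setIntegral μ hV hc
      (hφsq.comp (continuous_const_mul (x k)⁻¹))
      (hφsqc.comp_homeomorph (Homeomorph.mulLeft (x k)⁻¹))
      (fun y => ⟨sq_nonneg _, pow_le_one₀ (h01 _).1 (h01 _).2⟩) hsupp (hKB (x k)) hKx
    have hμ : μ.real ((fun y => x k * y) '' K) = μ.real K := by
      rw [measureReal_def, image_mul_left, measure_preimage_mul, measureReal_def]
    have hNk : ∫ y, ((fun y => φ y ^ 2) ∘ fun y => (x k)⁻¹ * y) y ∂μ = N :=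
      integral_mul_left_eq_self (fun y => φ y ^ 2) (x k)⁻¹
    rw [hμ, hNk] at h
    have := hxM k
    simp only [Function.comp_apply] at h
    linarith
  have hs : 0 < √N := Real.sqrt_pos.2 hNpos
  -- Disjoint supports give orthogonality, and normalising by `1 / √N` scales the form by `N⁻¹`.
  refine SubRiem.not_bddAbove_form_orthonormal μ X hV hdisc hc
    (f := fun k => ((√N)⁻¹ : ℂ) • ⟨_, (hΦk k).mem_formDomain μ X hV⟩) ⟨fun k => ?_, fun k l hkl => ?_⟩
    (N⁻¹ * (∫ y, ∑ j, ‖SubRiem.fieldDeriv (X j) (fun y => (φ y : ℂ)) y‖ ^ 2 ∂μ +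
        (M + |c| * μ.real K + c * N))) fun k => ?_
  · change ‖((√N)⁻¹ : ℂ) • (hΦk k).toLp μ‖ = 1
    rw [norm_smul, ← Real.sqrt_sq (norm_nonneg ((hΦk k).toLp μ)), hnorm k]
    simp [abs_of_pos hs, hs.ne']
  · simp only [Submodule.coe_smul, inner_smul_left, inner_smul_right]
    rw [(hΦk k).inner_toLp_eq_zero μ (hΦk l) fun y => ?_]
    · simp
    · refine (hdisj k l hkl y).imp (fun h => ?_) fun h => ?_ <;>
        simp [image_eq_zero_of_notMem_tsupport h]
  · rw [SubRiem.form_smul_left, SubRiem.form_smul_right, ← mul_assoc]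
    have hcoef : ((√N)⁻¹ : ℂ) * conj ((√N)⁻¹ : ℂ) = ((N⁻¹ : ℝ) : ℂ) := by
      rw [map_inv₀, Complex.conj_ofReal, ← mul_inv, ← Complex.ofReal_mul,
        Real.mul_self_sqrt hNpos.le, Complex.ofReal_inv]
    rw [hcoef, Complex.re_ofReal_mul]
    exact mul_le_mul_of_nonneg_left (hform k) (inv_nonneg.2 hNpos.le)
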